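/- For $a\in\mathbb{R}$ and $n\in\mathbb{Z}_{>0}$ let $d_a(n)=\sum_{d\mid n}d^{a}$, and let $\chi(1-s)=2(2\pi)^{-s}\cos\left(\frac{\pi s}{2}\right)\Gamma(s)$, so that $\zeta(1-s)=\chi(1-s)\zeta(s)$. Let $T\geq 100$, $X=\frac{T}{2\pi}$, $0<\lambda<\frac12$ and $\frac14\leq\tau\leq\frac12$, let $\mathcal{C}$ be the contour formed by the three segments joining successively the points $1-\tau-iT$, $2-2\tau+\lambda-iT$, $2-2\tau+\lambda+iT$, $1-\tau+iT$, and put $$I=\frac{1}{2i}\int_{\mathcal{C}}\chi(1-s)\left(\sum_{n\leq X}\frac{d_{1-2\tau}(n)}{n^{s}}\right)ds.$$ Write $f=g+O^*(h)$ for $|f-g|\leq h$, and let $\gamma$ be the Euler--Mascheroni constant. If $\tau=\frac12$, then $$I=T\log(T)+(2\gamma-1-\log(2\pi))T+O^{*}\left(19.275\,\sqrt{T}\log(T)\right),$$ whereas, if $\frac14\leq\tau<\frac12$, then $$I=\frac{\zeta(2-2\tau)}{(2-2\tau)(2\pi)^{1-2\tau}}T^{2-2\tau}+\zeta(2\tau)T+O^{*}\left(\left(\frac{1.99}{\frac12-\tau}+35.354\right)T^{\frac32-2\tau}\log(T)\right).$$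 -/

import Mathlib

noncomputable section

/-- The generalized sum-of-divisors function `d_a(n) = ∑_{d ∣ n} d ^ a`, for a real exponent `a`. -/
def divisorPowerSum (a : ℝ) (n : ℕ) : ℝ :=
  ∑ d ∈ n.divisors, (d : ℝ) ^ a

/-- The factor `χ` of the functional equation `ζ(w) = χ(w) ζ(1 - w)`, in the normalization
`χ(1 - s) = 2 (2π)^(-s) cos(π s / 2) Γ(s)`, written in the variable `w = 1 - s`.
Only `Re w < 1` (i.e. `Re s > 0`) is used, where `χ` has no singularity. -/
def chiFactor (w : ℂ) : ℂ :=
  2 * (2 * (Real.pi : ℂ)) ^ (-(1 - w)) * Complex.cos ((Real.pi : ℂ) * (1 - w) / 2)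
    * Complex.Gamma (1 - w)

/-- The integral `∫_C f(s) ds` along the polygonal contour `C` made of the three segments
`1-τ-iT → 2-2τ+lam-iT → 2-2τ+lam+iT → 1-τ+iT`, each parametrized by its varying coordinate
(so `ds = dσ` on the horizontal segments, `ds = i dt` on the vertical one). -/
def contourIntegral (τ lam T : ℝ) (f : ℂ → ℂ) : ℂ :=
  (∫ σ : ℝ in (1 - τ)..(2 - 2 * τ + lam), f ((σ : ℂ) - (T : ℂ) * Complex.I))
    + Complex.I *
      (∫ t : ℝ in (-T)..T, f (((2 - 2 * τ + lam : ℝ) : ℂ) + (t : ℂ) * Complex.I))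
    + (∫ σ : ℝ in (2 - 2 * τ + lam)..(1 - τ), f ((σ : ℂ) + (T : ℂ) * Complex.I))

/-- The Dirichlet polynomial `∑_{1 ≤ n ≤ X} d_a(n) n^(-s)`. -/
def divisorDirichletPoly (a X : ℝ) (s : ℂ) : ℂ :=
  ∑ n ∈ Finset.Icc 1 ⌊X⌋₊, (divisorPowerSum a n : ℂ) * (n : ℂ) ^ (-s)

/-- `I = (1 / 2i) ∫_C χ(1 - s) ∑_{n ≤ X} d_{1-2τ}(n) n^(-s) ds`. -/
def integralI (τ lam T X : ℝ) : ℂ :=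
  1 / (2 * Complex.I) *
    contourIntegral τ lam T
      (fun s => chiFactor (1 - s) * divisorDirichletPoly (1 - 2 * τ) X s)

end

/-!
The function `χ(1 - s)` equals `xiFactor s = (2π)^(-s) π / (sin (πs/2) Γ(1 - s))`, whose poles in
`Re s < 2` are `0, -2, -4, …`. Write `D(s)` for the Dirichlet polynomial and `α = 1 - 2τ`. The
contour is deformed to the left. Summed over all the poles, the residues of `χ(1 - s) D(s)` are
`2 ∑ d_α(n) cos (2πn) = 2 ∑_{n ≤ X} d_α(n)`, because `∑ (-1)^j (2πn)^(2j) / (2j)!` is the cosine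
series. Hence `I` is `2π ∑_{n ≤ X} d_α(n)` plus what remains of the contour, and the theorem becomes
Dirichlet's divisor problem with an explicit error term.

The deformed contour runs from the endpoints `1 - τ ± iT` along the heights `±T` to `Re s = -K`,
with `K` the odd integer next to `√X`, and from there vertically to infinity
(`norm_contour_sub_tsum_le`).
By Stirling's formula `|χ(1 - s)|` is about `(t / 2π)^(Re s - 1/2)`, that is `X^(Re s - 1/2)` at
height `T = 2πX` (`norm_xiFactor_le`).

* On the vertical half-lines this decays fast enough in `t` for a trivial bound of `D`: the choice
  of `K` makes `D(s)` as small as `X^(α + K + 1/2) log X`.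
* On the horizontal part with `Re s ≥ -2`, the trivial bound of `D` suffices as well.
* On the horizontal part with `Re s = -κ ≤ -2`, whose length is about `√X`, it would lose a factor
  of size `√X`. There `D(-κ + iT)` is written by the hyperbola method as a sum over `a ≤ √X` of sums
  over `b ≤ X/a` with phase `-X log b`, to which van der Corput's second derivative test applies
  (`norm_sum_unitExp_le_of_separated`, built on the Kuzmin–Landau inequality). As `T = 2πX` is tied
  to the length of the sum, the differences of the phase increase by at least `a²/X`, which gives
  `norm_divisorDirichletPoly_le_vanDerCorput`.

Altogether `I = 2π ∑_{n ≤ X} d_α(n) + O(X^(α + 1/2) log X)` (`norm_integralI_sub_sum_le`). The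
divisor sums are evaluated with error `O(X^(α + 1/2))` by the hyperbola method, for `α = 0` in
`abs_sum_divisorPowerSum_zero_sub_le` and for `0 < α ≤ 1/2` in `abs_sum_divisorPowerSum_sub_le`. The
latter needs the values `ζ(1 + α)` and `ζ(1 - α)` as limits of partial sums with the main term
removed; `exists_riemannZeta_eq` obtains them by continuing an Euler–Maclaurin series to `Re s > 0`.
-/

open Filter Topology

/-! ### A lower bound of Stirling type for the Gamma function -/

/-- One term of the sum for `Re (Γ'/Γ)` is at most the integral of `y / (y² + t²)` over the unit
interval centred at `y`, up to an error that telescopes. -/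
lemma div_sq_add_sq_le_log_sub (y t : ℝ) (hy : 1 / 2 ≤ y) (ht : 1 ≤ t) :
    y / (y ^ 2 + t ^ 2) ≤
      (Real.log ((y + 1 / 2) ^ 2 + t ^ 2) / 2 - 1 / (4 * ((y + 1 / 2) ^ 2 + t ^ 2))) -
      (Real.log ((y - 1 / 2) ^ 2 + t ^ 2) / 2 - 1 / (4 * ((y - 1 / 2) ^ 2 + t ^ 2))) := by
  have hP : 0 < (y + 1 / 2) ^ 2 + t ^ 2 := by positivity
  have hQ : 0 < (y - 1 / 2) ^ 2 + t ^ 2 := by positivity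
  have h1 := Real.lt_log_one_add_of_pos (x := 2 * y / ((y - 1 / 2) ^ 2 + t ^ 2)) (by positivity)
  have e1 : 1 + 2 * y / ((y - 1 / 2) ^ 2 + t ^ 2)
      = ((y + 1 / 2) ^ 2 + t ^ 2) / ((y - 1 / 2) ^ 2 + t ^ 2) := by
    field_simp; ring
  rw [e1, Real.log_div hP.ne' hQ.ne'] at h1
  have e2 : 2 * (2 * y / ((y - 1 / 2) ^ 2 + t ^ 2)) / (2 * y / ((y - 1 / 2) ^ 2 + t ^ 2) + 2)
      = 2 * y / (y ^ 2 + t ^ 2 + 1 / 4) := by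
    rw [div_add' _ _ _ hQ.ne', ← mul_div_assoc, div_div_div_cancel_right₀ hQ.ne',
      div_eq_div_iff (by nlinarith) (by positivity)]
    ring
  rw [e2] at h1
  have h2 : y / (y ^ 2 + t ^ 2) - y / (y ^ 2 + t ^ 2 + 1 / 4)
      ≤ 1 / (4 * ((y - 1 / 2) ^ 2 + t ^ 2)) - 1 / (4 * ((y + 1 / 2) ^ 2 + t ^ 2)) := by
    rw [div_sub_div _ _ (by positivity) (by positivity), div_sub_div _ _ (by positivity)
      (by positivity), div_le_div_iff₀ (by positivity) (by positivity)]
    have hA : 0 ≤ y ^ 2 + t ^ 2 - 1 / 4 := by nlinarith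
    nlinarith [mul_nonneg (by linarith : (0 : ℝ) ≤ y) (mul_nonneg hA
      (by positivity : 0 ≤ y ^ 2 + t ^ 2 + 1 / 4)), mul_nonneg (by linarith : (0 : ℝ) ≤ y) (sq_nonneg y), sq_nonneg t]
  have : 2 * y / (y ^ 2 + t ^ 2 + 1 / 4) = 2 * (y / (y ^ 2 + t ^ 2 + 1 / 4)) := by ring
  linarith

lemma sum_div_sq_add_sq_le (x t : ℝ) (hx : 1 / 2 ≤ x) (ht : 1 ≤ t) (n : ℕ) :
    ∑ j ∈ Finset.range (n + 1), (x + j) / ((x + j) ^ 2 + t ^ 2) ≤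
      Real.log ((x + n + 1 / 2) ^ 2 + t ^ 2) / 2 - Real.log t + 1 / (4 * t ^ 2) := by
  have h : ∀ j ∈ Finset.range (n + 1), (x + j) / ((x + j) ^ 2 + t ^ 2) ≤
      (Real.log ((x + (j + 1 : ℕ) - 1 / 2) ^ 2 + t ^ 2) / 2
        - 1 / (4 * ((x + (j + 1 : ℕ) - 1 / 2) ^ 2 + t ^ 2))) -
      (Real.log ((x + j - 1 / 2) ^ 2 + t ^ 2) / 2 - 1 / (4 * ((x + j - 1 / 2) ^ 2 + t ^ 2))) := by
    intro j _
    have := div_sq_add_sq_le_log_sub (x + j) t (by have : (0:ℝ) ≤ j := j.cast_nonneg; linarith) ht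
    convert this using 6 <;> push_cast <;> ring
  refine (Finset.sum_le_sum h).trans ?_
  rw [Finset.sum_range_sub (fun j : ℕ => Real.log ((x + j - 1 / 2) ^ 2 + t ^ 2) / 2
        - 1 / (4 * ((x + j - 1 / 2) ^ 2 + t ^ 2)))]
  have ht0 : 0 < t := by linarith
  have h1 : Real.log t ≤ Real.log ((x + (0 : ℕ) - 1 / 2) ^ 2 + t ^ 2) / 2 := by
    have : Real.log (t ^ 2) ≤ Real.log ((x + (0 : ℕ) - 1 / 2) ^ 2 + t ^ 2) :=
      Real.log_le_log (by positivity) (by nlinarith [sq_nonneg (x + (0 : ℕ) - 1 / 2)])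
    rw [Real.log_pow] at this
    push_cast at this ⊢
    linarith
  have h2 : 1 / (4 * ((x + (0 : ℕ) - 1 / 2) ^ 2 + t ^ 2)) ≤ 1 / (4 * t ^ 2) := by
    apply one_div_le_one_div_of_le (by positivity)
    nlinarith [sq_nonneg (x + (0 : ℕ) - 1 / 2)]
  have h3 : 0 ≤ 1 / (4 * ((x + (n + 1 : ℕ) - 1 / 2) ^ 2 + t ^ 2)) := by positivity
  have h4 : x + (n + 1 : ℕ) - 1 / 2 = x + n + 1 / 2 := by push_cast; ring
  rw [h4] at h3 ⊢
  linarith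

lemma norm_GammaSeq (x t : ℝ) (ht : 1 ≤ t) (n : ℕ) (hn : 0 < n) :
    ‖Complex.GammaSeq (x + t * Complex.I) n‖ = n.factorial *
      Real.exp (x * Real.log n -
        ∑ j ∈ Finset.range (n + 1), Real.log ((x + j) ^ 2 + t ^ 2) / 2) := by
  have hn' : (0 : ℝ) < n := by exact_mod_cast hn
  rw [Complex.GammaSeq, norm_div, norm_mul, Complex.norm_natCast_cpow_of_pos hn, norm_prod,
    Complex.norm_natCast, Real.exp_sub, Real.exp_sum, Real.rpow_def_of_pos hn']
  have : ∀ j ∈ Finset.range (n + 1), ‖(x + t * Complex.I + j : ℂ)‖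
      = Real.exp (Real.log ((x + j) ^ 2 + t ^ 2) / 2) := by
    intro j _
    have e : (x + t * Complex.I + j : ℂ) = ((x + j : ℝ) : ℂ) + (t : ℂ) * Complex.I := by
      push_cast; ring
    have hp : 0 < (x + j) ^ 2 + t ^ 2 := by positivity
    rw [e, Complex.norm_add_mul_I, Real.sqrt_eq_rpow, Real.rpow_def_of_pos hp]
    congr 1; ring
  rw [Finset.prod_congr rfl this]
  simp only [Complex.add_re, Complex.ofReal_re, Complex.mul_re, Complex.I_re, mul_zero,
    Complex.ofReal_im, Complex.I_im, mul_one, sub_zero, add_zero]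
  rw [mul_comm (Real.log n) x]
  ring

/-- Mean value inequality in `x` for `log ‖GammaSeq (x + it) n‖`, whose derivative is bounded below
by `sum_div_sq_add_sq_le`. -/
lemma norm_GammaSeq_half_le (x t : ℝ) (hx : 1 / 2 ≤ x) (hx' : x ≤ 3 / 2) (ht : 1 ≤ t) (n : ℕ)
    (hn : 0 < n) :
    ‖Complex.GammaSeq ((1 / 2 : ℝ) + t * Complex.I) n‖ *
      Real.exp ((Real.log n - (Real.log ((n + 2 : ℝ) ^ 2 + t ^ 2) / 2 - Real.log t
        + 1 / (4 * t ^ 2))) * (x - 1 / 2))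
      ≤ ‖Complex.GammaSeq (x + t * Complex.I) n‖ := by
  rw [norm_GammaSeq x t ht n hn, norm_GammaSeq (1 / 2) t ht n hn, mul_assoc, ← Real.exp_add]
  gcongr
  have hpos : ∀ (y : ℝ) (j : ℕ), 0 < (y + j) ^ 2 + t ^ 2 := fun y j => by positivity
  have hd : ∀ y : ℝ, HasDerivAt (fun y : ℝ => y * Real.log n -
      ∑ j ∈ Finset.range (n + 1), Real.log ((y + j) ^ 2 + t ^ 2) / 2)
      (Real.log n - ∑ j ∈ Finset.range (n + 1), (y + j) / ((y + j) ^ 2 + t ^ 2)) y := by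
    intro y
    refine HasDerivAt.sub ?_ ?_
    · simpa using (hasDerivAt_id y).mul_const (Real.log n)
    · refine HasDerivAt.fun_sum (fun j _ => ?_)
      have h0 : HasDerivAt (fun y : ℝ => (y + j) ^ 2 + t ^ 2) (2 * (y + j)) y := by
        simpa using (((hasDerivAt_id y).add_const (j : ℝ)).pow 2).add_const (t ^ 2)
      have := (h0.log (hpos y j).ne').div_const 2
      exact this.congr_deriv (by ring)
  have key := (convex_Icc (1 / 2 : ℝ) (3 / 2)).mul_sub_le_image_sub_of_le_deriv
    (f := fun y : ℝ => y * Real.log n -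
      ∑ j ∈ Finset.range (n + 1), Real.log ((y + j) ^ 2 + t ^ 2) / 2)
    (fun y _ => (hd y).continuousAt.continuousWithinAt)
    (fun y _ => (hd y).differentiableAt.differentiableWithinAt)
    (C := Real.log n - (Real.log ((n + 2 : ℝ) ^ 2 + t ^ 2) / 2 - Real.log t + 1 / (4 * t ^ 2)))
    (by
      intro y hy
      rw [interior_Icc] at hy
      rw [(hd y).deriv]
      have h1 := sum_div_sq_add_sq_le y t hy.1.le ht n
      have h2 : Real.log ((y + n + 1 / 2) ^ 2 + t ^ 2) ≤ Real.log ((n + 2 : ℝ) ^ 2 + t ^ 2) := by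
        apply Real.log_le_log (by positivity)
        have : y + n + 1 / 2 ≤ n + 2 := by linarith [hy.2]
        have h0 : 0 ≤ y + n + 1 / 2 := by
          have := hy.1
          positivity
        gcongr
      linarith)
    (1 / 2) (by constructor <;> norm_num) x ⟨hx, hx'⟩ hx
  linarith

lemma tendsto_log_sub_log_sq_add_sq (t : ℝ) (ht : 1 ≤ t) :
    Tendsto (fun n : ℕ => Real.log n - Real.log ((n + 2 : ℝ) ^ 2 + t ^ 2) / 2) atTop (𝓝 0) := by
  have h1 : Tendsto (fun n : ℕ => (1 + 2 * (1 / (n : ℝ))) ^ 2 + t ^ 2 * (1 / (n : ℝ)) ^ 2) atTop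
      (𝓝 ((1 + 2 * 0) ^ 2 + t ^ 2 * 0 ^ 2)) := by
    have := tendsto_one_div_atTop_nhds_zero_nat (𝕜 := ℝ)
    exact ((tendsto_const_nhds.add (this.const_mul 2)).pow 2).add ((this.pow 2).const_mul _)
  have h2 := (h1.log (by norm_num)).const_mul (-1 / 2 : ℝ)
  have e : (-1 / 2 : ℝ) * Real.log ((1 + 2 * 0) ^ 2 + t ^ 2 * 0 ^ 2) = 0 := by simp
  rw [e] at h2
  refine h2.congr' ?_
  filter_upwards [eventually_gt_atTop 0] with n hn
  have hn' : (0 : ℝ) < n := by exact_mod_cast hn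
  have : (1 + 2 * (1 / (n : ℝ))) ^ 2 + t ^ 2 * (1 / (n : ℝ)) ^ 2
      = ((n + 2 : ℝ) ^ 2 + t ^ 2) / (n : ℝ) ^ 2 := by
    field_simp
  rw [this, Real.log_div (by positivity) (by positivity), Real.log_pow]
  push_cast
  ring

/-- The limit `n → ∞` of `norm_GammaSeq_half_le`: moving from `Re s = 1/2` to `Re s = x`, the
modulus of `Γ` gains at least the factor `t ^ (x - 1/2)`, up to `exp (-1/(4t²))`. -/
lemma norm_Gamma_half_mul_le (x t : ℝ) (hx : 1 / 2 ≤ x) (hx' : x ≤ 3 / 2) (ht : 1 ≤ t) :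
    ‖Complex.Gamma ((1 / 2 : ℝ) + t * Complex.I)‖ *
      Real.exp ((Real.log t - 1 / (4 * t ^ 2)) * (x - 1 / 2))
      ≤ ‖Complex.Gamma (x + t * Complex.I)‖ := by
  have h1 := (Complex.GammaSeq_tendsto_Gamma (x + t * Complex.I)).norm
  have h2 := (Complex.GammaSeq_tendsto_Gamma ((1 / 2 : ℝ) + t * Complex.I)).norm
  have h3 : Tendsto (fun n : ℕ => Real.exp ((Real.log n - (Real.log ((n + 2 : ℝ) ^ 2 + t ^ 2) / 2
      - Real.log t + 1 / (4 * t ^ 2))) * (x - 1 / 2))) atTop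
      (𝓝 (Real.exp ((Real.log t - 1 / (4 * t ^ 2)) * (x - 1 / 2)))) := by
    apply Tendsto.rexp
    apply Tendsto.mul_const
    have := (tendsto_log_sub_log_sq_add_sq t ht).add_const (Real.log t - 1 / (4 * t ^ 2))
    rw [zero_add] at this
    exact this.congr (fun n => by ring)
  refine le_of_tendsto_of_tendsto (h2.mul h3) h1 ?_
  filter_upwards [eventually_gt_atTop 0] with n hn
  exact norm_GammaSeq_half_le x t hx hx' ht n hn

/-- A lower bound of Stirling type for `|Γ|` on all of `Re s ≥ 1/4`, relative to the line
`Re s = 1/2`, where the modulus is known exactly. -/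
lemma rpow_mul_norm_Gamma_half_le (x t : ℝ) (hx : 1 / 4 ≤ x) (ht : 100 ≤ t) :
    0.999 * t ^ (x - 1 / 2) * ‖Complex.Gamma ((1 / 2 : ℝ) + t * Complex.I)‖
      ≤ ‖Complex.Gamma (x + t * Complex.I)‖ := by
  have ht0 : 0 < t := by linarith
  have hG := norm_nonneg (Complex.Gamma ((1 / 2 : ℝ) + t * Complex.I))
  have base : ∀ x : ℝ, 1 / 2 ≤ x → x ≤ 3 / 2 →
      0.9999 * t ^ (x - 1 / 2) * ‖Complex.Gamma ((1 / 2 : ℝ) + t * Complex.I)‖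
        ≤ ‖Complex.Gamma (x + t * Complex.I)‖ := by
    intro x hx hx'
    refine le_trans ?_ (norm_Gamma_half_mul_le x t hx hx' (by linarith))
    rw [mul_comm]
    gcongr
    rw [Real.rpow_def_of_pos ht0, sub_mul, Real.exp_sub, le_div_iff₀ (Real.exp_pos _)]
    have h1 : Real.exp (1 / (4 * t ^ 2) * (x - 1 / 2)) ≤ 1.00005 := by
      have h2 : 1 / (4 * t ^ 2) * (x - 1 / 2) ≤ 0.000025 := by
        have : 1 / (4 * t ^ 2) ≤ 0.000025 := by
          rw [div_le_iff₀ (by positivity)]; nlinarith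
        nlinarith [show (0 : ℝ) ≤ 1 / (4 * t ^ 2) by positivity]
      have h3 : 0 ≤ 1 / (4 * t ^ 2) * (x - 1 / 2) :=
        mul_nonneg (by positivity) (by linarith)
      have := Real.exp_bound_div_one_sub_of_interval h3 (by linarith)
      refine this.trans ?_
      rw [div_le_iff₀ (by linarith)]
      nlinarith
    have h4 := Real.exp_pos (Real.log t * (x - 1 / 2))
    nlinarith [Real.exp_pos (1 / (4 * t ^ 2) * (x - 1 / 2))]
  have step : ∀ m : ℕ, ∀ x : ℝ, 1 / 2 + m ≤ x → x ≤ 3 / 2 + m →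
      0.9999 * t ^ (x - 1 / 2) * ‖Complex.Gamma ((1 / 2 : ℝ) + t * Complex.I)‖
        ≤ ‖Complex.Gamma (x + t * Complex.I)‖ := by
    intro m
    induction m with
    | zero => intro x h1 h2; push_cast at h1 h2; exact base x (by linarith) (by linarith)
    | succ m ih =>
      intro x h1 h2
      push_cast at h1 h2
      have h3 := ih (x - 1) (by linarith) (by linarith)
      have hne : ((x - 1 : ℝ) + t * Complex.I : ℂ) ≠ 0 := by
        intro h
        have := congrArg Complex.im h
        simp at this
        exact ht0.ne' this
      have h4 : (x + t * Complex.I : ℂ) = ((x - 1 : ℝ) + t * Complex.I : ℂ) + 1 := by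
        push_cast; ring
      rw [h4, Complex.Gamma_add_one _ hne, norm_mul]
      have h5 : t ≤ ‖((x - 1 : ℝ) + t * Complex.I : ℂ)‖ := by
        have := Complex.abs_im_le_norm ((x - 1 : ℝ) + t * Complex.I : ℂ)
        simp only [Complex.add_im, Complex.ofReal_im, Complex.mul_im, Complex.ofReal_re,
          Complex.I_im, mul_one, Complex.I_re, mul_zero, add_zero, zero_add] at this
        exact (le_abs_self t).trans this
      have h6 : t ^ (x - 1 / 2) = t * t ^ (x - 1 - 1 / 2) := by
        rw [show x - 1 / 2 = 1 + (x - 1 - 1 / 2) by ring, Real.rpow_add ht0, Real.rpow_one]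
      rw [h6]
      calc 0.9999 * (t * t ^ (x - 1 - 1 / 2)) * ‖Complex.Gamma ((1 / 2 : ℝ) + t * Complex.I)‖
          = t * (0.9999 * t ^ (x - 1 - 1 / 2) *
              ‖Complex.Gamma ((1 / 2 : ℝ) + t * Complex.I)‖) := by ring
        _ ≤ _ := by gcongr
  have half : ∀ x : ℝ, 1 / 2 ≤ x →
      0.9999 * t ^ (x - 1 / 2) * ‖Complex.Gamma ((1 / 2 : ℝ) + t * Complex.I)‖
        ≤ ‖Complex.Gamma (x + t * Complex.I)‖ := by
    intro x hx
    have h1 := Nat.floor_le (show 0 ≤ x - 1 / 2 by linarith)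
    have h2 := Nat.lt_floor_add_one (x - 1 / 2)
    exact step ⌊x - 1 / 2⌋₊ x (by linarith) (by linarith)
  have hp : 0 < t ^ (x - 1 / 2) := Real.rpow_pos_of_pos ht0 _
  rcases le_total (1 / 2) x with h | h
  · refine le_trans ?_ (half x h)
    gcongr
    norm_num
  · have h3 := half (x + 1) (by linarith)
    have hne : (x + t * Complex.I : ℂ) ≠ 0 := by
      intro h
      have := congrArg Complex.im h
      simp at this
      exact ht0.ne' this
    have h4 : ((x + 1 : ℝ) + t * Complex.I : ℂ) = (x + t * Complex.I : ℂ) + 1 := by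
      push_cast; ring
    rw [h4, Complex.Gamma_add_one _ hne, norm_mul] at h3
    have h5 : ‖(x + t * Complex.I : ℂ)‖ ≤ 1.0001 * t := by
      rw [Complex.norm_add_mul_I]
      apply Real.sqrt_le_iff.mpr
      constructor
      · positivity
      · nlinarith
    have h6 : t ^ (x + 1 - 1 / 2) = t * t ^ (x - 1 / 2) := by
      rw [show x + 1 - 1 / 2 = 1 + (x - 1 / 2) by ring, Real.rpow_add ht0, Real.rpow_one]
    rw [h6] at h3
    have h7 : t * (0.9999 * t ^ (x - 1 / 2) * ‖Complex.Gamma ((1 / 2 : ℝ) + t * Complex.I)‖)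
        ≤ t * (1.0001 * ‖Complex.Gamma (x + t * Complex.I)‖) := by
      calc _ = 0.9999 * (t * t ^ (x - 1 / 2)) *
            ‖Complex.Gamma ((1 / 2 : ℝ) + t * Complex.I)‖ := by ring
        _ ≤ _ := h3
        _ ≤ 1.0001 * t * ‖Complex.Gamma (x + t * Complex.I)‖ := by gcongr
        _ = _ := by ring
    have h8 := le_of_mul_le_mul_left h7 ht0
    have h9 : 0 ≤ t ^ (x - 1 / 2) * ‖Complex.Gamma ((1 / 2 : ℝ) + t * Complex.I)‖ := by positivity
    linarith

lemma norm_sq_Gamma_half (t : ℝ) :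
    ‖Complex.Gamma ((1 / 2 : ℝ) + t * Complex.I)‖ ^ 2 = Real.pi / Real.cosh (Real.pi * t) := by
  have h := Complex.Gamma_mul_Gamma_one_sub ((1 / 2 : ℝ) + t * Complex.I)
  have h1 : (1 : ℂ) - ((1 / 2 : ℝ) + t * Complex.I)
      = (starRingEnd ℂ) ((1 / 2 : ℝ) + t * Complex.I) := by
    simp only [map_add, map_mul, Complex.conj_ofReal, Complex.conj_I]
    push_cast; ring
  have h2 : Complex.sin (Real.pi * ((1 / 2 : ℝ) + t * Complex.I))
      = (Real.cosh (Real.pi * t) : ℂ) := by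
    rw [show (Real.pi * ((1 / 2 : ℝ) + t * Complex.I) : ℂ)
      = (Real.pi * t : ℂ) * Complex.I + Real.pi / 2 by push_cast; ring,
      Complex.sin_add_pi_div_two, Complex.cos_mul_I]
    push_cast; rfl
  rw [h1, Complex.Gamma_conj, Complex.mul_conj, h2, Complex.normSq_eq_norm_sq] at h
  exact_mod_cast h

lemma norm_sq_Gamma_one (t : ℝ) (ht : t ≠ 0) :
    ‖Complex.Gamma ((1 : ℝ) + t * Complex.I)‖ ^ 2
      = Real.pi * t / Real.sinh (Real.pi * t) := by
  have hne : (t * Complex.I : ℂ) ≠ 0 := by simpa using ht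
  have h := Complex.Gamma_mul_Gamma_one_sub (t * Complex.I)
  have h1 : (1 : ℂ) - t * Complex.I = (starRingEnd ℂ) ((1 : ℝ) + t * Complex.I) := by
    simp only [map_add, map_mul, Complex.conj_ofReal, Complex.conj_I]
    push_cast; ring
  have h2 : Complex.Gamma ((1 : ℝ) + t * Complex.I)
      = t * Complex.I * Complex.Gamma (t * Complex.I) := by
    rw [← Complex.Gamma_add_one _ hne, add_comm]; simp
  have h3 : Complex.sin (Real.pi * (t * Complex.I))
      = (Real.sinh (Real.pi * t) : ℂ) * Complex.I := by
    rw [← mul_assoc, Complex.sin_mul_I]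
    push_cast; rfl
  have h4 : Complex.Gamma ((1 : ℝ) + t * Complex.I)
      * (starRingEnd ℂ) (Complex.Gamma ((1 : ℝ) + t * Complex.I))
      = ((Real.pi * t / Real.sinh (Real.pi * t) : ℝ) : ℂ) := by
    rw [← Complex.Gamma_conj, ← h1]
    conv_lhs => rw [h2]
    rw [mul_assoc, h, h3]
    have : (Real.sinh (Real.pi * t) : ℂ) ≠ 0 := by
      norm_cast
      rw [Real.sinh_eq_zero]
      exact mul_ne_zero Real.pi_ne_zero ht
    push_cast at this ⊢
    field_simp
  rw [Complex.mul_conj, Complex.normSq_eq_norm_sq] at h4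
  exact_mod_cast h4

/-! ### The factor `χ(1 - s)` and its size -/

/-- The function `χ(1 - s)` rewritten by the reflection formula for `Γ`, so that on `Re s < 2` its
only singularities are the simple poles `0, -2, -4, …` coming from `sin (π s / 2)`. -/
noncomputable def xiFactor (s : ℂ) : ℂ :=
  (2 * (Real.pi : ℂ)) ^ (-s) * Real.pi * (Complex.sin (Real.pi * s / 2))⁻¹
    * (Complex.Gamma (1 - s))⁻¹

lemma chiFactor_one_sub_eq_xiFactor (s : ℂ) (hs : Complex.sin (Real.pi * s) ≠ 0) :
    chiFactor (1 - s) = xiFactor s := by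
  have h := Complex.Gamma_mul_Gamma_one_sub s
  have h2 : Complex.sin (Real.pi * s)
      = 2 * Complex.sin (Real.pi * s / 2) * Complex.cos (Real.pi * s / 2) := by
    rw [← Complex.sin_two_mul]; congr 1; ring
  rw [h2] at hs h
  have hs1 : Complex.sin (Real.pi * s / 2) ≠ 0 := fun h0 => hs (by simp [h0])
  have hs2 : Complex.cos (Real.pi * s / 2) ≠ 0 := fun h0 => hs (by simp [h0])
  have hπ : (Real.pi : ℂ) ≠ 0 := by exact_mod_cast Real.pi_ne_zero
  have hG : Complex.Gamma (1 - s) ≠ 0 := by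
    intro h0
    rw [h0, mul_zero] at h
    exact (div_ne_zero hπ hs) h.symm
  have hΓ : Complex.Gamma s = Real.pi /
      (2 * Complex.sin (Real.pi * s / 2) * Complex.cos (Real.pi * s / 2))
      / Complex.Gamma (1 - s) := by rw [← h]; field_simp
  rw [chiFactor, xiFactor, sub_sub_cancel, hΓ]
  field_simp

lemma norm_two_pi_cpow (s : ℂ) : ‖(2 * (Real.pi : ℂ)) ^ (-s)‖ = (2 * Real.pi) ^ (-s.re) := by
  have : (2 * (Real.pi : ℂ)) = ((2 * Real.pi : ℝ) : ℂ) := by push_cast; ring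
  rw [this, Complex.norm_cpow_eq_rpow_re_of_pos (by positivity), Complex.neg_re]

lemma norm_xiFactor_conj (s : ℂ) : ‖xiFactor ((starRingEnd ℂ) s)‖ = ‖xiFactor s‖ := by
  have h1 : (Real.pi : ℂ) * (starRingEnd ℂ) s / 2 = (starRingEnd ℂ) (Real.pi * s / 2) := by
    rw [map_div₀, map_mul, Complex.conj_ofReal, Complex.conj_ofNat]
  have h2 : 1 - (starRingEnd ℂ) s = (starRingEnd ℂ) (1 - s) := by simp
  simp only [xiFactor, norm_mul, norm_inv]
  rw [h1, h2, Complex.sin_conj, Complex.Gamma_conj, RCLike.norm_conj, RCLike.norm_conj,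
    norm_two_pi_cpow, norm_two_pi_cpow, Complex.conj_re]

lemma sq_norm_sin_add_mul_I (x y : ℝ) :
    ‖Complex.sin (x + y * Complex.I)‖ ^ 2 = Real.sin x ^ 2 + Real.sinh y ^ 2 := by
  have : Complex.sin (x + y * Complex.I) = ((Real.sin x * Real.cosh y : ℝ) : ℂ)
      + ((Real.cos x * Real.sinh y : ℝ) : ℂ) * Complex.I := by
    rw [Complex.sin_add_mul_I]; push_cast; ring
  rw [this, Complex.norm_add_mul_I, Real.sq_sqrt (by positivity), mul_pow, mul_pow, Real.cosh_sq,
    Real.cos_sq']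
  ring

lemma sinh_le_norm_sin (x y : ℝ) : Real.sinh y ≤ ‖Complex.sin (x + y * Complex.I)‖ := by
  refine le_of_abs_le (sq_le_sq.mp ?_ |>.trans (abs_of_nonneg (norm_nonneg _)).le)
  rw [sq_norm_sin_add_mul_I]
  nlinarith [sq_nonneg (Real.sin x)]

lemma sqrt_pi_div_two_le_sinh_mul (t : ℝ) (ht : 100 ≤ t) :
    0.999 * Real.sqrt (Real.pi / 2)
      ≤ Real.sinh (Real.pi * t / 2) * ‖Complex.Gamma ((1 / 2 : ℝ) + t * Complex.I)‖ := by
  have hpi := Real.pi_gt_three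
  have h1 : 150 ≤ Real.pi * t / 2 := by nlinarith
  have h2 : Real.pi * t / 2 ≤ Real.sinh (Real.pi * t / 2) := Real.self_le_sinh_iff.mpr (by linarith)
  have hs : 150 ≤ Real.sinh (Real.pi * t / 2) := h1.trans h2
  have hc : Real.cosh (Real.pi * t) = 1 + 2 * Real.sinh (Real.pi * t / 2) ^ 2 := by
    rw [show Real.pi * t = 2 * (Real.pi * t / 2) by ring, Real.cosh_two_mul, Real.cosh_sq]; ring_nf
  refine (sq_le_sq₀ (by positivity) (by positivity)).mp ?_
  rw [mul_pow, mul_pow, norm_sq_Gamma_half, Real.sq_sqrt (by positivity), hc,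
    mul_div (Real.sinh _ ^ 2), le_div_iff₀ (by positivity)]
  have h3 : 22500 ≤ Real.sinh (Real.pi * t / 2) ^ 2 := by nlinarith
  nlinarith

/-- On `Re s ≤ 3/4`, at height at least `100`, the factor `χ(1 - s)` has the size predicted by
Stirling's formula. -/
lemma norm_xiFactor_le (σ t : ℝ) (hσ : σ ≤ 3 / 4) (ht : 100 ≤ t) :
    ‖xiFactor (σ + t * Complex.I)‖ ≤ 1.01 * (t / (2 * Real.pi)) ^ (σ - 1 / 2) := by
  have ht0 : 0 < t := by linarith
  have hpi := Real.pi_pos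
  have h1 : (1 - (σ + t * Complex.I) : ℂ) = (starRingEnd ℂ) (((1 - σ : ℝ) : ℂ) + t * Complex.I) := by
    simp only [map_add, map_mul, Complex.conj_ofReal, Complex.conj_I]
    push_cast; ring
  have h2 : (Real.pi * (σ + t * Complex.I) / 2 : ℂ)
      = ((Real.pi * σ / 2 : ℝ) : ℂ) + ((Real.pi * t / 2 : ℝ) : ℂ) * Complex.I := by
    push_cast; ring
  simp only [xiFactor, norm_mul, norm_inv]
  rw [h1, Complex.Gamma_conj, RCLike.norm_conj, norm_two_pi_cpow, h2, Complex.norm_real,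
    Real.norm_of_nonneg hpi.le]
  have h3 := rpow_mul_norm_Gamma_half_le (1 - σ) t (by linarith) ht
  have h4 := sinh_le_norm_sin (Real.pi * σ / 2) (Real.pi * t / 2)
  have h5 := sqrt_pi_div_two_le_sinh_mul t ht
  have h6 : 0 < Real.sinh (Real.pi * t / 2) := Real.sinh_pos_iff.mpr (by positivity)
  have h7 : 0 < t ^ (1 - σ - 1 / 2) := Real.rpow_pos_of_pos ht0 _
  have hden : 0.998 * (t ^ (1 - σ - 1 / 2) * Real.sqrt (Real.pi / 2)) ≤
      ‖Complex.sin (((Real.pi * σ / 2 : ℝ) : ℂ) + ((Real.pi * t / 2 : ℝ) : ℂ) * Complex.I)‖ *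
      ‖Complex.Gamma (((1 - σ : ℝ) : ℂ) + t * Complex.I)‖ := by
    calc _ ≤ 0.999 * t ^ (1 - σ - 1 / 2) * (0.999 * Real.sqrt (Real.pi / 2)) := by
          nlinarith [mul_pos h7 (Real.sqrt_pos.mpr (show 0 < Real.pi / 2 by positivity))]
      _ ≤ 0.999 * t ^ (1 - σ - 1 / 2) * (Real.sinh (Real.pi * t / 2) *
            ‖Complex.Gamma ((1 / 2 : ℝ) + t * Complex.I)‖) := by gcongr
      _ = Real.sinh (Real.pi * t / 2) * (0.999 * t ^ (1 - σ - 1 / 2) *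
            ‖Complex.Gamma ((1 / 2 : ℝ) + t * Complex.I)‖) := by ring
      _ ≤ _ := by gcongr
  have hpos : 0 < t ^ (1 - σ - 1 / 2) * Real.sqrt (Real.pi / 2) := by positivity
  rw [mul_assoc, ← mul_inv, ← div_eq_mul_inv]
  have hre : (σ + t * Complex.I : ℂ).re = σ := by simp
  rw [hre]
  have hmain : (2 * Real.pi) ^ (-σ) * Real.pi
      = (t / (2 * Real.pi)) ^ (σ - 1 / 2) * (t ^ (1 - σ - 1 / 2) * Real.sqrt (Real.pi / 2)) := by
    rw [Real.div_rpow ht0.le (by positivity), show 1 - σ - 1 / 2 = -(σ - 1 / 2) by ring,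
      Real.rpow_neg ht0.le, Real.rpow_sub (by positivity : 0 < 2 * Real.pi) σ (1 / 2),
      Real.rpow_neg (by positivity : 0 ≤ 2 * Real.pi), ← Real.sqrt_eq_rpow]
    have e1 : Real.sqrt (2 * Real.pi) * Real.sqrt (Real.pi / 2) = Real.pi := by
      rw [← Real.sqrt_mul (by positivity), show 2 * Real.pi * (Real.pi / 2) = Real.pi ^ 2 by ring,
        Real.sqrt_sq hpi.le]
    have e2 : 0 < t ^ (σ - 1 / 2) := Real.rpow_pos_of_pos ht0 _
    have e3 : 0 < (2 * Real.pi) ^ σ := by positivity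
    field_simp
    linarith
  calc (2 * Real.pi) ^ (-σ) * Real.pi / _
      ≤ (2 * Real.pi) ^ (-σ) * Real.pi / (0.998 * (t ^ (1 - σ - 1 / 2) * Real.sqrt (Real.pi / 2))) := by
        gcongr
    _ = (1 / 0.998) * (t / (2 * Real.pi)) ^ (σ - 1 / 2) := by
        rw [hmain]; field_simp
    _ ≤ _ := by
        gcongr
        norm_num

/-- On `Re s = 1` the modulus of `Γ` is known exactly, and `tanh y ≤ y` makes it at least
`1 / cosh (πt/2)`. -/
lemma one_le_cosh_mul_norm_Gamma_one (t : ℝ) :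
    1 ≤ Real.cosh (Real.pi * t / 2) * ‖Complex.Gamma ((1 : ℝ) + t * Complex.I)‖ := by
  rcases eq_or_ne t 0 with rfl | ht
  · simp
  wlog hpos : 0 < t generalizing t
  · have := this (-t) (neg_ne_zero.mpr ht) (by
      rcases lt_or_gt_of_ne ht with h | h
      · linarith
      · exact absurd h hpos)
    have e : (((1 : ℝ) : ℂ) + ((-t : ℝ) : ℂ) * Complex.I)
        = (starRingEnd ℂ) (((1 : ℝ) : ℂ) + t * Complex.I) := by
      simp
    rw [e, Complex.Gamma_conj, RCLike.norm_conj, show Real.pi * -t / 2 = -(Real.pi * t / 2) by ring,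
      Real.cosh_neg] at this
    exact this
  have hy : 0 < Real.pi * t / 2 := by have := Real.pi_pos; positivity
  have hs : 0 < Real.sinh (Real.pi * t / 2) := Real.sinh_pos_iff.mpr hy
  have hc : 0 < Real.cosh (Real.pi * t / 2) := Real.cosh_pos _
  refine (sq_le_sq₀ (by positivity) (by positivity)).mp ?_
  have e : Real.sinh (Real.pi * t)
      = 2 * Real.sinh (Real.pi * t / 2) * Real.cosh (Real.pi * t / 2) := by
    rw [← Real.sinh_two_mul]; congr 1; ring
  rw [mul_pow, norm_sq_Gamma_one t ht, e, ← mul_div_assoc, le_div_iff₀ (by positivity)]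
  -- `tanh y ≤ y`, in the form `sinh y ≤ y cosh y`
  have hmono : Real.sinh (Real.pi * t / 2) ≤ Real.pi * t / 2 * Real.cosh (Real.pi * t / 2) := by
    have hd : ∀ y : ℝ, HasDerivAt (fun y => y * Real.cosh y - Real.sinh y) (y * Real.sinh y) y := by
      intro y
      have := ((hasDerivAt_id y).mul (Real.hasDerivAt_cosh y)).sub (Real.hasDerivAt_sinh y)
      exact this.congr_deriv (by simp)
    have := monotoneOn_of_deriv_nonneg (convex_Ici (0 : ℝ))
      (f := fun y => y * Real.cosh y - Real.sinh y)
      (fun y _ => (hd y).continuousAt.continuousWithinAt)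
      (fun y _ => (hd y).differentiableAt.differentiableWithinAt)
      (fun y hy => by
        rw [interior_Ici] at hy
        rw [(hd y).deriv]
        exact mul_nonneg (le_of_lt hy) (Real.sinh_nonneg_iff.mpr (le_of_lt hy)))
    have := this (Set.mem_Ici.mpr le_rfl) (Set.mem_Ici.mpr hy.le) hy.le
    simp only [zero_mul, Real.sinh_zero, sub_zero] at this
    linarith
  nlinarith

lemma factorial_mul_norm_Gamma_le (M : ℕ) (t : ℝ) :
    M.factorial * ‖Complex.Gamma ((1 : ℝ) + t * Complex.I)‖
      ≤ ‖Complex.Gamma (((M + 1 : ℝ) : ℂ) + t * Complex.I)‖ := by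
  induction M with
  | zero => simp
  | succ M ih =>
    have e : (((M + 1 : ℕ) + 1 : ℝ) : ℂ) + t * Complex.I
        = (((M + 1 : ℝ) : ℂ) + t * Complex.I) + 1 := by push_cast; ring
    have h1 : (M + 1 : ℝ) ≤ ‖(((M + 1 : ℝ) : ℂ) + t * Complex.I)‖ := by
      have := Complex.abs_re_le_norm (((M + 1 : ℝ) : ℂ) + t * Complex.I)
      simp only [Complex.add_re, Complex.ofReal_re, Complex.mul_re, Complex.I_re, mul_zero,
        Complex.ofReal_im, Complex.I_im, mul_one, sub_zero, add_zero] at this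
      exact (le_abs_self _).trans this
    have hne : (((M + 1 : ℝ) : ℂ) + t * Complex.I) ≠ 0 := by
      intro h; rw [h, norm_zero] at h1
      have : (0 : ℝ) ≤ M := M.cast_nonneg
      linarith
    rw [e, Complex.Gamma_add_one _ hne, norm_mul, Nat.factorial_succ]
    rw [Nat.cast_mul, mul_assoc, Nat.cast_succ]
    gcongr

/-- On the vertical lines `Re s = -1, -3, -5, …`, half-way between the poles, `χ(1 - s)` is
bounded uniformly in `Im s`. -/
lemma norm_xiFactor_neg_odd_le (N : ℕ) (t : ℝ) :
    ‖xiFactor ((-(2 * N + 1 : ℝ) : ℝ) + t * Complex.I)‖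
      ≤ (2 * Real.pi) ^ (2 * N + 1) * Real.pi / (2 * N + 1).factorial := by
  have hpi := Real.pi_pos
  have h1 : (1 - ((-(2 * N + 1 : ℝ) : ℝ) + t * Complex.I) : ℂ)
      = (starRingEnd ℂ) ((((2 * N + 1 : ℕ) + 1 : ℝ) : ℂ) + t * Complex.I) := by
    simp only [map_add, map_mul, Complex.conj_ofReal, Complex.conj_I]
    push_cast; ring
  have h2 : (Real.pi * ((-(2 * N + 1 : ℝ) : ℝ) + t * Complex.I) / 2 : ℂ)
      = ((-(N * Real.pi + Real.pi / 2) : ℝ) : ℂ) + ((Real.pi * t / 2 : ℝ) : ℂ) * Complex.I := by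
    push_cast; ring
  have hsin : ‖Complex.sin (((-(N * Real.pi + Real.pi / 2) : ℝ) : ℂ)
      + ((Real.pi * t / 2 : ℝ) : ℂ) * Complex.I)‖ = Real.cosh (Real.pi * t / 2) := by
    rw [← sq_eq_sq₀ (norm_nonneg _) (Real.cosh_pos _).le, sq_norm_sin_add_mul_I, Real.cosh_sq,
      Real.sin_neg, Real.sin_add_pi_div_two, Real.cos_nat_mul_pi, neg_sq, ← pow_mul, mul_comm N 2,
      pow_mul]
    norm_num
    ring
  simp only [xiFactor, norm_mul, norm_inv]
  rw [h1, Complex.Gamma_conj, RCLike.norm_conj, norm_two_pi_cpow, h2, Complex.norm_real,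
    Real.norm_of_nonneg hpi.le, hsin]
  have h3 := factorial_mul_norm_Gamma_le (2 * N + 1) t
  have h4 := one_le_cosh_mul_norm_Gamma_one t
  have hf : (0 : ℝ) < (2 * N + 1).factorial := by exact_mod_cast Nat.factorial_pos _
  have hc := Real.cosh_pos (Real.pi * t / 2)
  have h5 : ((2 * N + 1).factorial : ℝ) ≤ Real.cosh (Real.pi * t / 2) *
      ‖Complex.Gamma ((((2 * N + 1 : ℕ) + 1 : ℝ) : ℂ) + t * Complex.I)‖ := by
    calc ((2 * N + 1).factorial : ℝ) ≤ (2 * N + 1).factorial *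
          (Real.cosh (Real.pi * t / 2) * ‖Complex.Gamma ((1 : ℝ) + t * Complex.I)‖) :=
          le_mul_of_one_le_right hf.le h4
      _ = Real.cosh (Real.pi * t / 2) * ((2 * N + 1).factorial *
          ‖Complex.Gamma ((1 : ℝ) + t * Complex.I)‖) := by ring
      _ ≤ _ := by gcongr
  rw [mul_assoc, ← mul_inv, ← div_eq_mul_inv]
  have hre : (2 * Real.pi) ^ (-(((-(2 * N + 1 : ℝ) : ℝ) : ℂ) + t * Complex.I).re)
      = (2 * Real.pi) ^ (2 * N + 1) := by
    rw [← Real.rpow_natCast]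
    congr 1
    simp
  rw [hre]
  gcongr

/-! ### The residue theorem for a simple pole in a rectangle -/

/-- The integral of `f` along the boundary of the rectangle `[x₀, x₁] × [-T, T]`, anticlockwise. -/
noncomputable def rectIntegral (f : ℂ → ℂ) (x₀ x₁ T : ℝ) : ℂ :=
  (∫ x : ℝ in x₀..x₁, f ((x : ℂ) - (T : ℂ) * Complex.I))
    - (∫ x : ℝ in x₀..x₁, f ((x : ℂ) + (T : ℂ) * Complex.I))
    + Complex.I * (∫ t : ℝ in (-T)..T, f ((x₁ : ℂ) + (t : ℂ) * Complex.I))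
    - Complex.I * (∫ t : ℝ in (-T)..T, f ((x₀ : ℂ) + (t : ℂ) * Complex.I))

lemma rectIntegral_eq_zero (f : ℂ → ℂ) (x₀ x₁ T : ℝ)
    (hf : DifferentiableOn ℂ f (Set.uIcc x₀ x₁ ×ℂ Set.uIcc (-T) T)) :
    rectIntegral f x₀ x₁ T = 0 := by
  have := Complex.integral_boundary_rect_eq_zero_of_differentiableOn f ⟨x₀, -T⟩ ⟨x₁, T⟩ hf
  simp only [Complex.ofReal_neg, neg_mul, ← sub_eq_add_neg, smul_eq_mul] at this
  exact this

/-- The closed rectangle `[x₀, x₁] × [-T, T]` without the point `p`. -/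
def puncturedRect (x₀ x₁ T : ℝ) (p : ℂ) : Set ℂ :=
  (Set.Icc x₀ x₁ ×ℂ Set.Icc (-T) T) \ {p}

section edges

variable {x₀ x₁ T : ℝ} {p : ℝ} {f : ℂ → ℂ}

lemma intervalIntegrable_bottom (h0 : x₀ < p) (h1 : p < x₁) (hT : 0 < T)
    (hf : ContinuousOn f (puncturedRect x₀ x₁ T p)) :
    IntervalIntegrable (fun x : ℝ => f ((x : ℂ) - (T : ℂ) * Complex.I))
      MeasureTheory.volume x₀ x₁ := by
  apply ContinuousOn.intervalIntegrable
  rw [Set.uIcc_of_le (by linarith)]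
  refine hf.comp (by fun_prop) ?_
  intro x hx
  refine ⟨?_, ?_⟩
  · rw [Complex.mem_reProdIm]
    simpa using ⟨hx, by linarith⟩
  · intro h
    have := congrArg Complex.im h
    simp at this
    linarith

lemma intervalIntegrable_top (h0 : x₀ < p) (h1 : p < x₁) (hT : 0 < T)
    (hf : ContinuousOn f (puncturedRect x₀ x₁ T p)) :
    IntervalIntegrable (fun x : ℝ => f ((x : ℂ) + (T : ℂ) * Complex.I))
      MeasureTheory.volume x₀ x₁ := by
  apply ContinuousOn.intervalIntegrable
  rw [Set.uIcc_of_le (by linarith)]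
  refine hf.comp (by fun_prop) ?_
  intro x hx
  refine ⟨?_, ?_⟩
  · rw [Complex.mem_reProdIm]
    simpa using ⟨hx, by linarith⟩
  · intro h
    have := congrArg Complex.im h
    simp at this
    linarith

lemma intervalIntegrable_left (h0 : x₀ < p) (h1 : p < x₁) (hT : 0 < T)
    (hf : ContinuousOn f (puncturedRect x₀ x₁ T p)) :
    IntervalIntegrable (fun t : ℝ => f ((x₀ : ℂ) + (t : ℂ) * Complex.I))
      MeasureTheory.volume (-T) T := by
  apply ContinuousOn.intervalIntegrable
  rw [Set.uIcc_of_le (by linarith)]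
  refine hf.comp (by fun_prop) ?_
  intro x hx
  refine ⟨?_, ?_⟩
  · rw [Complex.mem_reProdIm]
    simpa using ⟨by linarith, hx⟩
  · intro h
    have := congrArg Complex.re h
    simp at this
    linarith

lemma intervalIntegrable_right (h0 : x₀ < p) (h1 : p < x₁) (hT : 0 < T)
    (hf : ContinuousOn f (puncturedRect x₀ x₁ T p)) :
    IntervalIntegrable (fun t : ℝ => f ((x₁ : ℂ) + (t : ℂ) * Complex.I))
      MeasureTheory.volume (-T) T := by
  apply ContinuousOn.intervalIntegrable
  rw [Set.uIcc_of_le (by linarith)]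
  refine hf.comp (by fun_prop) ?_
  intro x hx
  refine ⟨?_, ?_⟩
  · rw [Complex.mem_reProdIm]
    simpa using ⟨by linarith, hx⟩
  · intro h
    have := congrArg Complex.re h
    simp at this
    linarith

lemma rectIntegral_add {g : ℂ → ℂ} (h0 : x₀ < p) (h1 : p < x₁) (hT : 0 < T)
    (hf : ContinuousOn f (puncturedRect x₀ x₁ T p))
    (hg : ContinuousOn g (puncturedRect x₀ x₁ T p)) :
    rectIntegral (fun s => f s + g s) x₀ x₁ T
      = rectIntegral f x₀ x₁ T + rectIntegral g x₀ x₁ T := by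
  simp only [rectIntegral]
  rw [intervalIntegral.integral_add (intervalIntegrable_bottom h0 h1 hT hf)
      (intervalIntegrable_bottom h0 h1 hT hg),
    intervalIntegral.integral_add (intervalIntegrable_top h0 h1 hT hf)
      (intervalIntegrable_top h0 h1 hT hg),
    intervalIntegral.integral_add (intervalIntegrable_left h0 h1 hT hf)
      (intervalIntegrable_left h0 h1 hT hg),
    intervalIntegral.integral_add (intervalIntegrable_right h0 h1 hT hf) (intervalIntegrable_right h0 h1 hT hg)]
  ring

end edges

lemma rectIntegral_const_mul (f : ℂ → ℂ) (a : ℂ) (x₀ x₁ T : ℝ) :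
    rectIntegral (fun s => a * f s) x₀ x₁ T = a * rectIntegral f x₀ x₁ T := by
  simp only [rectIntegral, intervalIntegral.integral_const_mul]
  ring

lemma rectIntegral_congr {f g : ℂ → ℂ} {x₀ x₁ T p : ℝ} (h0 : x₀ < p) (h1 : p < x₁) (hT : 0 < T)
    (h : Set.EqOn f g {(p : ℂ)}ᶜ) :
    rectIntegral f x₀ x₁ T = rectIntegral g x₀ x₁ T := by
  simp only [rectIntegral]
  have hb : ∀ x : ℝ, f ((x : ℂ) - (T : ℂ) * Complex.I) = g ((x : ℂ) - (T : ℂ) * Complex.I) := by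
    intro x
    apply h
    intro hx
    have := congrArg Complex.im hx
    simp at this
    linarith
  have ht : ∀ x : ℝ, f ((x : ℂ) + (T : ℂ) * Complex.I) = g ((x : ℂ) + (T : ℂ) * Complex.I) := by
    intro x
    apply h
    intro hx
    have := congrArg Complex.im hx
    simp at this
    linarith
  have hl : ∀ t : ℝ, f ((x₀ : ℂ) + (t : ℂ) * Complex.I) = g ((x₀ : ℂ) + (t : ℂ) * Complex.I) := by
    intro x
    apply h
    intro hx
    have := congrArg Complex.re hx
    simp at this
    linarith
  have hr : ∀ t : ℝ, f ((x₁ : ℂ) + (t : ℂ) * Complex.I) = g ((x₁ : ℂ) + (t : ℂ) * Complex.I) := by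
    intro x
    apply h
    intro hx
    have := congrArg Complex.re hx
    simp at this
    linarith
  simp only [hb, ht, hl, hr]

lemma integral_inv_add_mul_I (d T : ℝ) (hd : d ≠ 0) :
    ∫ t : ℝ in (-T)..T, ((d : ℂ) + t * Complex.I)⁻¹ = ((2 * Real.arctan (T / d) : ℝ) : ℂ) := by
  have hne : ∀ t : ℝ, (d : ℂ) + t * Complex.I ≠ 0 := by
    intro t h
    have := congrArg Complex.re h
    simp at this
    exact hd this
  have hne' : ∀ t : ℝ, (d : ℂ) - t * Complex.I ≠ 0 := by
    intro t h
    have := congrArg Complex.re h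
    simp at this
    exact hd this
  have h1 : ∫ t : ℝ in (-T)..T, ((d : ℂ) + t * Complex.I)⁻¹
      = ∫ t : ℝ in (-T)..T, ((d : ℂ) - t * Complex.I)⁻¹ := by
    have := intervalIntegral.integral_comp_neg (a := -T) (b := T)
      (fun t : ℝ => ((d : ℂ) + t * Complex.I)⁻¹)
    rw [neg_neg] at this
    rw [← this]
    congr 1
    ext t
    push_cast
    ring
  have h2 : ∫ t : ℝ in (-T)..T, (((d : ℂ) + t * Complex.I)⁻¹ + ((d : ℂ) - t * Complex.I)⁻¹)
      = ((2 * (2 * Real.arctan (T / d)) : ℝ) : ℂ) := by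
    have e : ∀ t : ℝ, ((d : ℂ) + t * Complex.I)⁻¹ + ((d : ℂ) - t * Complex.I)⁻¹
        = ((2 * (d / (d ^ 2 + t ^ 2)) : ℝ) : ℂ) := by
      intro t
      have h3 : (d : ℂ) ^ 2 + t ^ 2 = (d + t * Complex.I) * (d - t * Complex.I) := by
        ring_nf; rw [Complex.I_sq]; ring
      push_cast
      rw [h3]
      field_simp [hne t, hne' t]
      ring
    simp only [e]
    rw [intervalIntegral.integral_ofReal, intervalIntegral.integral_const_mul,
      integral_div_sq_add_sq, neg_div, Real.arctan_neg]
    push_cast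
    ring
  have hi : Continuous (fun t : ℝ => ((d : ℂ) + t * Complex.I)⁻¹) := by
    fun_prop (disch := exact hne _)
  have hi' : Continuous (fun t : ℝ => ((d : ℂ) - t * Complex.I)⁻¹) := by
    fun_prop (disch := exact hne' _)
  rw [intervalIntegral.integral_add (hi.intervalIntegrable _ _) (hi'.intervalIntegrable _ _),
    ← h1] at h2
  have h4 : (2 : ℂ) * ∫ t : ℝ in (-T)..T, ((d : ℂ) + t * Complex.I)⁻¹
      = 2 * ((2 * Real.arctan (T / d) : ℝ) : ℂ) := by
    rw [two_mul, h2]; push_cast; ring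
  exact mul_left_cancel₀ two_ne_zero h4

lemma rectIntegral_inv_sub (x₀ x₁ T p : ℝ) (h0 : x₀ < p) (h1 : p < x₁) (hT : 0 < T) :
    rectIntegral (fun s => (s - p)⁻¹) x₀ x₁ T = 2 * Real.pi * Complex.I := by
  have hne : ∀ x : ℝ, (x : ℂ) - T * Complex.I - p ≠ 0 := by
    intro t h
    have := congrArg Complex.im h
    simp at this
    exact hT.ne' this
  have hne' : ∀ x : ℝ, (x : ℂ) + T * Complex.I - p ≠ 0 := by
    intro t h
    have := congrArg Complex.im h
    simp at this
    exact hT.ne' this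
  have hi : Continuous (fun x : ℝ => ((x : ℂ) - T * Complex.I - p)⁻¹) := by
    fun_prop (disch := exact hne _)
  have hi' : Continuous (fun x : ℝ => ((x : ℂ) + T * Complex.I - p)⁻¹) := by
    fun_prop (disch := exact hne' _)
  have hhor : (∫ x : ℝ in x₀..x₁, ((x : ℂ) - (T : ℂ) * Complex.I - p)⁻¹)
      - (∫ x : ℝ in x₀..x₁, ((x : ℂ) + (T : ℂ) * Complex.I - p)⁻¹)
      = 2 * Complex.I * ((Real.arctan ((x₁ - p) / T) - Real.arctan ((x₀ - p) / T) : ℝ) : ℂ) := by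
    rw [← intervalIntegral.integral_sub (hi.intervalIntegrable _ _) (hi'.intervalIntegrable _ _)]
    have e : ∀ x : ℝ, ((x : ℂ) - T * Complex.I - p)⁻¹ - ((x : ℂ) + T * Complex.I - p)⁻¹
        = 2 * Complex.I * ((T / (T ^ 2 + (x - p) ^ 2) : ℝ) : ℂ) := by
      intro x
      have h3 : (T : ℂ) ^ 2 + (x - p) ^ 2
          = (x - T * Complex.I - p) * (x + T * Complex.I - p) := by
        ring_nf; rw [Complex.I_sq]; ring
      push_cast
      rw [h3]
      field_simp [hne x, hne' x]
      ring
    simp only [e]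
    rw [intervalIntegral.integral_const_mul, intervalIntegral.integral_ofReal,
      intervalIntegral.integral_comp_sub_right (fun x => T / (T ^ 2 + x ^ 2)),
      integral_div_sq_add_sq]
  have hr : ∀ t : ℝ, (x₁ : ℂ) + t * Complex.I - p = ((x₁ - p : ℝ) : ℂ) + t * Complex.I := by
    intro t; push_cast; ring
  have hl : ∀ t : ℝ, (x₀ : ℂ) + t * Complex.I - p = ((x₀ - p : ℝ) : ℂ) + t * Complex.I := by
    intro t; push_cast; ring
  simp only [rectIntegral]
  rw [hhor]
  simp only [hr, hl]
  rw [integral_inv_add_mul_I _ _ (by linarith), integral_inv_add_mul_I _ _ (by linarith)]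
  have a1 := Real.arctan_inv_of_pos (x := (x₁ - p) / T) (div_pos (by linarith) hT)
  have a2 := Real.arctan_inv_of_neg (x := (x₀ - p) / T) (div_neg_of_neg_of_pos (by linarith) hT)
  rw [inv_div] at a1 a2
  rw [a1, a2]
  push_cast
  ring

/-- The residue theorem for a rectangle containing a single simple pole `p`, at which
`f s = h s / (s - p)` has residue `h p`. -/
lemma rectIntegral_eq_residue (f h : ℂ → ℂ) (U : Set ℂ) (hU : IsOpen U) (x₀ x₁ T p : ℝ)
    (h0 : x₀ < p) (h1 : p < x₁) (hT : 0 < T) (hsub : Set.Icc x₀ x₁ ×ℂ Set.Icc (-T) T ⊆ U)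
    (hh : DifferentiableOn ℂ h U) (hf : ∀ s, s ≠ (p : ℂ) → f s = h s * (s - p)⁻¹) :
    rectIntegral f x₀ x₁ T = 2 * Real.pi * Complex.I * h p := by
  have hp : (p : ℂ) ∈ U := hsub (by
    rw [Complex.mem_reProdIm]
    simpa using ⟨⟨h0.le, h1.le⟩, hT.le⟩)
  have hd : DifferentiableOn ℂ (dslope h p) U :=
    (Complex.differentiableOn_dslope (hU.mem_nhds hp)).mpr hh
  have e : Set.EqOn f (fun s => dslope h p s + h p * (s - p)⁻¹) {(p : ℂ)}ᶜ := by
    intro s hs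
    have hs' : s ≠ p := hs
    have : s - p ≠ 0 := sub_ne_zero.mpr hs'
    simp only
    rw [hf s hs', dslope_of_ne _ hs', slope_def_module, smul_eq_mul]
    ring
  have hsub' : puncturedRect x₀ x₁ T p ⊆ U := Set.sdiff_subset.trans hsub
  rw [rectIntegral_congr h0 h1 hT e, rectIntegral_add h0 h1 hT (hd.continuousOn.mono hsub'),
    rectIntegral_const_mul, rectIntegral_inv_sub _ _ _ _ h0 h1 hT, rectIntegral_eq_zero]
  · ring
  · refine hd.mono (Set.Subset.trans ?_ hsub)
    rw [Set.uIcc_of_le (by linarith), Set.uIcc_of_le (by linarith)]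
  · refine ContinuousOn.mul continuousOn_const (ContinuousOn.inv₀ (by fun_prop) ?_)
    intro s hs
    exact sub_ne_zero.mpr hs.2

lemma rectIntegral_add_adjacent (f : ℂ → ℂ) (x₀ x₁ x₂ T : ℝ)
    (hb : Continuous (fun x : ℝ => f ((x : ℂ) - (T : ℂ) * Complex.I)))
    (ht : Continuous (fun x : ℝ => f ((x : ℂ) + (T : ℂ) * Complex.I))) :
    rectIntegral f x₀ x₁ T + rectIntegral f x₁ x₂ T = rectIntegral f x₀ x₂ T := by
  simp only [rectIntegral]
  rw [← intervalIntegral.integral_add_adjacent_intervals (hb.intervalIntegrable x₀ x₁)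
      (hb.intervalIntegrable x₁ x₂),
    ← intervalIntegral.integral_add_adjacent_intervals (ht.intervalIntegrable x₀ x₁)
      (ht.intervalIntegrable x₁ x₂)]
  ring

/-! ### The residues of `χ(1 - s) D(s)` -/

lemma sin_pi_mul_div_two_ne_zero (z : ℂ) (hz : z ≠ 0) (h1 : -2 < z.re) (h2 : z.re < 2) :
    Complex.sin (Real.pi * z / 2) ≠ 0 := by
  intro h
  obtain ⟨k, hk⟩ := Complex.sin_eq_zero_iff.mp h
  have hpi : (Real.pi : ℂ) ≠ 0 := by exact_mod_cast Real.pi_ne_zero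
  have hz2 : z = ((2 * k : ℝ) : ℂ) := by
    have : (Real.pi : ℂ) * z = Real.pi * (2 * k) := by linear_combination 2 * hk
    push_cast
    exact mul_left_cancel₀ hpi this
  have hre : z.re = 2 * k := by rw [hz2, Complex.ofReal_re]
  have hk1 : (-1 : ℝ) < k := by linarith
  have hk2 : (k : ℝ) < 1 := by linarith
  have hk3 : k = 0 := by
    have : -1 < k := by exact_mod_cast hk1
    have : k < 1 := by exact_mod_cast hk2
    omega
  rw [hk3] at hz2
  exact hz (by simpa using hz2)

lemma sin_pi_mul_div_two_ne_zero_of_im (z : ℂ) (hz : z.im ≠ 0) :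
    Complex.sin (Real.pi * z / 2) ≠ 0 := by
  intro h
  obtain ⟨k, hk⟩ := Complex.sin_eq_zero_iff.mp h
  have := congrArg Complex.im hk
  have e : (Real.pi : ℂ) * z / 2 = ((Real.pi / 2 : ℝ) : ℂ) * z := by push_cast; ring
  have e' : (k : ℂ) * Real.pi = ((k * Real.pi : ℝ) : ℂ) := by push_cast; ring
  rw [e, e', Complex.im_ofReal_mul, Complex.ofReal_im] at this
  exact hz ((mul_eq_zero.mp this).resolve_left (by positivity))

/-- The quotient `sin (π z / 2) / z`, with its removable singularity filled in. -/
noncomputable def sinQuotient : ℂ → ℂ := dslope (fun z => Complex.sin (Real.pi * z / 2)) 0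

lemma sinQuotient_zero : sinQuotient 0 = Real.pi / 2 := by
  have h : HasDerivAt (fun z : ℂ => Complex.sin (Real.pi * z / 2))
      (Complex.cos (Real.pi * 0 / 2) * (Real.pi * 1 / 2)) 0 :=
    (((hasDerivAt_id (0 : ℂ)).const_mul (Real.pi : ℂ)).div_const 2).csin
  rw [sinQuotient, dslope_same, h.deriv]
  simp

lemma mul_sinQuotient (z : ℂ) : z * sinQuotient z = Complex.sin (Real.pi * z / 2) := by
  rcases eq_or_ne z 0 with rfl | hz
  · simp
  · rw [sinQuotient, dslope_of_ne _ hz, slope_def_module, smul_eq_mul]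
    simp [hz]

lemma sinQuotient_ne_zero (z : ℂ) (h1 : -2 < z.re) (h2 : z.re < 2) : sinQuotient z ≠ 0 := by
  rcases eq_or_ne z 0 with rfl | hz
  · rw [sinQuotient_zero]
    exact div_ne_zero (by exact_mod_cast Real.pi_ne_zero) two_ne_zero
  · intro h
    have := mul_sinQuotient z
    rw [h, mul_zero] at this
    exact sin_pi_mul_div_two_ne_zero z hz h1 h2 this.symm

lemma differentiable_sinQuotient : Differentiable ℂ sinQuotient := by
  have h : Differentiable ℂ (fun z : ℂ => Complex.sin (Real.pi * z / 2)) := by fun_prop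
  have := (Complex.differentiableOn_dslope (s := Set.univ) (c := 0)
    (f := fun z : ℂ => Complex.sin (Real.pi * z / 2)) Filter.univ_mem).mpr h.differentiableOn
  exact differentiableOn_univ.mp this

lemma two_pi_ne_zero_complex : (2 * (Real.pi : ℂ)) ≠ 0 := by
  have := Real.pi_ne_zero
  exact mul_ne_zero two_ne_zero (by exact_mod_cast this)

/-- The residue of `χ(1 - s) D(s)` at `s = -2j`. -/
noncomputable def xiResidue (D : ℂ → ℂ) (j : ℕ) : ℂ :=
  2 * (-1) ^ j * (2 * Real.pi) ^ (2 * j) / (2 * j).factorial * D (-(2 * j : ℝ) : ℝ)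

/-- The residue theorem for `χ(1 - s) D(s)` around the single pole `-2j`. -/
lemma rectIntegral_xiFactor_mul (D : ℂ → ℂ) (hD : Differentiable ℂ D) (j : ℕ) (x₀ x₁ T : ℝ)
    (hT : 0 < T) (h00 : -(2 * j : ℝ) - 2 < x₀) (h0 : x₀ < -(2 * j : ℝ))
    (h1 : -(2 * j : ℝ) < x₁) (h11 : x₁ < -(2 * j : ℝ) + 2) :
    rectIntegral (fun s => xiFactor s * D s) x₀ x₁ T
      = 2 * Real.pi * Complex.I * xiResidue D j := by
  set p : ℝ := -(2 * j : ℝ) with hp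
  have hpj : (p : ℂ) = -(2 * j) := by rw [hp]; push_cast; ring
  have hsin : ∀ s : ℂ, Complex.sin (Real.pi * s / 2)
      = (-1) ^ j * ((s - p) * sinQuotient (s - p)) := by
    intro s
    rw [mul_sinQuotient]
    have e : (Real.pi * (s - p) / 2 : ℂ) = Real.pi * s / 2 + j * Real.pi := by
      rw [hpj]; ring
    have hcos : Complex.cos (j * Real.pi) = (-1) ^ j := by
      rw [← Complex.ofReal_natCast, ← Complex.ofReal_mul, ← Complex.ofReal_cos,
        Real.cos_nat_mul_pi]
      push_cast; rfl
    rw [e, Complex.sin_add, Complex.sin_nat_mul_pi, hcos, mul_zero, add_zero]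
    have hsq : (-1 : ℂ) ^ j * (-1) ^ j = 1 := by rw [← mul_pow]; norm_num
    linear_combination -Complex.sin (Real.pi * s / 2) * hsq
  have hU : IsOpen {s : ℂ | p - 2 < s.re ∧ s.re < p + 2} :=
    (isOpen_lt continuous_const Complex.continuous_re).inter
      (isOpen_lt Complex.continuous_re continuous_const)
  have hG : Differentiable ℂ (fun s : ℂ => (Complex.Gamma (1 - s))⁻¹) :=
    Complex.differentiable_one_div_Gamma.comp (by fun_prop)
  have hpow : Differentiable ℂ (fun s : ℂ => (2 * (Real.pi : ℂ)) ^ (-s)) := by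
    intro s
    exact (differentiableAt_id.neg).const_cpow (Or.inl two_pi_ne_zero_complex)
  have key := rectIntegral_eq_residue (fun s => xiFactor s * D s)
    (fun s => (2 * (Real.pi : ℂ)) ^ (-s) * Real.pi * (-1) ^ j * (sinQuotient (s - p))⁻¹
      * (Complex.Gamma (1 - s))⁻¹ * D s) _ hU x₀ x₁ T p h0 h1 hT
    (by
      intro s hs
      rw [Complex.mem_reProdIm] at hs
      exact ⟨by linarith [hs.1.1], by linarith [hs.1.2]⟩)
    (by
      refine DifferentiableOn.mul (DifferentiableOn.mul (DifferentiableOn.mul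
        (((hpow.mul_const _).mul_const _).differentiableOn) ?_) hG.differentiableOn)
        hD.differentiableOn
      refine DifferentiableOn.inv ?_ ?_
      · exact (differentiable_sinQuotient.comp
          (differentiable_id.sub_const (p : ℂ))).differentiableOn
      · intro s hs
        apply sinQuotient_ne_zero
        · simp; linarith [hs.1]
        · simp; linarith [hs.2])
    (by
      intro s hs
      have hs' : s - p ≠ 0 := sub_ne_zero.mpr hs
      rw [xiFactor, hsin s, mul_inv, mul_inv]
      have : (((-1 : ℂ)) ^ j)⁻¹ = (-1) ^ j := by
        rw [← inv_pow]; norm_num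
      rw [this]
      ring)
  rw [key, xiResidue]
  congr 1
  rw [sub_self, sinQuotient_zero, hpj]
  have hΓ : Complex.Gamma (1 - -(2 * j)) = (2 * j).factorial := by
    rw [show (1 - -(2 * j) : ℂ) = ((2 * j : ℕ) : ℂ) + 1 by push_cast; ring,
      Complex.Gamma_nat_eq_factorial]
  have h2π : (2 * (Real.pi : ℂ)) ^ (-(-(2 * j)) : ℂ) = (2 * Real.pi) ^ (2 * j) := by
    rw [neg_neg, show (2 * j : ℂ) = ((2 * j : ℕ) : ℂ) by push_cast; ring, Complex.cpow_natCast]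
  rw [hΓ, h2π]
  have hpi : (Real.pi : ℂ) ≠ 0 := by exact_mod_cast Real.pi_ne_zero
  field_simp

lemma continuous_xiFactor_comp {g : ℝ → ℂ} (hg : Continuous g)
    (h : ∀ x, Complex.sin (Real.pi * g x / 2) ≠ 0) : Continuous (fun x => xiFactor (g x)) := by
  have hG : Continuous (fun s : ℂ => (Complex.Gamma (1 - s))⁻¹) :=
    (Complex.differentiable_one_div_Gamma.comp (by fun_prop)).continuous
  have hpow : Continuous (fun s : ℂ => (2 * (Real.pi : ℂ)) ^ (-s)) := by
    have : Differentiable ℂ (fun s : ℂ => (2 * (Real.pi : ℂ)) ^ (-s)) := fun s =>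
      (differentiableAt_id.neg).const_cpow (Or.inl two_pi_ne_zero_complex)
    exact this.continuous
  unfold xiFactor
  refine Continuous.mul (Continuous.mul (Continuous.mul (hpow.comp hg) continuous_const) ?_)
    (hG.comp hg)
  exact Continuous.inv₀ (by fun_prop) h

lemma continuous_xiFactor_horizontal (T : ℝ) (hT : T ≠ 0) :
    Continuous (fun x : ℝ => xiFactor (x + T * Complex.I)) := by
  refine continuous_xiFactor_comp (by fun_prop) fun x => ?_
  exact sin_pi_mul_div_two_ne_zero_of_im _ (by simpa using hT)

lemma continuous_xiFactor_horizontal_neg (T : ℝ) (hT : T ≠ 0) :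
    Continuous (fun x : ℝ => xiFactor (x - T * Complex.I)) := by
  refine continuous_xiFactor_comp (by fun_prop) fun x => ?_
  exact sin_pi_mul_div_two_ne_zero_of_im _ (by simpa using hT)

lemma continuous_xiFactor_vertical (k : ℕ) :
    Continuous (fun t : ℝ => xiFactor (((-(2 * k + 1 : ℝ) : ℝ) : ℂ) + t * Complex.I)) := by
  refine continuous_xiFactor_comp (by fun_prop) fun t => ?_
  intro h
  obtain ⟨m, hm⟩ := Complex.sin_eq_zero_iff.mp h
  have := congrArg Complex.re hm
  have e : (Real.pi : ℂ) * ((((-(2 * k + 1 : ℝ) : ℝ) : ℂ) + t * Complex.I)) / 2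
      = ((Real.pi * (-(2 * k + 1 : ℝ)) / 2 : ℝ) : ℂ) + ((Real.pi * t / 2 : ℝ) : ℂ) * Complex.I := by
    push_cast; ring
  have e' : (m : ℂ) * Real.pi = ((m * Real.pi : ℝ) : ℂ) := by push_cast; ring
  rw [e, e', Complex.ofReal_re, Complex.add_re, Complex.ofReal_re, Complex.re_ofReal_mul,
    Complex.I_re, mul_zero, add_zero] at this
  have h3 : Real.pi * (-(2 * k + 1 : ℝ)) = Real.pi * (2 * m) := by linarith
  have h4 := mul_left_cancel₀ Real.pi_ne_zero h3
  have h5 : -(2 * (k : ℤ) + 1) = 2 * m := by exact_mod_cast h4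
  omega

/-- The rectangle from `Re s = -(2N+1)` to `Re s = c` contains the poles `0, -2, …, -2N`. -/
lemma rectIntegral_xiFactor_mul_sum (D : ℂ → ℂ) (hD : Differentiable ℂ D) (c T : ℝ)
    (hT : 0 < T) (hc : 0 < c) (hc2 : c < 2) (N : ℕ) :
    rectIntegral (fun s => xiFactor s * D s) (-(2 * N + 1 : ℝ)) c T
      = 2 * Real.pi * Complex.I * ∑ j ∈ Finset.range (N + 1), xiResidue D j := by
  have hb : Continuous (fun x : ℝ => (fun s => xiFactor s * D s)
      ((x : ℂ) - (T : ℂ) * Complex.I)) :=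
    (continuous_xiFactor_horizontal_neg T hT.ne').mul (hD.continuous.comp (by fun_prop))
  have ht : Continuous (fun x : ℝ => (fun s => xiFactor s * D s)
      ((x : ℂ) + (T : ℂ) * Complex.I)) :=
    (continuous_xiFactor_horizontal T hT.ne').mul (hD.continuous.comp (by fun_prop))
  induction N with
  | zero =>
    rw [Finset.sum_range_one]
    apply rectIntegral_xiFactor_mul D hD 0 <;> norm_num <;> assumption
  | succ N ih =>
    rw [← rectIntegral_add_adjacent _ _ (-(2 * N + 1 : ℝ)) c T hb ht, ih,
      rectIntegral_xiFactor_mul D hD (N + 1) _ _ T hT, Finset.sum_range_succ _ (N + 1)]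
    · ring
    all_goals push_cast; linarith

/-! ### Deforming the contour to the left -/

/-- The contour integral from `σ₀ - iT` to `σ₀ + iT` through `Re s = c`, deformed so that it passes
through the heights `±T` for `-(2k+1) ≤ Re s ≤ σ₀`, the line `Re s = -(2k+1)` for heights between
`T` and `T'`, the heights `±T'` further to the left, and is closed on `Re s = -(2N+1)`. -/
lemma contour_eq_sum_xiResidue_add (D : ℂ → ℂ) (hD : Differentiable ℂ D) (σ₀ c T T' : ℝ)
    (hT : 0 < T) (hT' : 0 < T') (hc : 0 < c) (hc2 : c < 2) (k N : ℕ)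
    (G : ℂ → ℂ) (hG : G = fun s => xiFactor s * D s) :
    (∫ x : ℝ in σ₀..c, G ((x : ℂ) - (T : ℂ) * Complex.I))
      + Complex.I * (∫ t : ℝ in (-T)..T, G ((c : ℂ) + (t : ℂ) * Complex.I))
      + (∫ x : ℝ in c..σ₀, G ((x : ℂ) + (T : ℂ) * Complex.I))
    = 2 * Real.pi * Complex.I * ∑ j ∈ Finset.range (N + 1), xiResidue D j
      - (∫ x : ℝ in (-(2 * k + 1 : ℝ))..σ₀, G ((x : ℂ) - (T : ℂ) * Complex.I))
      + (∫ x : ℝ in (-(2 * k + 1 : ℝ))..σ₀, G ((x : ℂ) + (T : ℂ) * Complex.I))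
      - Complex.I *
        (∫ t : ℝ in (-T')..(-T), G (((-(2 * k + 1 : ℝ) : ℝ) : ℂ) + (t : ℂ) * Complex.I))
      - Complex.I * (∫ t : ℝ in T..T', G (((-(2 * k + 1 : ℝ) : ℝ) : ℂ) + (t : ℂ) * Complex.I))
      - (∫ x : ℝ in (-(2 * N + 1 : ℝ))..(-(2 * k + 1 : ℝ)), G ((x : ℂ) - (T' : ℂ) * Complex.I))
      + (∫ x : ℝ in (-(2 * N + 1 : ℝ))..(-(2 * k + 1 : ℝ)), G ((x : ℂ) + (T' : ℂ) * Complex.I))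
      + Complex.I *
        (∫ t : ℝ in (-T')..T', G (((-(2 * N + 1 : ℝ) : ℝ) : ℂ) + (t : ℂ) * Complex.I)) := by
  subst hG
  set G : ℂ → ℂ := fun s => xiFactor s * D s
  have hb : ∀ T : ℝ, 0 < T → Continuous (fun x : ℝ => G ((x : ℂ) - (T : ℂ) * Complex.I)) :=
    fun T hT => (continuous_xiFactor_horizontal_neg T hT.ne').mul
      (hD.continuous.comp (by fun_prop))
  have ht : ∀ T : ℝ, 0 < T → Continuous (fun x : ℝ => G ((x : ℂ) + (T : ℂ) * Complex.I)) :=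
    fun T hT => (continuous_xiFactor_horizontal T hT.ne').mul
      (hD.continuous.comp (by fun_prop))
  have hv : Continuous (fun t : ℝ => G (((-(2 * k + 1 : ℝ) : ℝ) : ℂ) + (t : ℂ) * Complex.I)) :=
    (continuous_xiFactor_vertical k).mul (hD.continuous.comp (by fun_prop))
  have r1 := rectIntegral_xiFactor_mul_sum D hD c T hT hc hc2 k
  have r2 := rectIntegral_xiFactor_mul_sum D hD c T' hT' hc hc2 k
  have r3 := rectIntegral_xiFactor_mul_sum D hD c T' hT' hc hc2 N
  have r4 := rectIntegral_add_adjacent G (-(2 * N + 1 : ℝ)) (-(2 * k + 1 : ℝ)) c T'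
    (hb T' hT') (ht T' hT')
  rw [r3, r2] at r4
  simp only [rectIntegral] at r1 r4
  have a1 := intervalIntegral.integral_add_adjacent_intervals (μ := MeasureTheory.volume)
    ((hb T hT).intervalIntegrable (-(2 * k + 1 : ℝ)) σ₀) ((hb T hT).intervalIntegrable σ₀ c)
  have a2 := intervalIntegral.integral_add_adjacent_intervals (μ := MeasureTheory.volume)
    ((ht T hT).intervalIntegrable (-(2 * k + 1 : ℝ)) c) ((ht T hT).intervalIntegrable c σ₀)
  have a3 := intervalIntegral.integral_add_adjacent_intervals (μ := MeasureTheory.volume)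
    (hv.intervalIntegrable (-T') (-T)) (hv.intervalIntegrable (-T) T)
  have a4 := intervalIntegral.integral_add_adjacent_intervals (μ := MeasureTheory.volume)
    (hv.intervalIntegrable (-T') T) (hv.intervalIntegrable T T')
  linear_combination r1 + r4 + a1 + a2 + Complex.I * a3 + Complex.I * a4

lemma norm_comp_sub_eq_norm_comp_add {G : ℂ → ℂ} (hG : ∀ s, ‖G ((starRingEnd ℂ) s)‖ = ‖G s‖)
    (x t : ℝ) : ‖G ((x : ℂ) - (t : ℂ) * Complex.I)‖ = ‖G ((x : ℂ) + (t : ℂ) * Complex.I)‖ := by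
  rw [← hG]
  congr 2
  simp

lemma tendsto_mul_pow_div_factorial (Y : ℝ) :
    Tendsto (fun N : ℕ => (2 * N + 1 : ℝ) * (Y ^ (2 * N + 1) / (2 * N + 1).factorial)) atTop
      (𝓝 0) := by
  have h := (FloorSemiring.tendsto_pow_div_factorial_atTop Y).comp
    (tendsto_id.const_mul_atTop' (two_pos : (0 : ℕ) < 2))
  have h2 := h.const_mul Y
  rw [mul_zero] at h2
  refine h2.congr fun N => ?_
  simp only [Function.comp, id]
  rw [Nat.factorial_succ, pow_succ]
  have : ((2 * N).factorial : ℝ) ≠ 0 := by exact_mod_cast Nat.factorial_ne_zero _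
  push_cast
  field_simp

lemma integral_rpow_le (T T' a : ℝ) (hT : 0 < T) (hTT : T ≤ T') (ha : 1 < a) :
    ∫ t : ℝ in T..T', (t / (2 * Real.pi)) ^ (-a)
      ≤ 2 * Real.pi * ((T / (2 * Real.pi)) ^ (1 - a) / (a - 1)) := by
  have hpi := Real.pi_pos
  have h2 : (0 : ℝ) < 2 * Real.pi := by positivity
  rw [intervalIntegral.integral_comp_div (fun t => t ^ (-a)) h2.ne', smul_eq_mul]
  have h0 : (0 : ℝ) < T / (2 * Real.pi) := by positivity
  have h0' : T / (2 * Real.pi) ≤ T' / (2 * Real.pi) := by gcongr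
  rw [integral_rpow (Or.inr ⟨by linarith, by
    rw [Set.uIcc_of_le h0']
    intro h
    exact absurd h.1 (not_le.mpr h0)⟩)]
  refine mul_le_mul_of_nonneg_left ?_ h2.le
  rw [show -a + 1 = -(a - 1) by ring, div_neg, ← neg_div, show 1 - a = -(a - 1) by ring]
  have : 0 ≤ (T' / (2 * Real.pi)) ^ (-(a - 1)) := by
    apply Real.rpow_nonneg
    linarith
  have ha' : 0 < a - 1 := by linarith
  gcongr
  linarith

/-- Up to the part of the deformed contour at heights `±T` and the part on the line
`Re s = -(2k+1)`, the contour integral is the sum of all the residues. -/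
lemma norm_contour_sub_tsum_le (D : ℂ → ℂ) (hD : Differentiable ℂ D)
    (hconj : ∀ s, ‖D ((starRingEnd ℂ) s)‖ = ‖D s‖) (A Y : ℝ) (hA : 0 ≤ A) (hY : 1 ≤ Y)
    (hDY : ∀ s : ℂ, s.re ≤ 0 → ‖D s‖ ≤ A * Y ^ (-s.re))
    (σ₀ c T : ℝ) (hT : 100 ≤ T) (hc : 0 < c) (hc2 : c < 2) (k : ℕ) (hσ : -(2 * k + 1 : ℝ) ≤ σ₀)
    (R : ℂ) (hR : HasSum (xiResidue D) R) (B : ℝ)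
    (hB : ∀ t : ℝ, ‖D (((-(2 * k + 1 : ℝ) : ℝ) : ℂ) + (t : ℂ) * Complex.I)‖ ≤ B)
    (G : ℂ → ℂ) (hG : G = fun s => xiFactor s * D s) :
    ‖(∫ x : ℝ in σ₀..c, G ((x : ℂ) - (T : ℂ) * Complex.I))
      + Complex.I * (∫ t : ℝ in (-T)..T, G ((c : ℂ) + (t : ℂ) * Complex.I))
      + (∫ x : ℝ in c..σ₀, G ((x : ℂ) + (T : ℂ) * Complex.I)) - 2 * Real.pi * Complex.I * R‖
    ≤ 2 * (∫ x : ℝ in (-(2 * k + 1 : ℝ))..σ₀, ‖G ((x : ℂ) + (T : ℂ) * Complex.I)‖)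
      + 2 * (1.01 * B * (2 * Real.pi * ((T / (2 * Real.pi)) ^ (1 / 2 - (2 * k + 1 : ℝ))
          / (2 * k + 1 / 2)))) := by
  have hT0 : 0 < T := by linarith
  have hpi := Real.pi_pos
  have hB0 : 0 ≤ B := (norm_nonneg _).trans (hB 0)
  have hGconj : ∀ s, ‖G ((starRingEnd ℂ) s)‖ = ‖G s‖ := by
    intro s; rw [hG]; simp only [norm_mul]; rw [norm_xiFactor_conj, hconj]
  set K : ℝ := (2 * k + 1 : ℝ) with hK
  have hK1 : 1 ≤ K := by rw [hK]; have : (0 : ℝ) ≤ k := k.cast_nonneg; linarith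
  set H := ∫ x : ℝ in (-K)..σ₀, ‖G ((x : ℂ) + (T : ℂ) * Complex.I)‖ with hH
  -- the line `Re s = -K` above height `T`
  have hvert : ∀ T' : ℝ, T ≤ T' → ∫ t : ℝ in T..T', ‖G (((-K : ℝ) : ℂ) + (t : ℂ) * Complex.I)‖
      ≤ 1.01 * B * (2 * Real.pi * ((T / (2 * Real.pi)) ^ (1 / 2 - K) / (2 * k + 1 / 2))) := by
    intro T' hTT
    have hint := integral_rpow_le T T' (K + 1 / 2) hT0 hTT (by linarith)
    rw [show 1 - (K + 1 / 2) = 1 / 2 - K by ring,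
      show K + 1 / 2 - 1 = 2 * k + 1 / 2 by rw [hK]; ring] at hint
    refine le_trans ?_ (mul_le_mul_of_nonneg_left hint (by positivity : 0 ≤ 1.01 * B))
    rw [← intervalIntegral.integral_const_mul]
    apply intervalIntegral.integral_mono_on hTT
    · apply Continuous.intervalIntegrable
      rw [hG]
      exact ((continuous_xiFactor_vertical k).mul (hD.continuous.comp (by fun_prop))).norm
    · apply ContinuousOn.intervalIntegrable
      rw [Set.uIcc_of_le hTT]
      refine ContinuousOn.mul continuousOn_const (ContinuousOn.rpow_const (by fun_prop) ?_)
      intro t ht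
      left
      have : 0 < t := by linarith [ht.1]
      positivity
    · intro t ht
      rw [hG]
      simp only [norm_mul]
      have h1 := norm_xiFactor_le (-K) t (by linarith) (by linarith [ht.1])
      have ht0 : 0 < t := by linarith [ht.1]
      rw [show -K - 1 / 2 = -(K + 1 / 2) by ring] at h1
      calc _ ≤ 1.01 * (t / (2 * Real.pi)) ^ (-(K + 1 / 2)) * B := by
            gcongr
            exact hB t
        _ = _ := by ring
  -- the rest of the deformed contour, for `T' = M = 2N + 1`
  set e₁ : ℕ → ℝ := fun N => 1.01 * A * (2 * Real.pi * Y) *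
    ((2 * N + 1 : ℝ) / (2 * Real.pi)) ^ (-(1 / 2 : ℝ)) with he₁
  set e₂ : ℕ → ℝ := fun N => 2 * Real.pi * A * ((2 * N + 1 : ℝ) *
    ((2 * Real.pi * Y) ^ (2 * N + 1) / (2 * N + 1).factorial)) with he₂
  have hlin : Tendsto (fun N : ℕ => (2 * N + 1 : ℝ)) atTop atTop :=
    tendsto_atTop_add_const_right _ _
      (Tendsto.const_mul_atTop two_pos tendsto_natCast_atTop_atTop)
  have he₁0 : Tendsto e₁ atTop (𝓝 0) := by
    have := ((tendsto_rpow_neg_atTop (y := (1 / 2 : ℝ)) (by norm_num)).comp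
      (hlin.atTop_div_const (by positivity : 0 < 2 * Real.pi))).const_mul
        (1.01 * A * (2 * Real.pi * Y))
    rw [mul_zero] at this
    exact this
  have he₂0 : Tendsto e₂ atTop (𝓝 0) := by
    have := (tendsto_mul_pow_div_factorial (2 * Real.pi * Y)).const_mul (2 * Real.pi * A)
    rw [mul_zero] at this
    exact this
  set C := (∫ x : ℝ in σ₀..c, G ((x : ℂ) - (T : ℂ) * Complex.I))
      + Complex.I * (∫ t : ℝ in (-T)..T, G ((c : ℂ) + (t : ℂ) * Complex.I))
      + (∫ x : ℝ in c..σ₀, G ((x : ℂ) + (T : ℂ) * Complex.I)) with hC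
  set V := 1.01 * B * (2 * Real.pi * ((T / (2 * Real.pi)) ^ (1 / 2 - K) / (2 * k + 1 / 2)))
    with hV
  have hlim1 : Tendsto (fun N : ℕ => ‖C - 2 * Real.pi * Complex.I *
      ∑ j ∈ Finset.range (N + 1), xiResidue D j‖) atTop
      (𝓝 ‖C - 2 * Real.pi * Complex.I * R‖) :=
    (tendsto_const_nhds.sub ((hR.tendsto_sum_nat.comp (tendsto_add_atTop_nat 1)).const_mul _)).norm
  have hlim2 : Tendsto (fun N : ℕ => 2 * H + 2 * V + (2 * e₁ N + e₂ N)) atTop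
      (𝓝 (2 * H + 2 * V + (2 * 0 + 0))) :=
    tendsto_const_nhds.add ((he₁0.const_mul 2).add he₂0)
  rw [mul_zero, add_zero, add_zero] at hlim2
  refine le_of_tendsto_of_tendsto hlim1 hlim2 ?_
  filter_upwards [hlin.eventually_ge_atTop T, hlin.eventually_ge_atTop K,
    hlin.eventually_ge_atTop (2 * Real.pi * Y)] with N hN1 hN2 hN3
  set M : ℝ := (2 * N + 1 : ℝ) with hM
  have hM0 : 0 < M := by linarith
  have hmain := contour_eq_sum_xiResidue_add D hD σ₀ c T M hT0 hM0 hc hc2 k N G hG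
  rw [← hK, ← hM, ← hC] at hmain
  -- horizontal pieces at height `T`
  have b1 : ‖∫ x : ℝ in (-K)..σ₀, G ((x : ℂ) - (T : ℂ) * Complex.I)‖ ≤ H := by
    refine (intervalIntegral.norm_integral_le_integral_norm hσ).trans (le_of_eq ?_)
    simp only [norm_comp_sub_eq_norm_comp_add hGconj, hH]
  have b2 : ‖∫ x : ℝ in (-K)..σ₀, G ((x : ℂ) + (T : ℂ) * Complex.I)‖ ≤ H :=
    intervalIntegral.norm_integral_le_integral_norm hσ
  -- vertical pieces on `Re s = -K`
  have b3 : ‖∫ t : ℝ in T..M, G (((-K : ℝ) : ℂ) + (t : ℂ) * Complex.I)‖ ≤ V :=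
    (intervalIntegral.norm_integral_le_integral_norm hN1).trans (hvert M hN1)
  have b4 : ‖∫ t : ℝ in (-M)..(-T), G (((-K : ℝ) : ℂ) + (t : ℂ) * Complex.I)‖ ≤ V := by
    refine (intervalIntegral.norm_integral_le_integral_norm (by linarith)).trans ?_
    rw [← intervalIntegral.integral_comp_neg
      (fun t : ℝ => ‖G (((-K : ℝ) : ℂ) + (t : ℂ) * Complex.I)‖)]
    refine le_trans (le_of_eq ?_) (hvert M hN1)
    congr 1
    ext t
    rw [← norm_comp_sub_eq_norm_comp_add hGconj]
    congr 2
    push_cast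
    ring
  -- horizontal pieces at height `M`
  have hq : 0 < M / (2 * Real.pi) := by positivity
  have hpt : ∀ x ∈ Set.uIoc (-M) (-K), ‖G ((x : ℂ) + (M : ℂ) * Complex.I)‖
      ≤ 1.01 * A * (2 * Real.pi * Y) * (M / (2 * Real.pi)) ^ (-(1 / 2 : ℝ)) / M := by
    intro x hx
    rw [Set.uIoc_of_le (by linarith)] at hx
    have hx1 : x ≤ -1 := by linarith [hx.2]
    rw [hG]
    simp only [norm_mul]
    have h1 := norm_xiFactor_le x M (by linarith) (by linarith)
    have h2 := hDY ((x : ℂ) + (M : ℂ) * Complex.I) (by simp; linarith)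
    have h3 : ((x : ℂ) + (M : ℂ) * Complex.I).re = x := by simp
    rw [h3] at h2
    have hY0 : 0 < Y := by linarith
    have h4 : (M / (2 * Real.pi)) ^ x * Y ^ (-x) ≤ (2 * Real.pi * Y) / M := by
      rw [Real.rpow_neg hY0.le, ← div_eq_mul_inv, ← Real.div_rpow hq.le hY0.le, div_div]
      have h5 : 1 ≤ M / (2 * Real.pi * Y) := by
        rw [le_div_iff₀ (by positivity)]; linarith
      calc (M / (2 * Real.pi * Y)) ^ x ≤ (M / (2 * Real.pi * Y)) ^ (-1 : ℝ) :=
            Real.rpow_le_rpow_of_exponent_le h5 hx1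
        _ = _ := by rw [Real.rpow_neg_one, inv_div]
    calc _ ≤ 1.01 * (M / (2 * Real.pi)) ^ (x - 1 / 2) * (A * Y ^ (-x)) := by gcongr
      _ = 1.01 * A * (M / (2 * Real.pi)) ^ (-(1 / 2 : ℝ)) *
          ((M / (2 * Real.pi)) ^ x * Y ^ (-x)) := by
        rw [show x - 1 / 2 = x + -(1 / 2) by ring, Real.rpow_add hq]; ring
      _ ≤ 1.01 * A * (M / (2 * Real.pi)) ^ (-(1 / 2 : ℝ)) * ((2 * Real.pi * Y) / M) := by gcongr
      _ = _ := by ring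
  have hlen : |-K - -M| ≤ M := by rw [abs_of_nonneg (by linarith)]; linarith
  have hE : 1.01 * A * (2 * Real.pi * Y) * (M / (2 * Real.pi)) ^ (-(1 / 2 : ℝ)) / M * |-K - -M|
      ≤ e₁ N := by
    calc _ ≤ 1.01 * A * (2 * Real.pi * Y) * (M / (2 * Real.pi)) ^ (-(1 / 2 : ℝ)) / M * M := by
          gcongr
      _ = 1.01 * A * (2 * Real.pi * Y) * (M / (2 * Real.pi)) ^ (-(1 / 2 : ℝ)) := by
          field_simp
  have b5 : ‖∫ x : ℝ in (-M)..(-K), G ((x : ℂ) + (M : ℂ) * Complex.I)‖ ≤ e₁ N :=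
    (intervalIntegral.norm_integral_le_of_norm_le_const hpt).trans hE
  have b6 : ‖∫ x : ℝ in (-M)..(-K), G ((x : ℂ) - (M : ℂ) * Complex.I)‖ ≤ e₁ N :=
    (intervalIntegral.norm_integral_le_of_norm_le_const (fun x hx => by
      rw [norm_comp_sub_eq_norm_comp_add hGconj]; exact hpt x hx)).trans hE
  -- the closing piece on `Re s = -M`
  have b7 : ‖∫ t : ℝ in (-M)..M, G (((-M : ℝ) : ℂ) + (t : ℂ) * Complex.I)‖ ≤ e₂ N := by
    have hpt2 : ∀ t ∈ Set.uIoc (-M) M, ‖G (((-M : ℝ) : ℂ) + (t : ℂ) * Complex.I)‖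
        ≤ (2 * Real.pi) ^ (2 * N + 1) * Real.pi / (2 * N + 1).factorial
          * (A * Y ^ (2 * N + 1)) := by
      intro t _
      rw [hG]
      simp only [norm_mul]
      have h1 := norm_xiFactor_neg_odd_le N t
      have h2 := hDY (((-M : ℝ) : ℂ) + (t : ℂ) * Complex.I) (by simp; linarith)
      have h3 : Y ^ (-(((-M : ℝ) : ℂ) + (t : ℂ) * Complex.I).re) = Y ^ (2 * N + 1) := by
        rw [← Real.rpow_natCast]
        congr 1
        simp [hM]
      rw [h3] at h2
      gcongr
    refine (intervalIntegral.norm_integral_le_of_norm_le_const hpt2).trans (le_of_eq ?_)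
    rw [abs_of_nonneg (by linarith), he₂]
    simp only
    rw [mul_pow]
    ring
  have htri : C - 2 * Real.pi * Complex.I * ∑ j ∈ Finset.range (N + 1), xiResidue D j
      = (∫ x : ℝ in (-K)..σ₀, G ((x : ℂ) + (T : ℂ) * Complex.I))
      - (∫ x : ℝ in (-K)..σ₀, G ((x : ℂ) - (T : ℂ) * Complex.I))
      - Complex.I * (∫ t : ℝ in (-M)..(-T), G (((-K : ℝ) : ℂ) + (t : ℂ) * Complex.I))
      - Complex.I * (∫ t : ℝ in T..M, G (((-K : ℝ) : ℂ) + (t : ℂ) * Complex.I))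
      - (∫ x : ℝ in (-M)..(-K), G ((x : ℂ) - (M : ℂ) * Complex.I))
      + (∫ x : ℝ in (-M)..(-K), G ((x : ℂ) + (M : ℂ) * Complex.I))
      + Complex.I * (∫ t : ℝ in (-M)..M, G (((-M : ℝ) : ℂ) + (t : ℂ) * Complex.I)) := by
    rw [hmain]; ring
  rw [htri]
  refine (norm_add_le _ _).trans ?_
  refine (add_le_add_left (norm_add_le _ _) _).trans ?_
  refine (add_le_add_left (add_le_add_left (norm_sub_le _ _) _) _).trans ?_
  refine (add_le_add_left (add_le_add_left (add_le_add_left (norm_sub_le _ _) _) _) _).trans ?_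
  refine (add_le_add_left (add_le_add_left (add_le_add_left (add_le_add_left
    (norm_sub_le _ _) _) _) _) _).trans ?_
  refine (add_le_add_left (add_le_add_left (add_le_add_left (add_le_add_left (add_le_add_left
    (norm_sub_le _ _) _) _) _) _) _).trans ?_
  simp only [norm_mul, Complex.norm_I, one_mul]
  linarith

/-! ### The Kuzmin–Landau inequality and van der Corput's second derivative test -/

/-- The additive character `x ↦ exp (2πix)`. -/
noncomputable def unitExp (x : ℝ) : ℂ := Complex.exp ((2 * Real.pi * x : ℝ) * Complex.I)

lemma norm_unitExp (x : ℝ) : ‖unitExp x‖ = 1 := Complex.norm_exp_ofReal_mul_I _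

lemma two_mul_le_abs_sin_pi_mul (k : ℤ) (δ θ : ℝ) (hδ : 0 < δ) (h1 : k + δ ≤ θ)
    (h2 : θ ≤ k + 1 - δ) : 2 * δ ≤ |Real.sin (Real.pi * θ)| := by
  have hpi := Real.pi_pos
  have e : |Real.sin (Real.pi * θ)| = |Real.sin (Real.pi * (θ - k))| := by
    rw [show Real.pi * θ = Real.pi * (θ - k) + k * Real.pi by ring, Real.sin_add_int_mul_pi,
      abs_mul]
    simp
  rw [e]
  set y := θ - k with hy
  have hy1 : δ ≤ y := by linarith
  have hy2 : y ≤ 1 - δ := by linarith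
  refine le_trans ?_ (le_abs_self _)
  rcases le_total y (1 / 2) with h | h
  · have := Real.mul_le_sin (x := Real.pi * y) (mul_nonneg hpi.le (by linarith)) (by nlinarith)
    have e2 : 2 / Real.pi * (Real.pi * y) = 2 * y := by field_simp
    linarith
  · have := Real.mul_le_sin (x := Real.pi * (1 - y)) (by nlinarith) (by nlinarith)
    have e2 : 2 / Real.pi * (Real.pi * (1 - y)) = 2 * (1 - y) := by field_simp
    rw [show Real.pi * (1 - y) = Real.pi - Real.pi * y by ring, Real.sin_pi_sub] at this
    rw [show Real.pi - Real.pi * y = Real.pi * (1 - y) by ring] at this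
    linarith

/-- `1 / (1 - e(θ)) = (1 + i cot (πθ)) / 2`. -/
noncomputable def cotWeight (θ : ℝ) : ℂ :=
  (1 + Complex.I * (Real.cos (Real.pi * θ) / Real.sin (Real.pi * θ) : ℝ)) / 2

lemma unitExp_sub_mul_cotWeight (u v : ℝ) (h : Real.sin (Real.pi * (v - u)) ≠ 0) :
    (unitExp u - unitExp v) * cotWeight (v - u) = unitExp u := by
  have e : unitExp v = unitExp u * (Complex.cos (Real.pi * (v - u) : ℝ)
      + Complex.sin (Real.pi * (v - u) : ℝ) * Complex.I) ^ 2 := by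
    rw [← Complex.exp_mul_I, ← Complex.exp_nat_mul, unitExp, unitExp, ← Complex.exp_add]
    congr 1
    push_cast
    ring
  rw [e, cotWeight, ← Complex.ofReal_cos, ← Complex.ofReal_sin]
  have hs : (Real.sin (Real.pi * (v - u)) : ℂ) ≠ 0 := by exact_mod_cast h
  have h1 : (Real.cos (Real.pi * (v - u)) : ℂ) ^ 2 = 1 - (Real.sin (Real.pi * (v - u)) : ℂ) ^ 2 := by
    have := Real.sin_sq_add_cos_sq (Real.pi * (v - u))
    rw [eq_sub_iff_add_eq, add_comm]
    exact_mod_cast this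
  set c : ℂ := (Real.cos (Real.pi * (v - u)) : ℂ)
  set s : ℂ := (Real.sin (Real.pi * (v - u)) : ℂ)
  rw [Complex.ofReal_div]
  change (unitExp u - unitExp u * (c + s * Complex.I) ^ 2) * ((1 + Complex.I * (c / s)) / 2) = _
  have hI : Complex.I ^ 2 = -1 := Complex.I_sq
  have h2 : (1 - (c + s * Complex.I) ^ 2) * (s + Complex.I * c) = 2 * s := by
    have : (1 - (c + s * Complex.I) ^ 2) = 2 * s * (s - c * Complex.I) := by
      linear_combination -h1 - s ^ 2 * hI
    rw [this]
    linear_combination 2 * s * h1 - 2 * s * c ^ 2 * hI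
  calc _ = unitExp u * ((1 - (c + s * Complex.I) ^ 2) * (s + Complex.I * c)) / (2 * s) := by
        field_simp
    _ = unitExp u := by rw [h2]; field_simp

lemma norm_cotWeight_le (θ d : ℝ) (hd : 0 < d) (h : d ≤ |Real.sin (Real.pi * θ)|) :
    ‖cotWeight θ‖ ≤ 1 / (2 * d) := by
  have hs : Real.sin (Real.pi * θ) ≠ 0 := by
    intro h0; rw [h0, abs_zero] at h; linarith
  have e : ‖cotWeight θ‖ = 1 / (2 * |Real.sin (Real.pi * θ)|) := by
    rw [cotWeight, norm_div, Complex.norm_ofNat, mul_comm Complex.I]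
    have : (1 : ℂ) = ((1 : ℝ) : ℂ) := by simp
    rw [this, Complex.norm_add_mul_I]
    have h2 : (1 : ℝ) ^ 2 + (Real.cos (Real.pi * θ) / Real.sin (Real.pi * θ)) ^ 2
        = (1 / Real.sin (Real.pi * θ)) ^ 2 := by
      field_simp
      rw [Real.sin_sq_add_cos_sq]
    rw [h2, Real.sqrt_sq_eq_abs, abs_div, abs_one]
    field_simp
  rw [e]
  gcongr

lemma abs_cot_le (θ d : ℝ) (hd : 0 < d) (h : d ≤ |Real.sin (Real.pi * θ)|) :
    |Real.cos (Real.pi * θ) / Real.sin (Real.pi * θ)| ≤ 1 / d := by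
  rw [abs_div]
  gcongr
  exact Real.abs_cos_le_one _

lemma cot_antitone (k : ℤ) (δ x y : ℝ) (hδ : 0 < δ) (h1 : k + δ ≤ x) (hxy : x ≤ y)
    (h2 : y ≤ k + 1 - δ) :
    Real.cos (Real.pi * y) / Real.sin (Real.pi * y)
      ≤ Real.cos (Real.pi * x) / Real.sin (Real.pi * x) := by
  have hpi := Real.pi_pos
  have e : ∀ z : ℝ, Real.cos (Real.pi * z) / Real.sin (Real.pi * z)
      = Real.cos (Real.pi * (z - k)) / Real.sin (Real.pi * (z - k)) := by
    intro z
    rw [show Real.pi * z = Real.pi * (z - k) + k * Real.pi by ring, Real.sin_add_int_mul_pi,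
      Real.cos_add_int_mul_pi]
    have : ((-1 : ℝ) ^ k) ≠ 0 := zpow_ne_zero _ (by norm_num)
    rw [mul_div_mul_left _ _ this]
  rw [e x, e y]
  have hx : 0 < Real.sin (Real.pi * (x - k)) :=
    Real.sin_pos_of_pos_of_lt_pi (by nlinarith) (by nlinarith)
  have hy : 0 < Real.sin (Real.pi * (y - k)) :=
    Real.sin_pos_of_pos_of_lt_pi (by nlinarith) (by nlinarith)
  rw [div_le_div_iff₀ hy hx]
  have h3 : 0 ≤ Real.sin (Real.pi * (y - k) - Real.pi * (x - k)) :=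
    Real.sin_nonneg_of_nonneg_of_le_pi (by nlinarith) (by nlinarith)
  rw [Real.sin_sub] at h3
  linarith

/-- The **Kuzmin–Landau inequality**: an exponential sum whose successive differences increase
and stay at distance at least `δ` from the integers is at most `1 / δ`. -/
lemma norm_sum_unitExp_le_of_far (u : ℕ → ℝ) (k : ℤ) (δ : ℝ) (hδ : 0 < δ) (n : ℕ)
    (hmono : ∀ j < n, u (j + 1) - u j ≤ u (j + 2) - u (j + 1))
    (hfar : ∀ j ≤ n, k + δ ≤ u (j + 1) - u j ∧ u (j + 1) - u j ≤ k + 1 - δ) :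
    ‖∑ j ∈ Finset.range (n + 1), unitExp (u j)‖ ≤ 1 / δ := by
  set θ : ℕ → ℝ := fun j => u (j + 1) - u j with hθ
  set c : ℕ → ℝ := fun j => Real.cos (Real.pi * θ j) / Real.sin (Real.pi * θ j) with hc
  have hsin : ∀ j ≤ n, 2 * δ ≤ |Real.sin (Real.pi * θ j)| := fun j hj =>
    two_mul_le_abs_sin_pi_mul k δ _ hδ (hfar j hj).1 (hfar j hj).2
  have hne : ∀ j ≤ n, Real.sin (Real.pi * θ j) ≠ 0 := by
    intro j hj h0
    have := hsin j hj
    rw [h0, abs_zero] at this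
    linarith
  have key : ∀ m ≤ n, ‖(∑ j ∈ Finset.range (m + 1), unitExp (u j))
      + unitExp (u (m + 1)) * cotWeight (θ m)‖ ≤ ‖cotWeight (θ 0)‖ + (c 0 - c m) / 2 := by
    intro m
    induction m with
    | zero =>
      intro h0
      have := unitExp_sub_mul_cotWeight (u 0) (u 1) (hne 0 h0)
      rw [Finset.sum_range_one, ← this, hθ]
      simp only [zero_add]
      rw [← add_mul, sub_add_cancel, norm_mul, norm_unitExp, one_mul]
      simp
    | succ m ih =>
      intro hm
      have h1 := ih (by omega)
      have h2 := unitExp_sub_mul_cotWeight (u (m + 1)) (u (m + 2)) (hne (m + 1) hm)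
      have e : (∑ j ∈ Finset.range (m + 1 + 1), unitExp (u j))
          + unitExp (u (m + 1 + 1)) * cotWeight (θ (m + 1))
          = ((∑ j ∈ Finset.range (m + 1), unitExp (u j)) + unitExp (u (m + 1)) * cotWeight (θ m))
            + unitExp (u (m + 1)) * (cotWeight (θ (m + 1)) - cotWeight (θ m)) := by
        rw [Finset.sum_range_succ _ (m + 1)]
        change (unitExp (u (m + 1)) - unitExp (u (m + 2))) * cotWeight (θ (m + 1)) = _ at h2
        linear_combination -h2
      rw [e]
      refine (norm_add_le _ _).trans ?_
      have h3 : cotWeight (θ (m + 1)) - cotWeight (θ m)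
          = Complex.I * (((c (m + 1) - c m) / 2 : ℝ) : ℂ) := by
        simp only [cotWeight, hc]
        push_cast
        ring
      have h4 : c (m + 1) ≤ c m :=
        cot_antitone k δ _ _ hδ (hfar m (by omega)).1 (hmono m (by omega)) (hfar (m + 1) hm).2
      rw [norm_mul, norm_unitExp, one_mul, h3, norm_mul, Complex.norm_I, one_mul,
        Complex.norm_real, Real.norm_eq_abs, abs_of_nonpos (by linarith)]
      linarith
  have h1 := key n le_rfl
  have h2 : ∀ j ≤ n, ‖cotWeight (θ j)‖ ≤ 1 / (2 * (2 * δ)) := fun j hj =>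
    norm_cotWeight_le _ _ (by positivity) (hsin j hj)
  have h3 : ∀ j ≤ n, |c j| ≤ 1 / (2 * δ) := fun j hj => abs_cot_le _ _ (by positivity) (hsin j hj)
  have h4 : ‖∑ j ∈ Finset.range (n + 1), unitExp (u j)‖
      ≤ ‖(∑ j ∈ Finset.range (n + 1), unitExp (u j)) + unitExp (u (n + 1)) * cotWeight (θ n)‖
        + ‖cotWeight (θ n)‖ := by
    have := norm_sub_le ((∑ j ∈ Finset.range (n + 1), unitExp (u j))
      + unitExp (u (n + 1)) * cotWeight (θ n)) (unitExp (u (n + 1)) * cotWeight (θ n))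
    rwa [add_sub_cancel_right, norm_mul _ (cotWeight (θ n)), norm_unitExp, one_mul] at this
  have h5 := h2 0 (by omega)
  have h6 := h2 n le_rfl
  have h7 := (abs_le.mp (h3 0 (by omega))).2
  have h8 := (abs_le.mp (h3 n le_rfl)).1
  have e1 : 1 / (2 * (2 * δ)) = 1 / δ / 4 := by field_simp; norm_num
  have e2 : 1 / (2 * δ) = 1 / δ / 2 := by field_simp
  rw [e1] at h5 h6
  rw [e2] at h7 h8
  linarith

section separated

variable {u : ℕ → ℝ} {p q : ℕ} {lam : ℝ}

lemma mul_sub_le_of_separated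
    (hsep : ∀ j, p ≤ j → j < q → lam ≤ (u (j + 2) - u (j + 1)) - (u (j + 1) - u j))
    (i j : ℕ) (hpi : p ≤ i) (hij : i ≤ j) (hjq : j ≤ q) :
    lam * (j - i : ℝ) ≤ (u (j + 1) - u j) - (u (i + 1) - u i) := by
  induction j, hij using Nat.le_induction with
  | base => simp
  | succ j hij ih =>
    have h1 := ih (by omega)
    have h2 := hsep j (by omega) (by omega)
    push_cast
    linarith

lemma le_of_separated (hlam : 0 < lam)
    (hsep : ∀ j, p ≤ j → j < q → lam ≤ (u (j + 2) - u (j + 1)) - (u (j + 1) - u j))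
    (i j : ℕ) (hpi : p ≤ i) (hij : i ≤ j) (hjq : j ≤ q) :
    u (i + 1) - u i ≤ u (j + 1) - u j := by
  have := mul_sub_le_of_separated hsep i j hpi hij hjq
  have h2 : (i : ℝ) ≤ j := by exact_mod_cast hij
  nlinarith

/-- The discrete form of **van der Corput's second derivative test**: if the successive
differences of the phases increase by at least `lam` at each step, the sum splits, around each
integer in their range, into at most `2δ/lam + 1` terms with a difference within `δ` of the integer
and a block to which the Kuzmin–Landau inequality applies. -/
lemma norm_sum_unitExp_le_of_separated (hlam : 0 < lam) (hpq : p ≤ q)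
    (hsep : ∀ j, p ≤ j → j < q → lam ≤ (u (j + 2) - u (j + 1)) - (u (j + 1) - u j))
    (δ : ℝ) (hδ : 0 < δ) :
    ‖∑ j ∈ Finset.Icc p q, unitExp (u j)‖
      ≤ ((u (q + 1) - u q) - (u (p + 1) - u p) + 2) * (2 * δ / lam + 1 + 1 / δ) := by
  set θ : ℕ → ℝ := fun j => u (j + 1) - u j with hθ
  have hmono : ∀ i j, p ≤ i → i ≤ j → j ≤ q → θ i ≤ θ j := le_of_separated hlam hsep
  set κ : ℕ → ℤ := fun j => ⌊θ j + δ⌋ with hκ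
  have hmaps : ∀ j ∈ Finset.Icc p q, κ j ∈ Finset.Icc (κ p) (κ q) := by
    intro j hj
    rw [Finset.mem_Icc] at hj ⊢
    refine ⟨Int.floor_le_floor (by linarith [hmono p j le_rfl hj.1 hj.2]),
      Int.floor_le_floor (by linarith [hmono j q hj.1 hj.2 le_rfl])⟩
  rw [← Finset.sum_fiberwise_of_maps_to hmaps]
  have hfib : ∀ k ∈ Finset.Icc (κ p) (κ q),
      ‖∑ j ∈ Finset.Icc p q with κ j = k, unitExp (u j)‖ ≤ 2 * δ / lam + 1 + 1 / δ := by
    intro k _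
    rw [← Finset.sum_filter_add_sum_filter_not _ (fun j => θ j < k + δ)]
    refine (norm_add_le _ _).trans (add_le_add ?_ ?_)
    · -- the differences close to `k`
      set S := Finset.filter (fun j => θ j < k + δ) (Finset.filter (fun j => κ j = k)
        (Finset.Icc p q)) with hS
      have hmem : ∀ j ∈ S, p ≤ j ∧ j ≤ q ∧ (k : ℝ) - δ ≤ θ j ∧ θ j < k + δ := by
        intro j hj
        rw [hS, Finset.mem_filter, Finset.mem_filter, Finset.mem_Icc] at hj
        refine ⟨hj.1.1.1, hj.1.1.2, ?_, hj.2⟩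
        have := Int.floor_le (θ j + δ)
        have h2 : ⌊θ j + δ⌋ = k := hj.1.2
        rw [h2] at this
        linarith
      refine (norm_sum_le _ _).trans ?_
      simp only [norm_unitExp, Finset.sum_const, nsmul_eq_mul, mul_one]
      rcases S.eq_empty_or_nonempty with h0 | hne
      · rw [h0]; simp; positivity
      · have h1 := hmem _ (S.min'_mem hne)
        have h2 := hmem _ (S.max'_mem hne)
        have h3 : S.min' hne ≤ S.max' hne := S.min'_le _ (S.max'_mem hne)
        have h4 : S.card ≤ S.max' hne + 1 - S.min' hne := by
          rw [← Nat.card_Icc]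
          apply Finset.card_le_card
          intro j hj
          exact Finset.mem_Icc.mpr ⟨S.min'_le _ hj, S.le_max' _ hj⟩
        have h5 : (S.card : ℝ) ≤ S.max' hne - S.min' hne + 1 := by
          have : (S.card : ℤ) ≤ S.max' hne - S.min' hne + 1 := by omega
          exact_mod_cast this
        have h6 := mul_sub_le_of_separated hsep _ _ h1.1 h3 h2.2.1
        have h7 : ((S.max' hne : ℝ) - S.min' hne) ≤ 2 * δ / lam := by
          rw [le_div_iff₀ hlam]
          have h8 := h1.2.2.1
          have h9 := h2.2.2.2
          simp only [hθ] at h8 h9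
          linarith
        linarith
    · -- the differences at distance at least `δ` from the integers
      set S := Finset.filter (fun j => ¬ θ j < k + δ) (Finset.filter (fun j => κ j = k)
        (Finset.Icc p q)) with hS
      have hmem : ∀ j, j ∈ S ↔ (p ≤ j ∧ j ≤ q) ∧ (k : ℝ) + δ ≤ θ j ∧ θ j < k + 1 - δ := by
        intro j
        rw [hS, Finset.mem_filter, Finset.mem_filter, Finset.mem_Icc, not_lt, and_assoc]
        have : κ j = k ↔ (k : ℝ) ≤ θ j + δ ∧ θ j + δ < k + 1 := Int.floor_eq_iff
        rw [this]
        constructor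
        · rintro ⟨h1, ⟨h2, h3⟩, h4⟩
          exact ⟨h1, h4, by linarith⟩
        · rintro ⟨h1, h2, h3⟩
          exact ⟨h1, ⟨by linarith, by linarith⟩, h2⟩
      rcases S.eq_empty_or_nonempty with h0 | hne
      · rw [h0]; simp; positivity
      · have h1 := (hmem _).mp (S.min'_mem hne)
        have h2 := (hmem _).mp (S.max'_mem hne)
        set m := S.min' hne
        set M := S.max' hne
        have h3 : m ≤ M := S.min'_le _ (S.max'_mem hne)
        have hSI : S = Finset.Icc m M := by
          ext j
          rw [Finset.mem_Icc]
          constructor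
          · intro hj
            exact ⟨S.min'_le _ hj, S.le_max' _ hj⟩
          · rintro ⟨hj1, hj2⟩
            rw [hmem]
            have h5 := hmono m j h1.1.1 hj1 (by omega)
            have h6 := hmono j M (by omega) hj2 h2.1.2
            exact ⟨⟨by omega, by omega⟩, by linarith, by linarith⟩
        have e : ∑ j ∈ S, unitExp (u j)
            = ∑ j ∈ Finset.range (M - m + 1), unitExp ((fun i => u (m + i)) j) := by
          rw [hSI, ← Finset.Ico_add_one_right_eq_Icc, Finset.sum_Ico_eq_sum_range,
            Nat.sub_add_comm h3]
        rw [e]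
        apply norm_sum_unitExp_le_of_far _ k δ hδ
        · intro j hj
          have := hmono (m + j) (m + j + 1) (by omega) (by omega) (by omega)
          exact this
        · intro j hj
          have h5 := hmono m (m + j) h1.1.1 (by omega) (by omega)
          have h6 := hmono (m + j) M (by omega) (by omega) h2.1.2
          constructor
          · exact h1.2.1.trans h5
          · exact h6.trans h2.2.2.le
  refine (norm_sum_le _ _).trans ((Finset.sum_le_sum hfib).trans ?_)
  rw [Finset.sum_const, nsmul_eq_mul]
  have hcard : ((Finset.Icc (κ p) (κ q)).card : ℝ) ≤ θ q - θ p + 2 := by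
    have hle : κ p ≤ κ q := (Finset.mem_Icc.mp (hmaps q (Finset.mem_Icc.mpr ⟨hpq, le_rfl⟩))).1
    have h1 : ((Finset.Icc (κ p) (κ q)).card : ℤ) = κ q + 1 - κ p := by
      rw [Int.card_Icc, Int.toNat_of_nonneg (by omega)]
    have h2 : ((Finset.Icc (κ p) (κ q)).card : ℝ) = κ q + 1 - κ p := by exact_mod_cast h1
    have h3 := Int.floor_le (θ q + δ)
    have h4 := Int.lt_floor_add_one (θ p + δ)
    rw [h2]
    simp only [hκ]
    linarith
  gcongr

end separated

/-! ### Exponential sums with phase `-X log b` -/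

/-- Summation by parts against increasing weights: a bound for all the tails of a sum that is
itself a sum over the tail carries over to the weighted sum term by term. -/
lemma norm_sum_mul_le_of_monotone (e : ℕ → ℂ) (w μ : ℕ → ℝ) (A : ℝ) (p q : ℕ) (hpq : p ≤ q)
    (hw0 : 0 ≤ w p) (hw : ∀ b, p ≤ b → b < q → w b ≤ w (b + 1))
    (he : ∀ r, p ≤ r → r ≤ q →
      ‖∑ b ∈ Finset.Icc r q, e b‖ ≤ A + ∑ b ∈ Finset.Icc r q, μ b) :
    ‖∑ b ∈ Finset.Icc p q, (w b : ℂ) * e b‖ ≤ A * w q + ∑ b ∈ Finset.Icc p q, w b * μ b := by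
  have key : ∀ r ≤ q, p ≤ r →
      ‖∑ b ∈ Finset.Icc r q, (w b : ℂ) * e b - w r * ∑ b ∈ Finset.Icc r q, e b‖
        ≤ A * (w q - w r) + ∑ b ∈ Finset.Icc r q, (w b - w r) * μ b := by
    intro r hr
    induction hr using Nat.decreasingInduction with
    | self => intro _; simp
    | of_succ r hr ih =>
      intro hpr
      have h1 := ih (by omega)
      have h2 := he (r + 1) (by omega) (by omega)
      have h3 := hw r hpr (by omega)
      have hs : ∀ {M : Type} [AddCommMonoid M] (f : ℕ → M), ∑ b ∈ Finset.Icc r q, f b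
          = f r + ∑ b ∈ Finset.Icc (r + 1) q, f b := by
        intro M _ f
        rw [← Finset.insert_Icc_add_one_left_eq_Icc (by omega : r ≤ q), Finset.sum_insert (by simp)]
      rw [hs, hs, hs]
      have e1 : (w r : ℂ) * e r + ∑ b ∈ Finset.Icc (r + 1) q, (w b : ℂ) * e b
            - w r * (e r + ∑ b ∈ Finset.Icc (r + 1) q, e b)
          = (∑ b ∈ Finset.Icc (r + 1) q, (w b : ℂ) * e b
              - w (r + 1) * ∑ b ∈ Finset.Icc (r + 1) q, e b)
            + ((w (r + 1) - w r : ℝ) : ℂ) * ∑ b ∈ Finset.Icc (r + 1) q, e b := by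
        push_cast; ring
      rw [e1]
      refine (norm_add_le _ _).trans ?_
      rw [norm_mul, Complex.norm_real, Real.norm_of_nonneg (by linarith)]
      have h4 := mul_le_mul_of_nonneg_left h2 (by linarith : 0 ≤ w (r + 1) - w r)
      have e2 : ∑ b ∈ Finset.Icc (r + 1) q, (w b - w r) * μ b
          = ∑ b ∈ Finset.Icc (r + 1) q, (w b - w (r + 1)) * μ b
            + (w (r + 1) - w r) * ∑ b ∈ Finset.Icc (r + 1) q, μ b := by
        rw [Finset.mul_sum, ← Finset.sum_add_distrib]
        exact Finset.sum_congr rfl fun b _ => by ring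
      rw [e2]
      linarith
  have h1 := key p hpq le_rfl
  have h2 := mul_le_mul_of_nonneg_left (he p le_rfl hpq) hw0
  have h3 : ‖(w p : ℂ) * ∑ b ∈ Finset.Icc p q, e b‖ = w p * ‖∑ b ∈ Finset.Icc p q, e b‖ := by
    rw [norm_mul, Complex.norm_real, Real.norm_of_nonneg hw0]
  have h4 := norm_add_le (∑ b ∈ Finset.Icc p q, (w b : ℂ) * e b - w p * ∑ b ∈ Finset.Icc p q, e b)
    ((w p : ℂ) * ∑ b ∈ Finset.Icc p q, e b)
  rw [sub_add_cancel, h3] at h4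
  have e2 : ∑ b ∈ Finset.Icc p q, w b * μ b
      = ∑ b ∈ Finset.Icc p q, (w b - w p) * μ b + w p * ∑ b ∈ Finset.Icc p q, μ b := by
    rw [Finset.mul_sum, ← Finset.sum_add_distrib]
    exact Finset.sum_congr rfl fun b _ => by ring
  rw [e2]
  linarith

lemma log_succ_sub_log_le (b : ℕ) (hb : 1 ≤ b) :
    Real.log (b + 1 : ℕ) - Real.log b ≤ 1 / b := by
  have hb' : (0 : ℝ) < b := by exact_mod_cast hb
  rw [← Real.log_div (by positivity) (by positivity)]
  have h := Real.log_le_sub_one_of_pos (x := ((b + 1 : ℕ) : ℝ) / b) (by positivity)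
  have e : ((b + 1 : ℕ) : ℝ) / b - 1 = 1 / b := by push_cast; field_simp; ring
  linarith

lemma le_log_succ_sub_log (b : ℕ) (hb : 1 ≤ b) :
    1 / ((b : ℝ) + 1) ≤ Real.log (b + 1 : ℕ) - Real.log b := by
  have hb' : (0 : ℝ) < b := by exact_mod_cast hb
  have h := Real.log_le_sub_one_of_pos (x := (b : ℝ) / ((b + 1 : ℕ) : ℝ)) (by positivity)
  rw [Real.log_div (by positivity) (by positivity)] at h
  have e : (b : ℝ) / ((b + 1 : ℕ) : ℝ) - 1 = -(1 / ((b : ℝ) + 1)) := by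
    push_cast; field_simp; ring
  linarith

lemma inv_sq_le_log_second_difference (b : ℕ) (hb : 1 ≤ b) :
    1 / ((b : ℝ) + 1) ^ 2 ≤ (Real.log (b + 1 : ℕ) - Real.log b)
      - (Real.log (b + 2 : ℕ) - Real.log (b + 1 : ℕ)) := by
  have hb' : (0 : ℝ) < b := by exact_mod_cast hb
  have h := Real.log_le_sub_one_of_pos
    (x := ((b : ℝ) * ((b + 2 : ℕ) : ℝ)) / (((b + 1 : ℕ) : ℝ) * ((b + 1 : ℕ) : ℝ))) (by positivity)
  rw [Real.log_div (by positivity) (by positivity), Real.log_mul (by positivity) (by positivity),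
    Real.log_mul (by positivity) (by positivity)] at h
  have e : ((b : ℝ) * ((b + 2 : ℕ) : ℝ)) / (((b + 1 : ℕ) : ℝ) * ((b + 1 : ℕ) : ℝ)) - 1
      = -(1 / ((b : ℝ) + 1) ^ 2) := by
    push_cast; field_simp; ring
  linarith

/-- The tails of `∑ b ^ (-2πiX)` over `b ≤ X / a`, by van der Corput's test: the differences of the
phases `-X log b` increase by at least `a² / X`. -/
lemma norm_sum_unitExp_log_le (X : ℝ) (a r q : ℕ) (ha : 1 ≤ a) (hr : 1 ≤ r) (hrq : r ≤ q)
    (haX : (a : ℝ) ^ 2 ≤ X) (hq : (a * q : ℝ) ≤ X) :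
    ‖∑ b ∈ Finset.Icc r q, unitExp (-X * Real.log b)‖
      ≤ 2 * (3.83 * Real.sqrt X / a)
        + ∑ b ∈ Finset.Icc r q, (3.83 * Real.sqrt X / a) * (X / (b : ℝ) ^ 2) := by
  have ha0 : (0 : ℝ) < a := by exact_mod_cast ha
  have hX : 0 < X := lt_of_lt_of_le (by positivity) haX
  have hs : 0 < Real.sqrt X := Real.sqrt_pos.mpr hX
  have hsX : Real.sqrt X ^ 2 = X := Real.sq_sqrt hX.le
  have hlam : 0 < (a : ℝ) ^ 2 / X := by positivity
  have h2 : 0 < Real.sqrt 2 := by positivity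
  have h22 : Real.sqrt 2 ^ 2 = 2 := Real.sq_sqrt (by norm_num)
  have hsep : ∀ j : ℕ, r ≤ j → j < q → (a : ℝ) ^ 2 / X ≤
      ((fun b : ℕ => -X * Real.log b) (j + 2) - (fun b : ℕ => -X * Real.log b) (j + 1))
      - ((fun b : ℕ => -X * Real.log b) (j + 1) - (fun b : ℕ => -X * Real.log b) j) := by
    intro j hj hjq
    have h3 := inv_sq_le_log_second_difference j (by omega)
    have h4 : (a : ℝ) ^ 2 / X ≤ X * (1 / ((j : ℝ) + 1) ^ 2) := by
      rw [mul_one_div, div_le_div_iff₀ hX (by positivity), ← mul_pow, ← sq]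
      have h5 : ((j : ℝ) + 1) ≤ q := by exact_mod_cast hjq
      gcongr
      exact (mul_le_mul_of_nonneg_left h5 ha0.le).trans hq
    have h5 := mul_le_mul_of_nonneg_left h3 hX.le
    simp only
    linarith
  -- this `δ` makes `2δ / lam` and `1 / δ` equal, which minimizes their sum
  have key := norm_sum_unitExp_le_of_separated (u := fun b : ℕ => -X * Real.log b) hlam hrq hsep
    (a / (Real.sqrt 2 * Real.sqrt X)) (by positivity)
  refine key.trans ?_
  have hc : 2 * (a / (Real.sqrt 2 * Real.sqrt X)) / ((a : ℝ) ^ 2 / X) + 1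
      + 1 / (a / (Real.sqrt 2 * Real.sqrt X)) ≤ 3.83 * Real.sqrt X / a := by
    have e1 : 2 * (a / (Real.sqrt 2 * Real.sqrt X)) / ((a : ℝ) ^ 2 / X)
        = Real.sqrt 2 * (Real.sqrt X / a) := by
      field_simp
      rw [h22, hsX]
    have e2 : 1 / (a / (Real.sqrt 2 * Real.sqrt X)) = Real.sqrt 2 * (Real.sqrt X / a) := by
      field_simp
    have e3 : 1 ≤ Real.sqrt X / a := by
      rw [le_div_iff₀ ha0, one_mul]
      exact Real.le_sqrt_of_sq_le haX
    have e4 : Real.sqrt 2 ≤ 1.415 := by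
      rw [Real.sqrt_le_left (by norm_num)]; norm_num
    rw [e1, e2, mul_div_assoc]
    nlinarith
  have hΔ : ((-X * Real.log ((q + 1 : ℕ) : ℝ)) - (-X * Real.log (q : ℝ)))
      - ((-X * Real.log ((r + 1 : ℕ) : ℝ)) - (-X * Real.log (r : ℝ)))
      ≤ ∑ b ∈ Finset.Icc r q, X / (b : ℝ) ^ 2 := by
    have h3 := mul_le_mul_of_nonneg_left (log_succ_sub_log_le r hr) hX.le
    have h4 := mul_le_mul_of_nonneg_left (le_log_succ_sub_log q (by omega)) hX.le
    have h5 : X * (1 / (r : ℝ)) - X * (1 / ((q : ℝ) + 1)) ≤ ∑ b ∈ Finset.Icc r q, X / (b : ℝ) ^ 2 := by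
      have h6 : ∀ b ∈ Finset.Icc r q, X * (1 / (b : ℝ)) - X * (1 / ((b + 1 : ℕ) : ℝ))
          ≤ X / (b : ℝ) ^ 2 := by
        intro b hb
        have hb0 : (0 : ℝ) < b := by
          have := (Finset.mem_Icc.mp hb).1
          exact_mod_cast (by omega : 0 < b)
        have : X * (1 / (b : ℝ)) - X * (1 / ((b + 1 : ℕ) : ℝ)) = X / (b * (b + 1)) := by
          push_cast; field_simp; ring
        rw [this]
        gcongr
        nlinarith
      refine le_trans (le_of_eq ?_) (Finset.sum_le_sum h6)
      rw [← Finset.Ico_add_one_right_eq_Icc, Finset.sum_Ico_eq_sum_range]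
      have := Finset.sum_range_sub' (fun i : ℕ => X * (1 / ((r + i : ℕ) : ℝ))) (q + 1 - r)
      simp only [← add_assoc] at this
      rw [this, show r + (q + 1 - r) = q + 1 by omega]
      push_cast
      ring
    linarith
  rw [← Finset.mul_sum]
  have h0 : 0 ≤ ∑ b ∈ Finset.Icc r q, X / (b : ℝ) ^ 2 :=
    Finset.sum_nonneg fun b _ => by positivity
  calc _ ≤ (∑ b ∈ Finset.Icc r q, X / (b : ℝ) ^ 2 + 2) * (3.83 * Real.sqrt X / a) := by
        gcongr
    _ = _ := by ring

/-! ### Dirichlet's hyperbola method and sums of powers -/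

section hyperbola

variable {M : Type*} [AddCommMonoid M]

lemma sum_divisors_eq_sum_sum (F : ℕ → ℕ → M) (N : ℕ) :
    ∑ n ∈ Finset.Icc 1 N, ∑ d ∈ n.divisors, F d (n / d)
      = ∑ a ∈ Finset.Icc 1 N, ∑ b ∈ Finset.Icc 1 (N / a), F a b := by
  rw [Finset.sum_sigma', Finset.sum_sigma']
  refine Finset.sum_nbij' (fun x => ⟨x.2, x.1 / x.2⟩) (fun x => ⟨x.1 * x.2, x.1⟩) ?_ ?_ ?_ ?_ ?_
  · rintro ⟨n, d⟩ h
    simp only [Finset.mem_sigma, Finset.mem_Icc, Nat.mem_divisors] at h ⊢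
    obtain ⟨⟨h1, h2⟩, h3, h4⟩ := h
    have hd := Nat.pos_of_dvd_of_pos h3 h1
    have hle := Nat.le_of_dvd h1 h3
    exact ⟨⟨hd, hle.trans h2⟩, Nat.div_pos hle hd, Nat.div_le_div_right h2⟩
  · rintro ⟨a, b⟩ h
    simp only [Finset.mem_sigma, Finset.mem_Icc, Nat.mem_divisors] at h ⊢
    obtain ⟨⟨h1, h2⟩, h3, h4⟩ := h
    have h5 : a * b ≤ N := by
      rw [mul_comm]; exact (Nat.le_div_iff_mul_le h1).mp h4
    exact ⟨⟨Nat.mul_pos h1 h3, h5⟩, dvd_mul_right _ _, (Nat.mul_pos h1 h3).ne'⟩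
  · rintro ⟨n, d⟩ h
    simp only [Finset.mem_sigma, Finset.mem_Icc, Nat.mem_divisors] at h
    have := Nat.mul_div_cancel' h.2.1
    simp [this]
  · rintro ⟨a, b⟩ h
    simp only [Finset.mem_sigma, Finset.mem_Icc] at h
    have := Nat.mul_div_cancel_left b h.1.1
    simp [this]
  · rintro ⟨n, d⟩ h
    rfl

/-- The **Dirichlet hyperbola method**: the pairs `(a, b)` with `a b ≤ N` are split according to
which of `a`, `b` is the smaller one, and that one is at most `√N`. -/
lemma sum_sum_eq_hyperbola (F : ℕ → ℕ → M) (N : ℕ) :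
    ∑ a ∈ Finset.Icc 1 N, ∑ b ∈ Finset.Icc 1 (N / a), F a b
      = ∑ a ∈ Finset.Icc 1 N.sqrt,
          (F a a + ∑ b ∈ Finset.Icc (a + 1) (N / a), (F a b + F b a)) := by
  have hle : ∀ a b : ℕ, 1 ≤ a → (b ≤ N / a ↔ a * b ≤ N) := fun a b ha => by
    rw [Nat.le_div_iff_mul_le ha, mul_comm]
  have h1 : ∑ a ∈ Finset.Icc 1 N, ∑ b ∈ Finset.Icc 1 (N / a), F a b
      = ∑ a ∈ Finset.Icc 1 N, (∑ b ∈ Finset.Icc 1 (N / a) with b < a, F a b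
        + (∑ b ∈ Finset.Icc 1 (N / a) with b = a, F a b
          + ∑ b ∈ Finset.Icc 1 (N / a) with a < b, F a b)) := by
    refine Finset.sum_congr rfl fun a _ => ?_
    rw [← Finset.sum_filter_add_sum_filter_not _ (fun b => b < a)]
    congr 1
    rw [← Finset.sum_filter_add_sum_filter_not _ (fun b => b = a), Finset.filter_filter,
      Finset.filter_filter]
    congr 1
    · refine Finset.sum_congr (Finset.filter_congr fun b _ => ?_) fun _ _ => rfl
      constructor <;> intro h <;> omega
    · refine Finset.sum_congr (Finset.filter_congr fun b _ => ?_) fun _ _ => rfl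
      constructor <;> intro h <;> omega
  rw [h1, Finset.sum_add_distrib, Finset.sum_add_distrib]
  have hA : ∑ a ∈ Finset.Icc 1 N, ∑ b ∈ Finset.Icc 1 (N / a) with b < a, F a b
      = ∑ a ∈ Finset.Icc 1 N.sqrt, ∑ b ∈ Finset.Icc (a + 1) (N / a), F b a := by
    rw [Finset.sum_sigma', Finset.sum_sigma']
    refine Finset.sum_nbij' (fun x => ⟨x.2, x.1⟩) (fun x => ⟨x.2, x.1⟩) ?_ ?_ ?_ ?_ ?_
    · rintro ⟨a, b⟩ h
      simp only [Finset.mem_sigma, Finset.mem_Icc, Finset.mem_filter, Nat.le_sqrt] at h ⊢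
      obtain ⟨⟨h1, h2⟩, ⟨h3, h4⟩, h5⟩ := h
      rw [hle a b h1] at h4
      refine ⟨⟨h3, by nlinarith⟩, h5, ?_⟩
      rw [hle b a h3, mul_comm]; exact h4
    · rintro ⟨a, b⟩ h
      simp only [Finset.mem_sigma, Finset.mem_Icc, Finset.mem_filter, Nat.le_sqrt] at h ⊢
      obtain ⟨⟨h1, h2⟩, h3, h4⟩ := h
      rw [hle a b h1] at h4
      refine ⟨⟨by omega, by nlinarith⟩, ⟨h1, ?_⟩, h3⟩
      rw [hle b a (by omega), mul_comm]; exact h4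
    all_goals rintro ⟨a, b⟩ _; rfl
  have hB : ∑ a ∈ Finset.Icc 1 N, ∑ b ∈ Finset.Icc 1 (N / a) with a < b, F a b
      = ∑ a ∈ Finset.Icc 1 N.sqrt, ∑ b ∈ Finset.Icc (a + 1) (N / a), F a b := by
    rw [Finset.sum_sigma', Finset.sum_sigma']
    refine Finset.sum_nbij' (fun x => x) (fun x => x) ?_ ?_ ?_ ?_ ?_
    · rintro ⟨a, b⟩ h
      simp only [Finset.mem_sigma, Finset.mem_Icc, Finset.mem_filter, Nat.le_sqrt] at h ⊢
      obtain ⟨⟨h1, h2⟩, ⟨h3, h4⟩, h5⟩ := h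
      have h6 := (hle a b h1).mp h4
      exact ⟨⟨h1, by nlinarith⟩, h5, h4⟩
    · rintro ⟨a, b⟩ h
      simp only [Finset.mem_sigma, Finset.mem_Icc, Finset.mem_filter, Nat.le_sqrt] at h ⊢
      obtain ⟨⟨h1, h2⟩, h3, h4⟩ := h
      exact ⟨⟨h1, by nlinarith⟩, ⟨by omega, h4⟩, h3⟩
    all_goals rintro ⟨a, b⟩ _; rfl
  have hC : ∑ a ∈ Finset.Icc 1 N, ∑ b ∈ Finset.Icc 1 (N / a) with b = a, F a b
      = ∑ a ∈ Finset.Icc 1 N.sqrt, F a a := by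
    have hsub : Finset.Icc 1 N.sqrt ⊆ Finset.Icc 1 N :=
      Finset.Icc_subset_Icc le_rfl (Nat.sqrt_le_self N)
    rw [← Finset.sum_subset hsub]
    · refine Finset.sum_congr rfl fun a ha => ?_
      rw [Finset.mem_Icc, Nat.le_sqrt] at ha
      have : (Finset.Icc 1 (N / a)).filter (fun b => b = a) = {a} := by
        ext b
        simp only [Finset.mem_filter, Finset.mem_Icc, Finset.mem_singleton]
        constructor
        · exact fun h => h.2
        · rintro rfl
          exact ⟨⟨ha.1, (hle b b ha.1).mpr ha.2⟩, rfl⟩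
      rw [this, Finset.sum_singleton]
    · intro a ha ha'
      apply Finset.sum_eq_zero
      intro b hb
      exfalso
      simp only [Finset.mem_filter, Finset.mem_Icc, Nat.le_sqrt] at ha ha' hb
      obtain ⟨⟨h1, h2⟩, rfl⟩ := hb
      exact ha' ⟨h1, (hle b b h1).mp h2⟩
  rw [hA, hB, hC, ← Finset.sum_add_distrib, ← Finset.sum_add_distrib]
  refine Finset.sum_congr rfl fun a _ => ?_
  rw [Finset.sum_add_distrib]
  rw [add_comm, add_assoc]

end hyperbola

lemma sum_rpow_div_le (q : ℕ) (hq : 1 ≤ q) (s : ℝ) (hs : 0 ≤ s) :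
    ∑ b ∈ Finset.Icc 1 q, ((b : ℝ) / q) ^ s ≤ q / (s + 1) + 1 := by
  have hq0 : (0 : ℝ) < q := by exact_mod_cast hq
  have hmono : MonotoneOn (fun x : ℝ => (x / q) ^ s) (Set.Icc ((0 : ℕ) : ℝ) (q : ℕ)) := by
    intro x hx y _ hxy
    have : (0 : ℝ) ≤ x := by simpa using hx.1
    simp only
    gcongr
  have h1 := MonotoneOn.sum_le_integral_Ico (Nat.zero_le q) hmono
  have h2 : ∫ x : ℝ in ((0 : ℕ) : ℝ)..(q : ℕ), (x / q) ^ s = q / (s + 1) := by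
    rw [intervalIntegral.integral_comp_div (fun x => x ^ s) hq0.ne',
      integral_rpow (Or.inl (by linarith))]
    rw [div_self hq0.ne', Nat.cast_zero, zero_div, Real.one_rpow,
      Real.zero_rpow (by linarith)]
    simp [div_eq_mul_inv]
  rw [h2] at h1
  obtain ⟨r, rfl⟩ : ∃ r, q = r + 1 := ⟨q - 1, by omega⟩
  rw [← Finset.Ico_add_one_right_eq_Icc, Finset.sum_Ico_succ_top (by omega)]
  have h3 : (((r + 1 : ℕ) : ℝ) / ((r + 1 : ℕ) : ℝ)) ^ s = 1 := by
    rw [div_self hq0.ne', Real.one_rpow]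
  rw [h3]
  have h4 : ∑ b ∈ Finset.Ico 1 (r + 1), ((b : ℝ) / ((r + 1 : ℕ) : ℝ)) ^ s
      ≤ ∑ i ∈ Finset.Ico 0 (r + 1), ((i : ℝ) / ((r + 1 : ℕ) : ℝ)) ^ s :=
    Finset.sum_le_sum_of_subset_of_nonneg (Finset.Ico_subset_Ico (by omega) le_rfl)
      fun i _ _ => by positivity
  linarith

lemma sum_rpow_neg_le (q : ℕ) (s : ℝ) (hs : 0 ≤ s) (hs1 : s < 1) :
    ∑ b ∈ Finset.Icc 1 q, (b : ℝ) ^ (-s) ≤ (q : ℝ) ^ (1 - s) / (1 - s) := by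
  have hanti : ∀ b : ℕ, 1 ≤ b → (b : ℝ) ^ (-s)
      ≤ ((b : ℝ) ^ (1 - s) - ((b - 1 : ℕ) : ℝ) ^ (1 - s)) / (1 - s) := by
    intro b hb
    have hb0 : (0 : ℝ) < b := by exact_mod_cast hb
    have h1s : 0 < 1 - s := by linarith
    rw [le_div_iff₀ h1s]
    -- Bernoulli's inequality for `(1 - 1/b) ^ (1 - s)`
    have hbern := rpow_one_add_le_one_add_mul_self (s := -(1 / (b : ℝ))) (by
      have : 1 / (b : ℝ) ≤ 1 := by rw [div_le_one hb0]; exact_mod_cast hb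
      linarith) h1s.le (by linarith : 1 - s ≤ 1)
    have e : ((b - 1 : ℕ) : ℝ) = b * (1 + -(1 / (b : ℝ))) := by
      rw [Nat.cast_sub hb]; field_simp; push_cast; ring
    have h0 : 0 ≤ 1 + -(1 / (b : ℝ)) := by
      have : 1 / (b : ℝ) ≤ 1 := by rw [div_le_one hb0]; exact_mod_cast hb
      linarith
    rw [e, Real.mul_rpow hb0.le h0]
    have hp : 0 < (b : ℝ) ^ (1 - s) := by positivity
    have e2 : (b : ℝ) ^ (-s) = (b : ℝ) ^ (1 - s) * (1 / b) := by
      rw [show -s = (1 - s) - 1 by ring, Real.rpow_sub hb0, Real.rpow_one]; ring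
    rw [e2]
    nlinarith
  calc ∑ b ∈ Finset.Icc 1 q, (b : ℝ) ^ (-s)
      ≤ ∑ b ∈ Finset.Icc 1 q, ((b : ℝ) ^ (1 - s) - ((b - 1 : ℕ) : ℝ) ^ (1 - s)) / (1 - s) :=
        Finset.sum_le_sum fun b hb => hanti b (Finset.mem_Icc.mp hb).1
    _ = (q : ℝ) ^ (1 - s) / (1 - s) := by
        rw [← Finset.sum_div]
        congr 1
        rw [← Finset.Ico_add_one_right_eq_Icc, Finset.sum_Ico_eq_sum_range]
        have := Finset.sum_range_sub (fun i : ℕ => (i : ℝ) ^ (1 - s)) q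
        rw [Nat.cast_zero, Real.zero_rpow (by linarith), sub_zero] at this
        rw [← this]
        refine Finset.sum_congr (by simp) fun i _ => ?_
        rw [show 1 + i - 1 = i by omega, add_comm 1 i]

lemma sum_inv_le_one_add_log (q : ℕ) (Y : ℝ) (hY : 1 ≤ Y) (hq : (q : ℝ) ≤ Y) :
    ∑ b ∈ Finset.Icc 1 q, 1 / (b : ℝ) ≤ 1 + Real.log Y := by
  have h := harmonic_floor_le_one_add_log Y hY
  have h2 : q ≤ ⌊Y⌋₊ := Nat.le_floor hq
  rw [harmonic_eq_sum_Icc] at h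
  push_cast at h
  refine le_trans ?_ h
  refine (Finset.sum_le_sum_of_subset_of_nonneg (Finset.Icc_subset_Icc le_rfl h2)
    fun i _ _ => by positivity).trans (le_of_eq ?_)
  exact Finset.sum_congr rfl fun b _ => one_div _

/-! ### Bounds for the Dirichlet polynomial -/

/-- The summand of `∑ d_α(n) n^(-s)` belonging to the factorization `n = a b`. -/
noncomputable def divisorTerm (α : ℝ) (s : ℂ) (a b : ℕ) : ℂ :=
  (((a : ℝ) ^ α : ℝ) : ℂ) * ((a * b : ℕ) : ℂ) ^ (-s)

lemma divisorDirichletPoly_eq_sum (α X : ℝ) (s : ℂ) :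
    divisorDirichletPoly α X s
      = ∑ a ∈ Finset.Icc 1 ⌊X⌋₊, ∑ b ∈ Finset.Icc 1 (⌊X⌋₊ / a), divisorTerm α s a b := by
  rw [← sum_divisors_eq_sum_sum, divisorDirichletPoly]
  refine Finset.sum_congr rfl fun n _ => ?_
  rw [divisorPowerSum, Complex.ofReal_sum, Finset.sum_mul]
  refine Finset.sum_congr rfl fun d hd => ?_
  rw [divisorTerm, Nat.mul_div_cancel' (Nat.dvd_of_mem_divisors hd)]

lemma norm_divisorTerm (α : ℝ) (s : ℂ) (a b : ℕ) (ha : 1 ≤ a) (hb : 1 ≤ b) :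
    ‖divisorTerm α s a b‖ = (a : ℝ) ^ α * ((a : ℝ) * b) ^ (-s.re) := by
  rw [divisorTerm, norm_mul, Complex.norm_real, Real.norm_of_nonneg (by positivity),
    Complex.norm_natCast_cpow_of_pos (Nat.mul_pos ha hb), Complex.neg_re]
  push_cast
  rfl

section bounds

variable {X : ℝ}

lemma mul_le_of_le_floor_div (hX : 0 ≤ X) {a b : ℕ} (ha : 1 ≤ a) (hb : b ≤ ⌊X⌋₊ / a) :
    (a : ℝ) * b ≤ X := by
  have h1 : a * b ≤ ⌊X⌋₊ := by
    rw [mul_comm]; exact (Nat.le_div_iff_mul_le ha).mp hb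
  calc (a : ℝ) * b = ((a * b : ℕ) : ℝ) := by push_cast; ring
    _ ≤ ⌊X⌋₊ := by exact_mod_cast h1
    _ ≤ X := Nat.floor_le hX

lemma lt_mul_floor_div_add_one {a : ℕ} (ha : 1 ≤ a) :
    X < (a : ℝ) * ((⌊X⌋₊ / a : ℕ) + 1) := by
  have h1 : ⌊X⌋₊ < (⌊X⌋₊ / a + 1) * a := (Nat.div_lt_iff_lt_mul ha).mp (Nat.lt_succ_self _)
  have h2 : ((⌊X⌋₊ : ℝ) + 1) ≤ a * ((⌊X⌋₊ / a : ℕ) + 1) := by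
    have : ⌊X⌋₊ + 1 ≤ a * (⌊X⌋₊ / a + 1) := by rw [mul_comm]; exact h1
    exact_mod_cast this
  exact (Nat.lt_floor_add_one X).trans_le h2

lemma sq_le_of_le_sqrt_floor (hX : 0 ≤ X) {a : ℕ} (ha : a ≤ ⌊X⌋₊.sqrt) : (a : ℝ) ^ 2 ≤ X := by
  have h1 := Nat.le_sqrt.mp ha
  calc (a : ℝ) ^ 2 = ((a * a : ℕ) : ℝ) := by push_cast; ring
    _ ≤ ⌊X⌋₊ := by exact_mod_cast h1
    _ ≤ X := Nat.floor_le hX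

lemma le_sqrt_of_le_sqrt_floor (hX : 0 ≤ X) {a : ℕ} (ha : a ≤ ⌊X⌋₊.sqrt) :
    (a : ℝ) ≤ Real.sqrt X := Real.le_sqrt_of_sq_le (sq_le_of_le_sqrt_floor hX ha)

lemma sum_inv_sqrt_floor_le (hX : 1 ≤ X) :
    ∑ a ∈ Finset.Icc 1 ⌊X⌋₊.sqrt, 1 / (a : ℝ) ≤ 1 + Real.log X / 2 := by
  have h := sum_inv_le_one_add_log ⌊X⌋₊.sqrt (Real.sqrt X) (Real.one_le_sqrt.mpr hX)
    (le_sqrt_of_le_sqrt_floor (by linarith) le_rfl)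
  rwa [Real.log_sqrt (by linarith)] at h

lemma rpow_le_rpow_of_mul_le {α : ℝ} (hα : 0 ≤ α) {a b : ℕ} (ha : 1 ≤ a) (hb : 1 ≤ b)
    (h : (a : ℝ) * b ≤ X) : (a : ℝ) ^ α ≤ X ^ α := by
  have hb' : (1 : ℝ) ≤ b := by exact_mod_cast hb
  have ha' : (0 : ℝ) ≤ a := a.cast_nonneg
  have : (a : ℝ) ≤ X := by nlinarith
  gcongr

/-- The trivial bound for the Dirichlet polynomial, in the form used on `-2 ≤ Re s ≤ 3/4`. -/
lemma norm_divisorDirichletPoly_le (hX : 1 ≤ X) (α : ℝ) (hα : 0 ≤ α) (s : ℂ) (hs : s.re ≤ 3 / 4) :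
    ‖divisorDirichletPoly α X s‖ ≤ X ^ α * X ^ (-s.re) * (4 * X * (1 + Real.log X)) := by
  have hX0 : 0 < X := by linarith
  rw [divisorDirichletPoly_eq_sum]
  have hterm : ∀ a ∈ Finset.Icc 1 ⌊X⌋₊, ‖∑ b ∈ Finset.Icc 1 (⌊X⌋₊ / a), divisorTerm α s a b‖
      ≤ X ^ α * X ^ (-s.re) * (4 * X * (1 / a)) := by
    intro a ha
    rw [Finset.mem_Icc] at ha
    have ha0 : (0 : ℝ) < a := by exact_mod_cast ha.1
    have h1 : ∀ b ∈ Finset.Icc 1 (⌊X⌋₊ / a), ‖divisorTerm α s a b‖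
        ≤ X ^ α * X ^ (-s.re) * ((X / a) ^ (3 / 4 : ℝ) * (b : ℝ) ^ (-(3 / 4 : ℝ))) := by
      intro b hb
      rw [Finset.mem_Icc] at hb
      have hb0 : (0 : ℝ) < b := by exact_mod_cast hb.1
      have hab := mul_le_of_le_floor_div hX0.le ha.1 hb.2
      rw [norm_divisorTerm _ _ _ _ ha.1 hb.1, mul_assoc]
      have h2 := rpow_le_rpow_of_mul_le hα ha.1 hb.1 hab
      gcongr
      have h3 : 1 ≤ X / (a * b) := by rw [le_div_iff₀ (by positivity)]; linarith
      have h4 : ((a : ℝ) * b) ^ (-s.re) = X ^ (-s.re) * (X / (a * b)) ^ s.re := by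
        rw [Real.div_rpow hX0.le (by positivity), Real.rpow_neg (by positivity),
          Real.rpow_neg hX0.le]
        have : X ^ s.re ≠ 0 := (Real.rpow_pos_of_pos hX0 _).ne'
        field_simp
      have h5 : (X / a) ^ (3 / 4 : ℝ) * (b : ℝ) ^ (-(3 / 4 : ℝ)) = (X / (a * b)) ^ (3 / 4 : ℝ) := by
        rw [Real.rpow_neg hb0.le, ← div_eq_mul_inv, ← Real.div_rpow (by positivity) hb0.le,
          div_div]
      rw [h4, h5]
      gcongr
    refine (norm_sum_le _ _).trans ((Finset.sum_le_sum h1).trans ?_)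
    rw [← Finset.mul_sum, ← Finset.mul_sum]
    refine mul_le_mul_of_nonneg_left ?_ (by positivity)
    have h6 := sum_rpow_neg_le (⌊X⌋₊ / a) (3 / 4) (by norm_num) (by norm_num)
    have h7 : (((⌊X⌋₊ / a : ℕ) : ℝ)) ^ (1 - 3 / 4 : ℝ) ≤ (X / a) ^ (1 / 4 : ℝ) := by
      rw [show (1 - 3 / 4 : ℝ) = 1 / 4 by norm_num]
      apply Real.rpow_le_rpow (by positivity) _ (by norm_num)
      rw [le_div_iff₀ ha0, mul_comm]
      exact mul_le_of_le_floor_div hX0.le ha.1 le_rfl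
    calc (X / a) ^ (3 / 4 : ℝ) * ∑ b ∈ Finset.Icc 1 (⌊X⌋₊ / a), (b : ℝ) ^ (-(3 / 4 : ℝ))
        ≤ (X / a) ^ (3 / 4 : ℝ) * ((X / a) ^ (1 / 4 : ℝ) / (1 - 3 / 4)) := by
          gcongr
          refine h6.trans ?_
          gcongr
      _ = 4 * X * (1 / a) := by
          rw [mul_div_assoc', ← Real.rpow_add (by positivity)]
          norm_num
          ring
  refine (norm_sum_le _ _).trans ((Finset.sum_le_sum hterm).trans ?_)
  rw [← Finset.mul_sum, ← Finset.mul_sum]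
  gcongr
  exact sum_inv_le_one_add_log _ X hX (Nat.floor_le hX0.le)

lemma rpow_mul_le_rpow_div (hX : 0 < X) {a b q : ℕ} (ha : 1 ≤ a) (hq : 1 ≤ q)
    (haq : (a : ℝ) * q ≤ X) (κ : ℝ) (hκ : 0 ≤ κ) :
    ((a : ℝ) * b) ^ κ ≤ X ^ κ * ((b : ℝ) / q) ^ κ := by
  have hq0 : (0 : ℝ) < q := by exact_mod_cast hq
  rw [← Real.mul_rpow hX.le (by positivity)]
  apply Real.rpow_le_rpow (by positivity) _ hκ
  have : (a : ℝ) * b = (a * q) * (b / q) := by field_simp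
  rw [this]
  gcongr

/-- The trivial bound for the Dirichlet polynomial far to the left, where the terms with `n` within
`O(√X)` of `X` dominate. -/
lemma norm_divisorDirichletPoly_le_left (hX : 1 ≤ X) (α : ℝ) (hα : 0 ≤ α) (s : ℂ) (K : ℝ)
    (hs : s.re = -K) (hK : Real.sqrt X ≤ K + 1) (hK0 : 0 ≤ K) :
    ‖divisorDirichletPoly α X s‖ ≤ X ^ α * X ^ K * (Real.sqrt X * (4 + Real.log X)) := by
  have hX0 : 0 < X := by linarith
  have hsX : Real.sqrt X ^ 2 = X := Real.sq_sqrt hX0.le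
  rw [divisorDirichletPoly_eq_sum]
  have h1 : ‖∑ a ∈ Finset.Icc 1 ⌊X⌋₊, ∑ b ∈ Finset.Icc 1 (⌊X⌋₊ / a), divisorTerm α s a b‖
      ≤ X ^ α * ∑ a ∈ Finset.Icc 1 ⌊X⌋₊, ∑ b ∈ Finset.Icc 1 (⌊X⌋₊ / a), ((a : ℝ) * b) ^ K := by
    rw [Finset.mul_sum]
    refine (norm_sum_le _ _).trans (Finset.sum_le_sum fun a ha => ?_)
    rw [Finset.mul_sum]
    refine (norm_sum_le _ _).trans (Finset.sum_le_sum fun b hb => ?_)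
    rw [Finset.mem_Icc] at ha hb
    rw [norm_divisorTerm _ _ _ _ ha.1 hb.1, hs, neg_neg]
    have h := rpow_le_rpow_of_mul_le hα ha.1 hb.1 (mul_le_of_le_floor_div hX0.le ha.1 hb.2)
    gcongr
  refine h1.trans ?_
  rw [mul_assoc]
  gcongr
  rw [sum_sum_eq_hyperbola (fun a b : ℕ => ((a : ℝ) * b) ^ K)]
  have h2 : ∀ a ∈ Finset.Icc 1 ⌊X⌋₊.sqrt, ((a : ℝ) * a) ^ K
      + ∑ b ∈ Finset.Icc (a + 1) (⌊X⌋₊ / a), (((a : ℝ) * b) ^ K + ((b : ℝ) * a) ^ K)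
      ≤ X ^ K * (2 * (Real.sqrt X * (1 / a) + 1)) := by
    intro a ha
    rw [Finset.mem_Icc] at ha
    have ha0 : (0 : ℝ) < a := by exact_mod_cast ha.1
    have haq : a ≤ ⌊X⌋₊ / a := (Nat.le_div_iff_mul_le ha.1).mpr (Nat.le_sqrt.mp ha.2)
    set q := ⌊X⌋₊ / a with hq
    have hq1 : 1 ≤ q := ha.1.trans haq
    have haqX : (a : ℝ) * q ≤ X := mul_le_of_le_floor_div hX0.le ha.1 le_rfl
    have h3 : ((a : ℝ) * a) ^ K + ∑ b ∈ Finset.Icc (a + 1) q, (((a : ℝ) * b) ^ K + ((b : ℝ) * a) ^ K)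
        ≤ 2 * ∑ b ∈ Finset.Icc 1 q, ((a : ℝ) * b) ^ K := by
      have h4 : ∑ b ∈ Finset.Icc a q, ((a : ℝ) * b) ^ K ≤ ∑ b ∈ Finset.Icc 1 q, ((a : ℝ) * b) ^ K :=
        Finset.sum_le_sum_of_subset_of_nonneg (Finset.Icc_subset_Icc ha.1 le_rfl)
          fun b _ _ => by positivity
      rw [← Finset.insert_Icc_add_one_left_eq_Icc haq, Finset.sum_insert (by simp)] at h4
      have h5 : ∑ b ∈ Finset.Icc (a + 1) q, (((a : ℝ) * b) ^ K + ((b : ℝ) * a) ^ K)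
          = 2 * ∑ b ∈ Finset.Icc (a + 1) q, ((a : ℝ) * b) ^ K := by
        rw [Finset.mul_sum]
        exact Finset.sum_congr rfl fun b _ => by rw [mul_comm (b : ℝ)]; ring
      rw [h5]
      have h6 : 0 ≤ ((a : ℝ) * a) ^ K := by positivity
      linarith
    have h7 : ∑ b ∈ Finset.Icc 1 q, ((a : ℝ) * b) ^ K ≤ X ^ K * (q / (K + 1) + 1) := by
      refine (Finset.sum_le_sum fun b _ =>
        rpow_mul_le_rpow_div (b := b) hX0 ha.1 hq1 haqX K hK0).trans ?_
      rw [← Finset.mul_sum]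
      gcongr
      exact sum_rpow_div_le q hq1 K hK0
    have h8 : (q : ℝ) / (K + 1) ≤ Real.sqrt X * (1 / a) := by
      rw [mul_one_div, div_le_div_iff₀ (by linarith) ha0]
      nlinarith [Real.sqrt_nonneg X]
    calc _ ≤ 2 * (X ^ K * (q / (K + 1) + 1)) := h3.trans (by gcongr)
      _ = X ^ K * (2 * (q / (K + 1) + 1)) := by ring
      _ ≤ _ := by gcongr
  refine (Finset.sum_le_sum h2).trans ?_
  rw [← Finset.mul_sum]
  gcongr
  rw [← Finset.mul_sum, Finset.sum_add_distrib, ← Finset.mul_sum]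
  have h9 := sum_inv_sqrt_floor_le hX
  have h10 : (∑ _a ∈ Finset.Icc 1 ⌊X⌋₊.sqrt, (1 : ℝ)) ≤ Real.sqrt X := by
    simpa using le_sqrt_of_le_sqrt_floor hX0.le (le_refl ⌊X⌋₊.sqrt)
  have h11 := mul_le_mul_of_nonneg_left h9 (Real.sqrt_nonneg X)
  nlinarith

/-- At height `T = 2πX` the phase of `(ab)^(-iT)` splits, and the weight in `b` is increasing. -/
lemma divisorTerm_add_divisorTerm (α κ T : ℝ) (hT : T = 2 * Real.pi * X) (a b : ℕ) (ha : 1 ≤ a)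
    (hb : 1 ≤ b) :
    divisorTerm α (((-κ : ℝ) : ℂ) + T * Complex.I) a b
      + divisorTerm α (((-κ : ℝ) : ℂ) + T * Complex.I) b a
    = unitExp (-X * Real.log a) * (((((a : ℝ) ^ α + (b : ℝ) ^ α) * ((a : ℝ) * b) ^ κ : ℝ) : ℂ)
      * unitExp (-X * Real.log b)) := by
  have ha0 : (0 : ℝ) < a := by exact_mod_cast ha
  have hb0 : (0 : ℝ) < b := by exact_mod_cast hb
  have h : ((a * b : ℕ) : ℂ) ^ (-(((-κ : ℝ) : ℂ) + T * Complex.I))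
      = ((((a : ℝ) * b) ^ κ : ℝ) : ℂ) * (unitExp (-X * Real.log a) * unitExp (-X * Real.log b)) := by
    have e : ((a * b : ℕ) : ℂ) = (((a : ℝ) * b : ℝ) : ℂ) := by push_cast; ring
    have hne : (((a : ℝ) * b : ℝ) : ℂ) ≠ 0 := by
      have : (a : ℝ) * b ≠ 0 := by positivity
      exact_mod_cast this
    rw [e, neg_add, ← Complex.ofReal_neg, neg_neg, Complex.cpow_add _ _ hne,
      Complex.ofReal_cpow (by positivity : (0 : ℝ) ≤ (a : ℝ) * b)]
    congr 1
    rw [Complex.cpow_def_of_ne_zero hne, unitExp, unitExp, ← Complex.exp_add,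
      ← Complex.ofReal_log (by positivity), Real.log_mul ha0.ne' hb0.ne', hT]
    congr 1
    push_cast
    ring
  rw [divisorTerm, divisorTerm, mul_comm b a, h]
  push_cast
  ring

/-- On `Re s ≤ -2`, at the height `2πX`, van der Corput's test gains over the trivial bound. -/
lemma norm_divisorDirichletPoly_le_vanDerCorput (hX : 15.9 ≤ X) (α : ℝ) (hα : 0 ≤ α) (κ T : ℝ)
    (hκ : 2 ≤ κ) (hT : T = 2 * Real.pi * X) :
    ‖divisorDirichletPoly α X (((-κ : ℝ) : ℂ) + T * Complex.I)‖
      ≤ X ^ α * X ^ κ * (Real.sqrt X *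
          (7.66 * Real.log X + 30 + 10.22 * Real.sqrt X * (κ - 1)⁻¹)) := by
  have hX0 : 0 < X := by linarith
  have hsX : Real.sqrt X ^ 2 = X := Real.sq_sqrt hX0.le
  have hs0 : 0 < Real.sqrt X := Real.sqrt_pos.mpr hX0
  have hs3 : 3.98 ≤ Real.sqrt X := Real.le_sqrt_of_sq_le (by linarith)
  have hκ1 : 0 < κ - 1 := by linarith
  rw [divisorDirichletPoly_eq_sum, sum_sum_eq_hyperbola]
  set s : ℂ := ((-κ : ℝ) : ℂ) + T * Complex.I with hs
  have hre : s.re = -κ := by simp [hs]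
  have hP : 0 ≤ X ^ α * X ^ κ := by positivity
  have hterm : ∀ a ∈ Finset.Icc 1 ⌊X⌋₊.sqrt, ‖divisorTerm α s a a
      + ∑ b ∈ Finset.Icc (a + 1) (⌊X⌋₊ / a), (divisorTerm α s a b + divisorTerm α s b a)‖
      ≤ X ^ α * X ^ κ * (1 + 7.66 * Real.sqrt X * (2 * (1 / a) + 4 / 3 * (κ - 1)⁻¹
          + 16 / 9 * (1 / Real.sqrt X))) := by
    intro a ha
    rw [Finset.mem_Icc] at ha
    have ha0 : (0 : ℝ) < a := by exact_mod_cast ha.1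
    have haq : a ≤ ⌊X⌋₊ / a := (Nat.le_div_iff_mul_le ha.1).mpr (Nat.le_sqrt.mp ha.2)
    have haX := sq_le_of_le_sqrt_floor hX0.le ha.2
    have hasX := le_sqrt_of_le_sqrt_floor hX0.le ha.2
    have hlt := lt_mul_floor_div_add_one (X := X) ha.1
    set q := ⌊X⌋₊ / a with hq
    have hq1 : 1 ≤ q := ha.1.trans haq
    have hq0 : (0 : ℝ) < q := by exact_mod_cast hq1
    have haqX : (a : ℝ) * q ≤ X := mul_le_of_le_floor_div hX0.le ha.1 le_rfl
    -- the diagonal term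
    have hdiag : ‖divisorTerm α s a a‖ ≤ X ^ α * X ^ κ := by
      rw [norm_divisorTerm _ _ _ _ ha.1 ha.1, hre, neg_neg]
      have h1 : (a : ℝ) * a ≤ X := by rw [← sq]; exact haX
      have h2 := rpow_le_rpow_of_mul_le hα ha.1 ha.1 h1
      gcongr
    -- `X / a ≥ √X ≥ 3.98`, so that `q = ⌊X / a⌋` is at least `3/4` of `X / a`
    have hq34 : X ≤ 4 / 3 * (a * q) := by
      have h1 : Real.sqrt X < q + 1 := by
        have : Real.sqrt X * Real.sqrt X < Real.sqrt X * (q + 1) := by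
          calc Real.sqrt X * Real.sqrt X = X := by rw [← sq, hsX]
            _ < a * (q + 1) := hlt
            _ ≤ Real.sqrt X * (q + 1) := by gcongr
        exact lt_of_mul_lt_mul_left this hs0.le
      have h2 : (2 : ℝ) < q := by linarith
      have h3 : (3 : ℝ) ≤ q := by
        have : 2 < q := by exact_mod_cast h2
        exact_mod_cast this
      nlinarith
    have hoff : ‖∑ b ∈ Finset.Icc (a + 1) q, (divisorTerm α s a b + divisorTerm α s b a)‖
        ≤ X ^ α * X ^ κ * (7.66 * Real.sqrt X * (2 * (1 / a) + 4 / 3 * (κ - 1)⁻¹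
          + 16 / 9 * (1 / Real.sqrt X))) := by
      rcases Nat.lt_or_ge q (a + 1) with hlt' | hge
      · rw [Finset.Icc_eq_empty (by omega), Finset.sum_empty, norm_zero]
        positivity
      set w : ℕ → ℝ := fun b => ((a : ℝ) ^ α + (b : ℝ) ^ α) * ((a : ℝ) * b) ^ κ with hw
      have e : ∑ b ∈ Finset.Icc (a + 1) q, (divisorTerm α s a b + divisorTerm α s b a)
          = unitExp (-X * Real.log a) * ∑ b ∈ Finset.Icc (a + 1) q,
            ((w b : ℝ) : ℂ) * unitExp (-X * Real.log b) := by
        rw [Finset.mul_sum]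
        refine Finset.sum_congr rfl fun b hb => ?_
        have := (Finset.mem_Icc.mp hb).1
        exact divisorTerm_add_divisorTerm α κ T hT a b ha.1 (by omega)
      rw [e, norm_mul, norm_unitExp, one_mul]
      have key := norm_sum_mul_le_of_monotone (fun b => unitExp (-X * Real.log b)) w
        (fun b => (3.83 * Real.sqrt X / a) * (X / (b : ℝ) ^ 2)) (2 * (3.83 * Real.sqrt X / a))
        (a + 1) q hge (by simp only [hw]; positivity)
        (by
          intro b _ _
          simp only [hw]
          have : (b : ℝ) ≤ ((b + 1 : ℕ) : ℝ) := by push_cast; linarith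
          gcongr)
        (fun r hr hrq => norm_sum_unitExp_log_le X a r q ha.1 (by omega) hrq haX haqX)
      refine key.trans ?_
      have hwle : ∀ b ∈ Finset.Icc 1 q, w b ≤ 2 * (X ^ α * X ^ κ) * ((b : ℝ) / q) ^ κ := by
        intro b hb
        rw [Finset.mem_Icc] at hb
        have hab := mul_le_of_le_floor_div hX0.le ha.1 hb.2
        have h1 := rpow_le_rpow_of_mul_le hα ha.1 hb.1 hab
        have h2 : (b : ℝ) ^ α ≤ X ^ α :=
          rpow_le_rpow_of_mul_le hα hb.1 ha.1 (by rwa [mul_comm])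
        have h3 := rpow_mul_le_rpow_div (b := b) hX0 ha.1 hq1 haqX κ (by linarith)
        calc w b ≤ (X ^ α + X ^ α) * (X ^ κ * ((b : ℝ) / q) ^ κ) := by
              simp only [hw]; gcongr
          _ = _ := by ring
      have hwq : w q ≤ 2 * (X ^ α * X ^ κ) := by
        have := hwle q (Finset.mem_Icc.mpr ⟨hq1, le_rfl⟩)
        rwa [div_self hq0.ne', Real.one_rpow, mul_one] at this
      have hsum : ∑ b ∈ Finset.Icc (a + 1) q, w b * ((3.83 * Real.sqrt X / a) * (X / (b : ℝ) ^ 2))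
          ≤ (3.83 * Real.sqrt X / a) * (2 * (X ^ α * X ^ κ)) * (X / (q : ℝ) ^ 2) *
            (q / (κ - 1) + 1) := by
        have h1 : ∀ b ∈ Finset.Icc 1 q, w b * ((3.83 * Real.sqrt X / a) * (X / (b : ℝ) ^ 2))
            ≤ (3.83 * Real.sqrt X / a) * (2 * (X ^ α * X ^ κ)) * (X / (q : ℝ) ^ 2) *
              ((b : ℝ) / q) ^ (κ - 2) := by
          intro b hb
          have hb0 : (0 : ℝ) < b := by exact_mod_cast (Finset.mem_Icc.mp hb).1
          have h2 : ((b : ℝ) / q) ^ κ = ((b : ℝ) / q) ^ (κ - 2) * ((b : ℝ) / q) ^ 2 := by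
            rw [← Real.rpow_natCast ((b : ℝ) / q) 2, ← Real.rpow_add (by positivity)]
            congr 1
            push_cast
            ring
          calc w b * ((3.83 * Real.sqrt X / a) * (X / (b : ℝ) ^ 2))
              ≤ 2 * (X ^ α * X ^ κ) * ((b : ℝ) / q) ^ κ
                * ((3.83 * Real.sqrt X / a) * (X / (b : ℝ) ^ 2)) := by
                gcongr
                exact hwle b hb
            _ = _ := by
                rw [h2]
                field_simp
        refine (Finset.sum_le_sum_of_subset_of_nonneg
          (Finset.Icc_subset_Icc (by omega : 1 ≤ a + 1) le_rfl) fun b _ _ => ?_).trans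
          ((Finset.sum_le_sum h1).trans ?_)
        · simp only [hw]; positivity
        · rw [← Finset.mul_sum]
          gcongr
          have := sum_rpow_div_le q hq1 (κ - 2) (by linarith)
          rwa [show κ - 2 + 1 = κ - 1 by ring] at this
      have h4 : X / (q : ℝ) ^ 2 * (q / (κ - 1) + 1)
          ≤ a * (4 / 3 * (κ - 1)⁻¹ + 16 / 9 * (1 / Real.sqrt X)) := by
        have h5 : X / q ≤ 4 / 3 * a := by rw [div_le_iff₀ hq0]; linarith
        have h6 : 1 / (q : ℝ) ≤ 4 / 3 * (1 / Real.sqrt X) := by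
          rw [mul_one_div, div_le_div_iff₀ hq0 hs0]
          have : Real.sqrt X * Real.sqrt X ≤ Real.sqrt X * (4 / 3 * q) := by
            calc Real.sqrt X * Real.sqrt X = X := by rw [← sq, hsX]
              _ ≤ 4 / 3 * (a * q) := hq34
              _ ≤ 4 / 3 * (Real.sqrt X * q) := by gcongr
              _ = _ := by ring
          have := le_of_mul_le_mul_left this hs0
          linarith
        have h7 : X / (q : ℝ) ^ 2 * (q / (κ - 1) + 1) = X / q * ((κ - 1)⁻¹ + 1 / q) := by
          field_simp
        rw [h7]
        have h8 : 0 ≤ 1 / (q : ℝ) := by positivity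
        have h9 : 0 ≤ (κ - 1)⁻¹ := by positivity
        calc X / q * ((κ - 1)⁻¹ + 1 / q) ≤ 4 / 3 * a * ((κ - 1)⁻¹ + 4 / 3 * (1 / Real.sqrt X)) := by
              gcongr
          _ = _ := by ring
      calc 2 * (3.83 * Real.sqrt X / a) * w q + _
          ≤ 2 * (3.83 * Real.sqrt X / a) * (2 * (X ^ α * X ^ κ))
            + (3.83 * Real.sqrt X / a) * (2 * (X ^ α * X ^ κ)) * (X / (q : ℝ) ^ 2) *
            (q / (κ - 1) + 1) := by gcongr
        _ = 2 * (3.83 * Real.sqrt X / a) * (2 * (X ^ α * X ^ κ))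
            + (3.83 * Real.sqrt X / a) * (2 * (X ^ α * X ^ κ)) * (X / (q : ℝ) ^ 2 *
            (q / (κ - 1) + 1)) := by ring
        _ ≤ 2 * (3.83 * Real.sqrt X / a) * (2 * (X ^ α * X ^ κ))
            + (3.83 * Real.sqrt X / a) * (2 * (X ^ α * X ^ κ)) *
              (a * (4 / 3 * (κ - 1)⁻¹ + 16 / 9 * (1 / Real.sqrt X))) := by gcongr
        _ = _ := by
          field_simp
          ring
    refine (norm_add_le _ _).trans ?_
    linarith
  refine (norm_sum_le _ _).trans ((Finset.sum_le_sum hterm).trans ?_)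
  rw [← Finset.mul_sum]
  gcongr
  rw [Finset.sum_add_distrib, ← Finset.mul_sum, Finset.sum_add_distrib, Finset.sum_add_distrib,
    ← Finset.mul_sum]
  have h9 := sum_inv_sqrt_floor_le (by linarith : 1 ≤ X)
  have h10 : ∀ c : ℝ, 0 ≤ c → (∑ _a ∈ Finset.Icc 1 ⌊X⌋₊.sqrt, c) ≤ Real.sqrt X * c := by
    intro c hc
    simp only [Finset.sum_const, Nat.card_Icc, add_tsub_cancel_right, nsmul_eq_mul]
    gcongr
    exact le_sqrt_of_le_sqrt_floor hX0.le le_rfl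
  have h11 := h10 1 zero_le_one
  have h12 := h10 (4 / 3 * (κ - 1)⁻¹) (by positivity)
  have h13 := h10 (16 / 9 * (1 / Real.sqrt X)) (by positivity)
  have h14 : Real.sqrt X * (16 / 9 * (1 / Real.sqrt X)) = 16 / 9 := by field_simp
  rw [h14] at h13
  have hκi : 0 ≤ Real.sqrt X * (κ - 1)⁻¹ := by positivity
  calc _ ≤ Real.sqrt X * 1 + 7.66 * Real.sqrt X * (2 * (1 + Real.log X / 2)
        + Real.sqrt X * (4 / 3 * (κ - 1)⁻¹) + 16 / 9) := by gcongr
    _ = Real.sqrt X * (7.66 * Real.log X + (1 + 7.66 * (34 / 9))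
        + 7.66 * (4 / 3) * (Real.sqrt X * (κ - 1)⁻¹)) := by ring
    _ ≤ _ := by
      gcongr Real.sqrt X * ?_
      nlinarith

end bounds

/-! ### The contour integral and the divisor sum -/

lemma differentiable_divisorDirichletPoly (α X : ℝ) :
    Differentiable ℂ (divisorDirichletPoly α X) := by
  unfold divisorDirichletPoly
  refine Differentiable.fun_sum fun n hn => ?_
  have hn0 : (n : ℂ) ≠ 0 := by
    have := (Finset.mem_Icc.mp hn).1
    exact_mod_cast (by omega : n ≠ 0)
  refine Differentiable.const_mul (fun s => ?_) _
  exact differentiableAt_id.neg.const_cpow (Or.inl hn0)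

lemma norm_divisorDirichletPoly_conj (α X : ℝ) (s : ℂ) :
    ‖divisorDirichletPoly α X ((starRingEnd ℂ) s)‖ = ‖divisorDirichletPoly α X s‖ := by
  have h : divisorDirichletPoly α X ((starRingEnd ℂ) s)
      = (starRingEnd ℂ) (divisorDirichletPoly α X s) := by
    unfold divisorDirichletPoly
    rw [map_sum]
    refine Finset.sum_congr rfl fun n hn => ?_
    have hn0 : 0 < n := (Finset.mem_Icc.mp hn).1
    rw [map_mul, Complex.conj_ofReal, ← map_neg, Complex.cpow_conj _ _ (by
      rw [Complex.natCast_arg]; exact Real.pi_pos.ne), Complex.conj_natCast]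
  rw [h, RCLike.norm_conj]

/-- Since `cos (2πn) = 1`, the residues of `χ(1 - s) D(s)` add up to `2 ∑ d_α(n)`. -/
lemma hasSum_xiResidue_divisorDirichletPoly (α X : ℝ) :
    HasSum (xiResidue (divisorDirichletPoly α X))
      (2 * ∑ n ∈ Finset.Icc 1 ⌊X⌋₊, (divisorPowerSum α n : ℂ)) := by
  have h : ∀ n ∈ Finset.Icc 1 ⌊X⌋₊, HasSum (fun j : ℕ => 2 * (divisorPowerSum α n : ℂ) *
      ((-1) ^ j * (2 * Real.pi * n : ℂ) ^ (2 * j) / (2 * j).factorial))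
      (2 * (divisorPowerSum α n : ℂ) * 1) := by
    intro n _
    have h1 := Complex.hasSum_cos (2 * Real.pi * n)
    have h2 : Complex.cos (2 * Real.pi * n) = 1 := by
      rw [mul_comm]; exact Complex.cos_nat_mul_two_pi n
    rw [h2] at h1
    exact h1.mul_left _
  have h3 := hasSum_sum h
  rw [Finset.mul_sum]
  simp only [mul_one] at h3
  have h4 : xiResidue (divisorDirichletPoly α X) = fun j : ℕ => ∑ n ∈ Finset.Icc 1 ⌊X⌋₊,
      2 * (divisorPowerSum α n : ℂ) *
        ((-1) ^ j * (2 * Real.pi * n : ℂ) ^ (2 * j) / (2 * j).factorial) := by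
    funext j
    unfold xiResidue divisorDirichletPoly
    rw [Finset.mul_sum]
    refine Finset.sum_congr rfl fun n _ => ?_
    have h5 : (n : ℂ) ^ (-((-(2 * j : ℝ) : ℝ) : ℂ)) = (n : ℂ) ^ (2 * j) := by
      rw [← Complex.cpow_natCast]; push_cast; rw [neg_neg]
    rw [h5, mul_pow _ (n : ℂ)]
    ring
  rw [h4]
  exact h3

/-- On the contour, `χ(1 - s)` may be replaced by `xiFactor s`. -/
lemma contourIntegral_chiFactor_mul (τ lam T : ℝ) (hτ : 1 / 4 ≤ τ) (hτ' : τ ≤ 1 / 2) (hT0 : 0 < T)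
    (hlam : 0 < lam) (hlam' : lam < 1 / 2) (D : ℂ → ℂ) :
    contourIntegral τ lam T (fun s => chiFactor (1 - s) * D s)
      = (∫ x : ℝ in (1 - τ)..(2 - 2 * τ + lam),
          (fun s => xiFactor s * D s) ((x : ℂ) - (T : ℂ) * Complex.I))
      + Complex.I * (∫ t : ℝ in (-T)..T,
          (fun s => xiFactor s * D s) (((2 - 2 * τ + lam : ℝ) : ℂ) + (t : ℂ) * Complex.I))
      + (∫ x : ℝ in (2 - 2 * τ + lam)..(1 - τ),
          (fun s => xiFactor s * D s) ((x : ℂ) + (T : ℂ) * Complex.I)) := by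
  have hpi := Real.pi_pos
  have hsinT : ∀ x : ℝ, ∀ t : ℝ, t ≠ 0 → Complex.sin (Real.pi * ((x : ℂ) + t * Complex.I)) ≠ 0 := by
    intro x t ht
    have := sin_pi_mul_div_two_ne_zero_of_im (2 * ((x : ℂ) + t * Complex.I)) (by simpa using ht)
    rwa [show (Real.pi : ℂ) * (2 * ((x : ℂ) + t * Complex.I)) / 2
      = Real.pi * ((x : ℂ) + t * Complex.I) by ring] at this
  have hc1 : 1 < 2 - 2 * τ + lam := by linarith
  have hc2 : 2 - 2 * τ + lam < 2 := by linarith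
  have hsinc : ∀ t : ℝ, Complex.sin (Real.pi * (((2 - 2 * τ + lam : ℝ) : ℂ) + t * Complex.I)) ≠ 0 := by
    intro t
    rcases eq_or_ne t 0 with rfl | ht
    · rw [Complex.ofReal_zero, zero_mul, add_zero, ← Complex.ofReal_mul, ← Complex.ofReal_sin,
        Ne, Complex.ofReal_eq_zero]
      have h1 : Real.sin (Real.pi * (2 - 2 * τ + lam)) = -Real.sin (Real.pi * (1 - 2 * τ + lam)) := by
        rw [show Real.pi * (2 - 2 * τ + lam) = Real.pi * (1 - 2 * τ + lam) + Real.pi by ring,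
          Real.sin_add_pi]
      have h2 : 0 < Real.sin (Real.pi * (1 - 2 * τ + lam)) :=
        Real.sin_pos_of_pos_of_lt_pi (by nlinarith) (by nlinarith)
      linarith
    · exact hsinT _ t ht
  have e1 : ∀ x : ℝ, chiFactor (1 - ((x : ℂ) + T * Complex.I))
      = xiFactor ((x : ℂ) + T * Complex.I) := fun x =>
    chiFactor_one_sub_eq_xiFactor _ (hsinT x T hT0.ne')
  have e2 : ∀ x : ℝ, chiFactor (1 - ((x : ℂ) - T * Complex.I))
      = xiFactor ((x : ℂ) - T * Complex.I) := fun x =>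
    chiFactor_one_sub_eq_xiFactor _ (by
      have := hsinT x (-T) (by linarith)
      rwa [Complex.ofReal_neg, neg_mul, ← sub_eq_add_neg] at this)
  have e3 : ∀ t : ℝ, chiFactor (1 - (((2 - 2 * τ + lam : ℝ) : ℂ) + t * Complex.I))
      = xiFactor (((2 - 2 * τ + lam : ℝ) : ℂ) + t * Complex.I) := fun t =>
    chiFactor_one_sub_eq_xiFactor _ (hsinc t)
  simp only [contourIntegral, e1, e2, e3]

/-- The contour integral equals `2π ∑_{n ≤ X} d_α(n)` up to `O(X^(α + 1/2) log X)`. -/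
lemma norm_integralI_sub_sum_le (τ lam T : ℝ) (hτ : 1 / 4 ≤ τ) (hτ' : τ ≤ 1 / 2) (hT : 100 ≤ T)
    (hlam : 0 < lam) (hlam' : lam < 1 / 2) (X : ℝ) (hX : X = T / (2 * Real.pi)) :
    ‖integralI τ lam T X
        - ((2 * Real.pi * ∑ n ∈ Finset.Icc 1 ⌊X⌋₊, divisorPowerSum (1 - 2 * τ) n : ℝ) : ℂ)‖
      ≤ X ^ (1 - 2 * τ) * Real.sqrt X * (31.3 * Real.log X + 73.2) := by
  have hpi := Real.pi_pos
  have hpi4 := Real.pi_lt_d4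
  have hT0 : 0 < T := by linarith
  have hTX : T = 2 * Real.pi * X := by rw [hX]; field_simp
  have hX15 : 15.9 ≤ X := by
    rw [hX, le_div_iff₀ (by positivity)]; linarith
  have hX0 : 0 < X := by linarith
  have hX1 : 1 ≤ X := by linarith
  set α := 1 - 2 * τ with hα
  have hα0 : 0 ≤ α := by linarith
  set L := Real.log X with hL
  have hL0 : 0 ≤ L := Real.log_nonneg hX1
  set S := Real.sqrt X with hS
  have hsX : S ^ 2 = X := Real.sq_sqrt hX0.le
  have hS3 : 3.98 ≤ S := Real.le_sqrt_of_sq_le (by linarith)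
  have hS0 : 0 < S := by linarith
  have hXα : 0 < X ^ α := Real.rpow_pos_of_pos hX0 _
  set D := divisorDirichletPoly α X with hD
  set G : ℂ → ℂ := fun s => xiFactor s * D s with hG
  -- the abscissa `-K` of the vertical line, with `K` the least odd integer that is at least `√X`
  set k := ⌈(S - 1) / 2⌉₊ with hk
  set K : ℝ := 2 * k + 1 with hK
  have hK1 : S ≤ K := by
    have := Nat.le_ceil ((S - 1) / 2)
    rw [hK]; linarith
  have hK2 : K < S + 2 := by
    have := Nat.ceil_lt_add_one (show 0 ≤ (S - 1) / 2 by linarith)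
    rw [hK]; linarith
  set B := X ^ α * X ^ K * (S * (4 + L)) with hB
  have hBbound : ∀ t : ℝ, ‖D (((-K : ℝ) : ℂ) + (t : ℂ) * Complex.I)‖ ≤ B := fun t =>
    norm_divisorDirichletPoly_le_left hX1 α hα0 _ K (by simp) (by linarith) (by linarith)
  have hmain := norm_contour_sub_tsum_le D (differentiable_divisorDirichletPoly α X)
    (norm_divisorDirichletPoly_conj α X) (X ^ α * (4 * X * (1 + L))) X (by positivity) hX1
    (fun s hs => (norm_divisorDirichletPoly_le hX1 α hα0 s (by linarith)).trans
      (le_of_eq (by ring)))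
    (1 - τ) (2 - 2 * τ + lam) T hT (by linarith) (by linarith) k (by linarith)
    _ (hasSum_xiResidue_divisorDirichletPoly α X) B hBbound G hG
  rw [← hK, ← hX] at hmain
  -- pointwise bounds at height `T`
  have hGle : ∀ x : ℝ, x ≤ 3 / 4 → ∀ E : ℝ, ‖D ((x : ℂ) + T * Complex.I)‖ ≤ X ^ α * X ^ (-x) * E →
      ‖G ((x : ℂ) + T * Complex.I)‖ ≤ 1.01 * X ^ α * (E / S) := by
    intro x hx E hE
    rw [hG]
    simp only [norm_mul]
    have h1 := norm_xiFactor_le x T hx hT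
    rw [← hX] at h1
    have h2 : X ^ (x - 1 / 2) = X ^ x / S := by
      rw [Real.rpow_sub hX0, hS, Real.sqrt_eq_rpow]
    have h3 : X ^ x * X ^ (-x) = 1 := by rw [← Real.rpow_add hX0]; simp
    calc _ ≤ 1.01 * X ^ (x - 1 / 2) * (X ^ α * X ^ (-x) * E) := by gcongr
      _ = 1.01 * X ^ α * (E / S) * (X ^ x * X ^ (-x)) := by rw [h2]; ring
      _ = _ := by rw [h3, mul_one]
  have hGcont : Continuous (fun x : ℝ => ‖G ((x : ℂ) + T * Complex.I)‖) :=
    ((continuous_xiFactor_horizontal T hT0.ne').mul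
      ((differentiable_divisorDirichletPoly α X).continuous.comp (by fun_prop))).norm
  have hH1 : ∫ x : ℝ in (-2 : ℝ)..(1 - τ), ‖G ((x : ℂ) + T * Complex.I)‖
      ≤ X ^ α * S * (11.11 * (1 + L)) := by
    have h1 : ∀ x ∈ Set.Icc (-2 : ℝ) (1 - τ), ‖G ((x : ℂ) + T * Complex.I)‖
        ≤ 1.01 * X ^ α * (4 * S * (1 + L)) := by
      intro x hx
      refine (hGle x (by linarith [hx.2]) (4 * X * (1 + L)) ?_).trans (le_of_eq ?_)
      · have := norm_divisorDirichletPoly_le hX1 α hα0 ((x : ℂ) + T * Complex.I)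
          (by simp; linarith [hx.2])
        simpa using this
      · rw [← hsX]; field_simp
    have h2 := intervalIntegral.integral_mono_on (μ := MeasureTheory.volume) (by linarith : (-2 : ℝ) ≤ 1 - τ)
      (hGcont.intervalIntegrable _ _) (continuous_const.intervalIntegrable _ _) h1
    rw [intervalIntegral.integral_const, smul_eq_mul] at h2
    refine h2.trans ?_
    have h3 : 0 ≤ X ^ α * (S * (1 + L)) := by positivity
    calc (1 - τ - -2) * (1.01 * X ^ α * (4 * S * (1 + L)))
        ≤ 2.75 * (1.01 * X ^ α * (4 * S * (1 + L))) := by gcongr; linarith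
      _ = X ^ α * S * (11.11 * (1 + L)) := by ring
  have hH2 : ∫ x : ℝ in (-K)..(-2), ‖G ((x : ℂ) + T * Complex.I)‖
      ≤ X ^ α * S * (12.9 * L + 33) := by
    have hne : ∀ x ∈ Set.uIcc (-K) (-2), -1 - x ≠ 0 := by
      intro x hx
      rw [Set.uIcc_of_le (by linarith)] at hx
      linarith [hx.2]
    have hcont : ContinuousOn (fun x : ℝ => (-1 - x)⁻¹) (Set.uIcc (-K) (-2)) :=
      ContinuousOn.inv₀ (by fun_prop) hne
    have h1 : ∀ x ∈ Set.Icc (-K) (-2 : ℝ), ‖G ((x : ℂ) + T * Complex.I)‖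
        ≤ 1.01 * X ^ α * (7.66 * L + 30) + 1.01 * X ^ α * (10.22 * S) * (-1 - x)⁻¹ := by
      intro x hx
      refine (hGle x (by linarith [hx.2]) (S * (7.66 * L + 30 + 10.22 * S * (-x - 1)⁻¹)) ?_).trans
        (le_of_eq ?_)
      · have := norm_divisorDirichletPoly_le_vanDerCorput hX15 α hα0 (-x) T (by linarith [hx.2]) hTX
        rwa [neg_neg] at this
      · rw [mul_div_cancel_left₀ _ hS0.ne', show -1 - x = -x - 1 by ring]; ring
    have h2 := intervalIntegral.integral_mono_on (μ := MeasureTheory.volume) (by linarith : -K ≤ -2)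
      (hGcont.intervalIntegrable _ _)
      ((continuous_const.intervalIntegrable _ _).add
        ((hcont.intervalIntegrable).const_mul (1.01 * X ^ α * (10.22 * S)))) h1
    have h3 : ∫ x : ℝ in (-K)..(-2), (-1 - x)⁻¹ = Real.log (K - 1) := by
      rw [intervalIntegral.integral_comp_sub_left (fun x => x⁻¹),
        show (-1 : ℝ) - -2 = 1 by norm_num, show -1 - -K = K - 1 by ring,
        integral_inv_of_pos one_pos (by linarith), div_one]
    rw [intervalIntegral.integral_add (continuous_const.intervalIntegrable _ _)
      ((hcont.intervalIntegrable).const_mul _), intervalIntegral.integral_const,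
      intervalIntegral.integral_const_mul, h3, smul_eq_mul] at h2
    refine h2.trans ?_
    have h4 : Real.log (K - 1) ≤ L / 2 + 0.26 := by
      have h5 : Real.log (K - 1) ≤ Real.log (S * (1 + 1 / S)) := by
        apply Real.log_le_log (by linarith)
        have : S * (1 + 1 / S) = S + 1 := by field_simp
        linarith
      have h6 : Real.log S = L / 2 := Real.log_sqrt hX0.le
      have h7 : 1 / S ≤ 0.26 := by
        rw [div_le_iff₀ hS0]; linarith
      rw [Real.log_mul hS0.ne' (by positivity), h6] at h5
      have h8 := Real.log_le_sub_one_of_pos (x := 1 + 1 / S) (by positivity)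
      linarith
    calc (-2 - -K) * (1.01 * X ^ α * (7.66 * L + 30))
          + 1.01 * X ^ α * (10.22 * S) * Real.log (K - 1)
        ≤ S * (1.01 * X ^ α * (7.66 * L + 30))
          + 1.01 * X ^ α * (10.22 * S) * (L / 2 + 0.26) := by
          gcongr
          linarith
      _ = X ^ α * S * (1.01 * (7.66 * L + 30 + 10.22 * (L / 2 + 0.26))) := by ring
      _ ≤ _ := by
        gcongr X ^ α * S * ?_
        linarith
  have hH : ∫ x : ℝ in (-K)..(1 - τ), ‖G ((x : ℂ) + T * Complex.I)‖
      ≤ X ^ α * S * (24.01 * L + 44.11) := by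
    rw [← intervalIntegral.integral_add_adjacent_intervals (hGcont.intervalIntegrable (-K) (-2))
      (hGcont.intervalIntegrable (-2) (1 - τ))]
    refine (add_le_add hH2 hH1).trans (le_of_eq ?_)
    ring
  -- the vertical line `Re s = -K`
  have hV : 1.01 * B * (2 * Real.pi * (X ^ (1 / 2 - K) / (2 * k + 1 / 2)))
      ≤ X ^ α * S * (7.26 * (4 + L)) := by
    have h1 : X ^ K * X ^ (1 / 2 - K) = S := by
      rw [← Real.rpow_add hX0, hS, Real.sqrt_eq_rpow]; congr 1; ring
    have h2 : (2 * k + 1 / 2 : ℝ) = K - 1 / 2 := by rw [hK]; ring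
    have h3 : S / (K - 1 / 2) ≤ 1.144 := by
      rw [div_le_iff₀ (by linarith)]; linarith
    have h4 : 0 ≤ S / (K - 1 / 2) := div_nonneg hS0.le (by linarith)
    rw [h2]
    calc 1.01 * B * (2 * Real.pi * (X ^ (1 / 2 - K) / (K - 1 / 2)))
        = X ^ α * S * (4 + L) * (1.01 * (2 * Real.pi) * ((X ^ K * X ^ (1 / 2 - K)) / (K - 1 / 2))) := by
          rw [hB]; ring
      _ = X ^ α * S * (4 + L) * (1.01 * (2 * Real.pi) * (S / (K - 1 / 2))) := by rw [h1]
      _ ≤ X ^ α * S * (4 + L) * (1.01 * (2 * 3.1416) * 1.144) := by gcongr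
      _ ≤ X ^ α * S * (4 + L) * 7.26 := by gcongr; norm_num
      _ = _ := by ring
  rw [← contourIntegral_chiFactor_mul τ lam T hτ hτ' hT0 hlam hlam' D] at hmain
  have hI : integralI τ lam T X
      - ((2 * Real.pi * ∑ n ∈ Finset.Icc 1 ⌊X⌋₊, divisorPowerSum α n : ℝ) : ℂ)
      = 1 / (2 * Complex.I) * (contourIntegral τ lam T (fun s => chiFactor (1 - s) * D s)
        - 2 * Real.pi * Complex.I * (2 * ∑ n ∈ Finset.Icc 1 ⌊X⌋₊, (divisorPowerSum α n : ℂ))) := by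
    rw [integralI, mul_sub]
    congr 1
    have := Complex.I_ne_zero
    push_cast
    field_simp
  rw [hI, norm_mul]
  have hhalf : ‖1 / (2 * Complex.I)‖ = 1 / 2 := by simp
  rw [hhalf]
  calc _ ≤ 1 / 2 * (2 * (X ^ α * S * (24.01 * L + 44.11)) + 2 * (X ^ α * S * (7.26 * (4 + L)))) := by
        gcongr
        exact hmain.trans (by gcongr)
    _ = X ^ α * S * (31.27 * L + 73.15) := by ring
    _ ≤ _ := by gcongr <;> norm_num

/-! ### Differences of powers -/

/-- The mean value theorem for `z ^ p / p`, a primitive of `z ^ (p - 1)`. -/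
lemma exists_rpow_div_sub_eq {p x y : ℝ} (hp : p ≠ 0) (hx' : 0 < x ∨ 1 ≤ p)
    (hxy : x < y) : ∃ c ∈ Set.Ioo x y, y ^ p / p - x ^ p / p = c ^ (p - 1) * (y - x) := by
  have hd : ∀ z ∈ Set.Icc x y, HasDerivAt (fun z : ℝ => z ^ p / p) (z ^ (p - 1)) z := by
    intro z hz
    have h := (Real.hasDerivAt_rpow_const (x := z) (p := p)
      (hx'.imp (fun h => (h.trans_le hz.1).ne') id)).div_const p
    rwa [mul_div_cancel_left₀ _ hp] at h
  obtain ⟨c, hc, h⟩ := exists_hasDerivAt_eq_slope (fun z : ℝ => z ^ p / p) (fun z => z ^ (p - 1))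
    hxy (fun z hz => (hd z hz).continuousAt.continuousWithinAt)
    (fun z hz => hd z (Set.Ioo_subset_Icc_self hz))
  exact ⟨c, hc, by rw [h, div_mul_cancel₀ _ (sub_pos.mpr hxy).ne']⟩

/-! ### The zeta function on the positive real axis -/

lemma sum_range_succ_eq_sum_Icc {M : Type*} [AddCommMonoid M] (f : ℕ → M) (N : ℕ) :
    ∑ n ∈ Finset.range N, f (n + 1) = ∑ n ∈ Finset.Icc 1 N, f n := by
  induction N with
  | zero => simp
  | succ N ih => rw [Finset.sum_range_succ, ih, Finset.sum_Icc_succ_top (by omega)]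

/-- `(1 - s)` times the difference between `(n+2)^(-s)` and the integral of `x^(-s)` over
`[n+1, n+2]`. The series of these terms represents `s - (s - 1) ζ(s)` for `Re s > 0`. -/
noncomputable def zetaTerm (n : ℕ) (s : ℂ) : ℂ :=
  (1 - s) * ((n : ℂ) + 2) ^ (-s) - ((n : ℂ) + 2) ^ (1 - s) + ((n : ℂ) + 1) ^ (1 - s)

/-- The mean value inequality, applied once to `x^(-s)` and once to
`(1 - s) (n+2)^(-s) x - x^(1-s)`, gains a power of `n`. -/
lemma norm_zetaTerm_le (n : ℕ) (s : ℂ) (hs : 0 < s.re) :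
    ‖zetaTerm n s‖ ≤ ‖1 - s‖ * ‖s‖ * ((n : ℝ) + 1) ^ (-s.re - 1) := by
  have hn0 : (0 : ℝ) < (n : ℝ) + 1 := by positivity
  set C : ℝ := ((n : ℝ) + 1) ^ (-s.re - 1) with hC
  have hpos : ∀ x ∈ Set.Icc ((n : ℝ) + 1) (n + 2), 0 < x := fun x hx => hn0.trans_le hx.1
  have hd : ∀ r : ℂ, ∀ x : ℝ, 0 < x →
      HasDerivAt (fun x : ℝ => (x : ℂ) ^ r) (r * (x : ℂ) ^ (r - 1)) x := by
    intro r x hx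
    have h := (hasDerivAt_id (x : ℂ)).cpow_const (c := r) (Or.inl (by simpa using hx))
    simpa using h.comp_ofReal
  have hdiff : ∀ x ∈ Set.Icc ((n : ℝ) + 1) (n + 2),
      ‖(((n : ℝ) + 2 : ℝ) : ℂ) ^ (-s) - (x : ℂ) ^ (-s)‖ ≤ ‖s‖ * C := by
    intro x hx
    have h := (convex_Icc ((n : ℝ) + 1) (n + 2)).norm_image_sub_le_of_norm_hasDerivWithin_le
      (f := fun x : ℝ => (x : ℂ) ^ (-s)) (f' := fun x : ℝ => -s * (x : ℂ) ^ (-s - 1)) (C := ‖s‖ * C)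
      (fun y hy => (hd (-s) y (hpos y hy)).hasDerivWithinAt)
      (fun y hy => by
        rw [norm_mul, norm_neg, Complex.norm_cpow_eq_rpow_re_of_pos (hpos y hy)]
        gcongr
        simp only [Complex.sub_re, Complex.neg_re, Complex.one_re]
        exact Real.rpow_le_rpow_of_nonpos hn0 hy.1 (by linarith))
      hx ⟨by linarith, le_refl _⟩
    refine h.trans ?_
    have h1 : ‖(n : ℝ) + 2 - x‖ ≤ 1 := by
      rw [Real.norm_eq_abs, abs_le]; constructor <;> linarith [hx.1, hx.2]
    have h2 : 0 ≤ ‖s‖ * C := by positivity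
    nlinarith
  have h := (convex_Icc ((n : ℝ) + 1) (n + 2)).norm_image_sub_le_of_norm_hasDerivWithin_le
      (f := fun x : ℝ => (1 - s) * (((n : ℝ) + 2 : ℝ) : ℂ) ^ (-s) * (x : ℂ) - (x : ℂ) ^ (1 - s))
      (f' := fun x : ℝ => (1 - s) * ((((n : ℝ) + 2 : ℝ) : ℂ) ^ (-s) - (x : ℂ) ^ (-s)))
      (C := ‖1 - s‖ * (‖s‖ * C))
      (fun y hy => by
        have h1 := hd (1 - s) y (hpos y hy)
        rw [show 1 - s - 1 = -s by ring] at h1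
        have h2 := ((hasDerivAt_id (y : ℂ)).comp_ofReal).const_mul
          ((1 - s) * (((n : ℝ) + 2 : ℝ) : ℂ) ^ (-s))
        refine ((h2.sub h1).congr_deriv ?_).hasDerivWithinAt
        ring)
      (fun y hy => by
        rw [norm_mul]
        gcongr
        exact hdiff y hy)
      (show (n : ℝ) + 1 ∈ _ from ⟨le_refl _, by linarith⟩)
      (show (n : ℝ) + 2 ∈ _ from ⟨by linarith, le_refl _⟩)
  have h3 : ‖(n : ℝ) + 2 - (n + 1)‖ = 1 := by
    rw [show (n : ℝ) + 2 - (n + 1) = 1 by ring, norm_one]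
  rw [h3, mul_one, ← mul_assoc] at h
  refine le_of_eq_of_le ?_ h
  congr 1
  rw [zetaTerm]
  push_cast
  ring

lemma differentiable_zetaTerm (n : ℕ) : Differentiable ℂ (zetaTerm n) := by
  have h1 : (n : ℂ) + 1 ≠ 0 := by exact_mod_cast Nat.succ_ne_zero n
  have h2 : (n : ℂ) + 2 ≠ 0 := by exact_mod_cast Nat.succ_ne_zero (n + 1)
  intro s
  unfold zetaTerm
  have d1 := (differentiableAt_id (𝕜 := ℂ) (x := s)).neg.const_cpow (c := (n : ℂ) + 2) (Or.inl h2)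
  have d2 := ((differentiableAt_const (𝕜 := ℂ) (x := s) (1 : ℂ)).sub
    differentiableAt_id).const_cpow (c := (n : ℂ) + 2) (Or.inl h2)
  have d3 := ((differentiableAt_const (𝕜 := ℂ) (x := s) (1 : ℂ)).sub
    differentiableAt_id).const_cpow (c := (n : ℂ) + 1) (Or.inl h1)
  exact ((((differentiableAt_const _).sub differentiableAt_id).mul d1).sub d2).add d3

lemma sum_range_zetaTerm (N : ℕ) (s : ℂ) :
    ∑ n ∈ Finset.range N, zetaTerm n s
      = (1 - s) * (∑ n ∈ Finset.Icc 1 (N + 1), (n : ℂ) ^ (-s)) - ((N : ℂ) + 1) ^ (1 - s) + s := by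
  induction N with
  | zero => simp
  | succ N ih =>
    rw [Finset.sum_range_succ, ih, Finset.sum_Icc_succ_top (by omega : 1 ≤ N + 1 + 1), zetaTerm]
    push_cast
    rw [show (N : ℂ) + 1 + 1 = N + 2 by ring]
    ring

lemma summable_zetaTerm {s : ℂ} (hs : 0 < s.re) : Summable (fun n => zetaTerm n s) := by
  refine Summable.of_norm_bounded (g := fun n : ℕ => ‖1 - s‖ * ‖s‖ * ((n : ℝ) + 1) ^ (-s.re - 1))
    ?_ fun n => norm_zetaTerm_le n s hs
  refine Summable.mul_left _ ?_
  have h := (summable_nat_add_iff 1).mpr (Real.summable_nat_rpow (p := -s.re - 1) |>.mpr (by linarith))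
  simpa using h

lemma tsum_zetaTerm_of_one_lt {s : ℂ} (hs : 1 < s.re) :
    ∑' n, zetaTerm n s = s - riemannZeta₁ s := by
  have hs1 : s ≠ 1 := by rintro rfl; simp at hs
  have h1 := (summable_zetaTerm (s := s) (by linarith)).hasSum.tendsto_sum_nat
  refine tendsto_nhds_unique h1 ?_
  have h2 : Tendsto (fun N : ℕ => ∑ n ∈ Finset.Icc 1 (N + 1), (n : ℂ) ^ (-s)) atTop
      (𝓝 (riemannZeta s)) := by
    have hsum : Summable (fun n : ℕ => 1 / ((n : ℂ) + 1) ^ s) := by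
      have := (summable_nat_add_iff 1).mpr (Complex.summable_one_div_nat_cpow.mpr hs)
      simpa using this
    rw [zeta_eq_tsum_one_div_nat_add_one_cpow hs]
    have := (hsum.hasSum.tendsto_sum_nat).comp (tendsto_add_atTop_nat 1)
    refine this.congr fun N => ?_
    rw [Function.comp, ← sum_range_succ_eq_sum_Icc]
    refine Finset.sum_congr rfl fun n _ => ?_
    rw [Complex.cpow_neg, one_div]
    push_cast
    rfl
  have h3 : Tendsto (fun N : ℕ => ((N : ℂ) + 1) ^ (1 - s)) atTop (𝓝 0) := by
    rw [tendsto_zero_iff_norm_tendsto_zero]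
    have h4 := (tendsto_rpow_neg_atTop (show 0 < s.re - 1 by linarith)).comp
      ((tendsto_natCast_atTop_atTop (R := ℝ)).comp (tendsto_add_atTop_nat 1))
    refine h4.congr fun N => ?_
    have h5 := Complex.norm_cpow_eq_rpow_re_of_pos (show (0 : ℝ) < (N : ℝ) + 1 by positivity) (1 - s)
    push_cast at h5
    rw [h5]
    simp
  have h4 := ((h2.const_mul (1 - s)).sub h3).add_const s
  have h5 : (1 - s) * riemannZeta s - 0 + s = s - riemannZeta₁ s := by
    rw [riemannZeta_eq_inv_sub_mul hs1]
    have : s - 1 ≠ 0 := sub_ne_zero.mpr hs1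
    field_simp
    ring
  rw [h5] at h4
  exact h4.congr fun N => (sum_range_zetaTerm N s).symm

/-- The series `∑ zetaTerm n s` continues `s - (s - 1) ζ(s)` to the half-plane `Re s > 0`. -/
lemma tsum_zetaTerm {s : ℂ} (hs : 0 < s.re) : ∑' n, zetaTerm n s = s - riemannZeta₁ s := by
  set U : Set ℂ := {z | 0 < z.re} with hU
  have hUo : IsOpen U := isOpen_lt continuous_const Complex.continuous_re
  have hUc : IsPreconnected U := (convex_halfSpace_re_gt 0).isPreconnected
  have hdiff : DifferentiableOn ℂ (fun z => ∑' n, zetaTerm n z) U := by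
    intro z hz
    -- a bounded neighbourhood of `z` on which the real part stays away from `0`
    set V : Set ℂ := {w | z.re / 2 < w.re} ∩ Metric.ball z 1 with hV
    have hVo : IsOpen V := (isOpen_lt continuous_const Complex.continuous_re).inter Metric.isOpen_ball
    have hz0 : 0 < z.re := hz
    have hzV : z ∈ V := ⟨by change z.re / 2 < z.re; linarith, Metric.mem_ball_self one_pos⟩
    have hsum : Summable (fun n : ℕ => ((2 + ‖z‖) * (1 + ‖z‖)) * ((n : ℝ) + 1) ^ (-(z.re / 2) - 1)) := by
      refine Summable.mul_left _ ?_
      have h := (summable_nat_add_iff 1).mpr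
        (Real.summable_nat_rpow (p := -(z.re / 2) - 1) |>.mpr (by linarith))
      simpa using h
    have hd := Complex.differentiableOn_tsum_of_summable_norm hsum
      (fun n => (differentiable_zetaTerm n).differentiableOn) hVo (fun n w hw => by
        have hw1 : z.re / 2 < w.re := hw.1
        have hw2 : ‖w - z‖ < 1 := by simpa [dist_eq_norm] using hw.2
        refine (norm_zetaTerm_le n w (by linarith)).trans ?_
        have h1 : ‖w‖ ≤ 1 + ‖z‖ := by
          calc ‖w‖ = ‖(w - z) + z‖ := by ring_nf
            _ ≤ ‖w - z‖ + ‖z‖ := norm_add_le _ _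
            _ ≤ _ := by linarith
        have h2 : ‖1 - w‖ ≤ 2 + ‖z‖ := by
          refine (norm_sub_le _ _).trans ?_
          rw [norm_one]; linarith
        gcongr
        · linarith [(Nat.cast_nonneg n : (0 : ℝ) ≤ n)])
    exact (hd.differentiableAt (hVo.mem_nhds hzV)).differentiableWithinAt
  have han : AnalyticOnNhd ℂ (fun z => ∑' n, zetaTerm n z) U := hdiff.analyticOnNhd hUo
  have han2 : AnalyticOnNhd ℂ (fun z => z - riemannZeta₁ z) U :=
    (differentiable_id.sub differentiable_riemannZeta₁).differentiableOn.analyticOnNhd hUo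
  have h2 : (2 : ℂ) ∈ U := by simp [hU]
  refine han.eqOn_of_preconnected_of_eventuallyEq han2 hUc h2 ?_ hs
  have : {z : ℂ | 1 < z.re} ∈ 𝓝 (2 : ℂ) :=
    (isOpen_lt continuous_const Complex.continuous_re).mem_nhds (by simp)
  filter_upwards [this] with z hz
  exact tsum_zetaTerm_of_one_lt hz

/-- The partial sums of `∑ n^(-s)` for real `s`, with the main term `N^(1-s)/(1-s)` removed; meant
for `s ≠ 1`. -/
noncomputable def zetaPartial (s : ℝ) (N : ℕ) : ℝ :=
  ∑ n ∈ Finset.Icc 1 N, (n : ℝ) ^ (-s) - (N : ℝ) ^ (1 - s) / (1 - s)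

lemma tendsto_zetaPartial {s : ℝ} (hs : 0 < s) (hs1 : s ≠ 1) :
    Tendsto (fun N : ℕ => ((zetaPartial s (N + 1) : ℝ) : ℂ)) atTop (𝓝 (riemannZeta s)) := by
  have hs1' : (s : ℂ) ≠ 1 := by exact_mod_cast hs1
  have h1s : (1 : ℂ) - s ≠ 0 := sub_ne_zero.mpr hs1'.symm
  have h1 := (summable_zetaTerm (s := s) (by simpa using hs)).hasSum.tendsto_sum_nat
  rw [tsum_zetaTerm (by simpa using hs)] at h1
  have h2 := (h1.sub_const (s : ℂ)).div_const (1 - s : ℂ)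
  have h3 : ((s : ℂ) - riemannZeta₁ s - s) / (1 - s) = riemannZeta s := by
    rw [riemannZeta_eq_inv_sub_mul hs1']
    have : (s : ℂ) - 1 ≠ 0 := sub_ne_zero.mpr hs1'
    field_simp
    ring
  rw [h3] at h2
  refine h2.congr fun N => ?_
  rw [sum_range_zetaTerm, zetaPartial, Complex.ofReal_sub, Complex.ofReal_sum, Complex.ofReal_div,
    Complex.ofReal_cpow (by positivity)]
  have h4 : ∀ n ∈ Finset.Icc 1 (N + 1), (((n : ℝ) ^ (-s) : ℝ) : ℂ) = (n : ℂ) ^ (-(s : ℂ)) := by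
    intro n _
    rw [Complex.ofReal_cpow (by positivity)]
    push_cast; rfl
  rw [Finset.sum_congr rfl h4]
  push_cast
  field_simp
  ring

/-- `zetaPartial s` decreases, and increases once its last term is removed. -/
lemma zetaPartial_succ_bounds {s : ℝ} (hs : 0 < s) (hs1 : s ≠ 1) {N : ℕ} (hN : 1 ≤ N) :
    zetaPartial s (N + 1) ≤ zetaPartial s N ∧
      zetaPartial s N - (N : ℝ) ^ (-s) ≤ zetaPartial s (N + 1) - ((N + 1 : ℕ) : ℝ) ^ (-s) := by
  have hN0 : (0 : ℝ) < N := by exact_mod_cast hN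
  obtain ⟨c, hc, h⟩ := exists_rpow_div_sub_eq (p := 1 - s) (sub_ne_zero.mpr hs1.symm) (Or.inl hN0)
    (show (N : ℝ) < N + 1 by linarith)
  rw [show 1 - s - 1 = -s by ring, show (N : ℝ) + 1 - N = 1 by ring, mul_one] at h
  have h1 : c ^ (-s) ≤ (N : ℝ) ^ (-s) := Real.rpow_le_rpow_of_nonpos hN0 hc.1.le (by linarith)
  have h2 : ((N : ℝ) + 1) ^ (-s) ≤ c ^ (-s) :=
    Real.rpow_le_rpow_of_nonpos (hN0.trans hc.1) hc.2.le (by linarith)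
  unfold zetaPartial
  rw [Finset.sum_Icc_succ_top (by omega)]
  push_cast
  constructor <;> linarith

/-- On the positive real axis `ζ(s)` is real and lies within `N^(-s)` below `zetaPartial s N`. -/
lemma exists_riemannZeta_eq {s : ℝ} (hs : 0 < s) (hs1 : s ≠ 1) :
    ∃ z : ℝ, riemannZeta s = z ∧ ∀ N : ℕ, 1 ≤ N →
      z ≤ zetaPartial s N ∧ zetaPartial s N ≤ z + (N : ℝ) ^ (-s) := by
  have h0 := tendsto_zetaPartial hs hs1
  have h1 : Tendsto (fun N : ℕ => zetaPartial s (N + 1)) atTop (𝓝 (riemannZeta s).re) :=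
    (Complex.continuous_re.tendsto _).comp h0
  have h2 : Tendsto (fun N : ℕ => ((zetaPartial s (N + 1) : ℝ) : ℂ)) atTop
      (𝓝 ((riemannZeta s).re : ℂ)) := (Complex.continuous_ofReal.tendsto _).comp h1
  refine ⟨(riemannZeta s).re, tendsto_nhds_unique h0 h2, fun N hN => ?_⟩
  obtain ⟨M, rfl⟩ : ∃ M, N = M + 1 := ⟨N - 1, by omega⟩
  have ha : Antitone (fun N : ℕ => zetaPartial s (N + 1)) :=
    antitone_nat_of_succ_le fun n => (zetaPartial_succ_bounds hs hs1 (by omega)).1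
  have hm : Monotone (fun N : ℕ => zetaPartial s (N + 1) - ((N + 1 : ℕ) : ℝ) ^ (-s)) :=
    monotone_nat_of_le_succ fun n => (zetaPartial_succ_bounds hs hs1 (by omega)).2
  refine ⟨ha.le_of_tendsto h1 M, ?_⟩
  have h3 : Tendsto (fun N : ℕ => ((N + 1 : ℕ) : ℝ) ^ (-s)) atTop (𝓝 0) :=
    (tendsto_rpow_neg_atTop hs).comp
      ((tendsto_natCast_atTop_atTop (R := ℝ)).comp (tendsto_add_atTop_nat 1))
  have h4 := hm.ge_of_tendsto (by simpa using h1.sub h3) M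
  linarith

/-! ### The divisor sum for exponent zero -/

lemma sum_rpow_bounds {β : ℝ} (hβ : 0 ≤ β) (N : ℕ) :
    (N : ℝ) ^ (1 + β) / (1 + β) ≤ ∑ n ∈ Finset.Icc 1 N, (n : ℝ) ^ β ∧
      ∑ n ∈ Finset.Icc 1 N, (n : ℝ) ^ β ≤ (N : ℝ) ^ (1 + β) / (1 + β) + (N : ℝ) ^ β := by
  induction N with
  | zero =>
    have h : (0 : ℝ) ^ (1 + β) = 0 := Real.zero_rpow (by linarith)
    have h2 : (0 : ℝ) ≤ 0 ^ β := Real.rpow_nonneg le_rfl _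
    simpa [h] using h2
  | succ N ih =>
    have hN : (0 : ℝ) ≤ N := Nat.cast_nonneg N
    obtain ⟨c, hc, h⟩ := exists_rpow_div_sub_eq (p := 1 + β) (by linarith)
      (Or.inr (by linarith)) (show (N : ℝ) < N + 1 by linarith)
    rw [show 1 + β - 1 = β by ring, show (N : ℝ) + 1 - N = 1 by ring, mul_one] at h
    have h1 : c ^ β ≤ ((N : ℝ) + 1) ^ β := Real.rpow_le_rpow (hN.trans hc.1.le) hc.2.le hβ
    have h2 : (N : ℝ) ^ β ≤ c ^ β := Real.rpow_le_rpow hN hc.1.le hβ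
    rw [Finset.sum_Icc_succ_top (by omega)]
    push_cast
    constructor <;> linarith [ih.1, ih.2]

lemma abs_sum_floor_rpow_sub_le {β Y : ℝ} (hβ : 0 ≤ β) (hY : 0 ≤ Y) :
    |∑ n ∈ Finset.Icc 1 ⌊Y⌋₊, (n : ℝ) ^ β - Y ^ (1 + β) / (1 + β)| ≤ Y ^ β := by
  have hN : (0 : ℝ) ≤ (⌊Y⌋₊ : ℝ) := Nat.cast_nonneg _
  have hNY := Nat.floor_le hY
  have hYN := Nat.lt_floor_add_one Y
  have hNβ : (⌊Y⌋₊ : ℝ) ^ β ≤ Y ^ β := Real.rpow_le_rpow hN hNY hβ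
  have h := sum_rpow_bounds hβ ⌊Y⌋₊
  have hdiff : 0 ≤ Y ^ (1 + β) / (1 + β) - (⌊Y⌋₊ : ℝ) ^ (1 + β) / (1 + β) ∧
      Y ^ (1 + β) / (1 + β) - (⌊Y⌋₊ : ℝ) ^ (1 + β) / (1 + β) ≤ Y ^ β := by
    rcases hNY.eq_or_lt with he | hlt
    · rw [he]
      exact ⟨by simp, by simpa using Real.rpow_nonneg hY β⟩
    · obtain ⟨c, hc, hc'⟩ := exists_rpow_div_sub_eq (p := 1 + β) (by linarith)
        (Or.inr (by linarith)) hlt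
      rw [show 1 + β - 1 = β by ring] at hc'
      have hc0 : 0 ≤ c := hN.trans hc.1.le
      have h1 : c ^ β ≤ Y ^ β := Real.rpow_le_rpow hc0 hc.2.le hβ
      have h2 : 0 ≤ c ^ β := Real.rpow_nonneg hc0 _
      rw [hc']
      constructor <;> nlinarith
  rw [abs_le]
  constructor <;> linarith [h.1, h.2, hdiff.1, hdiff.2]

/-- The summatory function of `d_α` by Dirichlet's hyperbola method. -/
lemma sum_divisorPowerSum_eq (α : ℝ) (N : ℕ) :
    ∑ n ∈ Finset.Icc 1 N, divisorPowerSum α n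
      = ∑ a ∈ Finset.Icc 1 N.sqrt, ((a : ℝ) ^ α + (((N / a : ℕ) : ℝ) - a) * (a : ℝ) ^ α
          + (∑ b ∈ Finset.Icc 1 (N / a), (b : ℝ) ^ α - ∑ b ∈ Finset.Icc 1 a, (b : ℝ) ^ α)) := by
  have h1 := sum_divisors_eq_sum_sum (fun a _ => (a : ℝ) ^ α) N
  have h2 := sum_sum_eq_hyperbola (fun a _ => (a : ℝ) ^ α) N
  unfold divisorPowerSum
  rw [h1, h2]
  refine Finset.sum_congr rfl fun a ha => ?_
  have ha1 : 1 ≤ a := (Finset.mem_Icc.mp ha).1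
  have haN : a ≤ N / a := by
    rw [Nat.le_div_iff_mul_le (by omega)]
    exact Nat.le_sqrt.mp (Finset.mem_Icc.mp ha).2
  rw [add_assoc, Finset.sum_add_distrib, Finset.sum_const, Nat.card_Icc, nsmul_eq_mul]
  have h3 : ∑ b ∈ Finset.Icc 1 (N / a), (b : ℝ) ^ α
      = ∑ b ∈ Finset.Icc 1 a, (b : ℝ) ^ α + ∑ b ∈ Finset.Icc (a + 1) (N / a), (b : ℝ) ^ α := by
    have hz : ∀ n : ℕ, Finset.Icc 1 n = Finset.Ioc 0 n := fun n => rfl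
    have hz' : Finset.Icc (a + 1) (N / a) = Finset.Ioc a (N / a) := by
      ext x; simp only [Finset.mem_Icc, Finset.mem_Ioc]; omega
    rw [hz, hz, hz']
    exact (Finset.sum_Ioc_consecutive _ (Nat.zero_le a) haN).symm
  rw [h3]
  have h4 : ((N / a + 1 - (a + 1) : ℕ) : ℝ) = ((N / a : ℕ) : ℝ) - a := by
    rw [Nat.add_sub_add_right, Nat.cast_sub haN]
  rw [h4]
  ring

lemma floor_div_bounds {X : ℝ} (hX : 0 ≤ X) {a : ℕ} (ha : 1 ≤ a) :
    X / a - 1 ≤ ((⌊X⌋₊ / a : ℕ) : ℝ) ∧ ((⌊X⌋₊ / a : ℕ) : ℝ) ≤ X / a := by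
  rw [← Nat.floor_div_natCast]
  exact ⟨by linarith [Nat.lt_floor_add_one (X / a)], Nat.floor_le (by positivity)⟩

lemma sqrt_floor_bounds {X : ℝ} (hX : 0 ≤ X) :
    ((⌊X⌋₊.sqrt : ℕ) : ℝ) ≤ Real.sqrt X ∧ Real.sqrt X < ((⌊X⌋₊.sqrt : ℕ) : ℝ) + 1 := by
  constructor
  · apply Real.le_sqrt_of_sq_le
    have h : ((⌊X⌋₊.sqrt ^ 2 : ℕ) : ℝ) ≤ (⌊X⌋₊ : ℝ) := by exact_mod_cast Nat.sqrt_le' _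
    push_cast at h
    exact h.trans (Nat.floor_le hX)
  · rw [Real.sqrt_lt' (by positivity)]
    have h : ((⌊X⌋₊ + 1 : ℕ) : ℝ) ≤ (((⌊X⌋₊.sqrt + 1) ^ 2 : ℕ) : ℝ) := by
      exact_mod_cast Nat.succ_le_succ_sqrt' _
    push_cast at h
    exact (Nat.lt_floor_add_one X).trans_le h

/-- Dirichlet's divisor problem with explicit error term. -/
lemma abs_sum_divisorPowerSum_zero_sub_le {X : ℝ} (hX : 15.9 ≤ X) :
    |∑ n ∈ Finset.Icc 1 ⌊X⌋₊, divisorPowerSum 0 n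
        - (X * Real.log X + (2 * Real.eulerMascheroniConstant - 1) * X)| ≤ 5 * Real.sqrt X := by
  have hX0 : 0 < X := by linarith
  set Y := Real.sqrt X with hY
  have hYX : Y ^ 2 = X := Real.sq_sqrt hX0.le
  have hY3 : 3.98 ≤ Y := Real.le_sqrt_of_sq_le (by linarith)
  set γ := Real.eulerMascheroniConstant
  set m := ⌊X⌋₊.sqrt with hm
  obtain ⟨hmY, hYm⟩ := sqrt_floor_bounds hX0.le
  rw [← hY, ← hm] at hmY hYm
  have hm0 : (0 : ℝ) < m := by linarith
  have hm1 : 1 ≤ m := by exact_mod_cast hm0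
  have hsum : ∑ n ∈ Finset.Icc 1 ⌊X⌋₊, divisorPowerSum 0 n
      = 2 * ∑ a ∈ Finset.Icc 1 m, ((⌊X⌋₊ / a : ℕ) : ℝ) - (m : ℝ) ^ 2 := by
    rw [sum_divisorPowerSum_eq, ← hm]
    simp only [Real.rpow_zero, mul_one, Finset.sum_const, Nat.card_Icc, nsmul_eq_mul,
      Nat.add_sub_cancel]
    have h1 : ∀ k : ℕ, ∑ a ∈ Finset.Icc 1 k, (1 - 2 * (a : ℝ)) = -(k : ℝ) ^ 2 := by
      intro k
      induction k with
      | zero => simp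
      | succ k ih => rw [Finset.sum_Icc_succ_top (by omega), ih]; push_cast; ring
    rw [sub_eq_add_neg, ← h1, Finset.mul_sum, ← Finset.sum_add_distrib]
    exact Finset.sum_congr rfl fun a _ => by ring
  -- `∑ ⌊X / a⌋ = X ∑ 1 / a + O(m)`, and `∑_{a ≤ m} 1 / a = log m + γ + O(1 / m)`
  have hH : ∑ a ∈ Finset.Icc 1 m, (a : ℝ)⁻¹ = (harmonic m : ℝ) := by
    rw [harmonic_eq_sum_Icc]; push_cast; rfl
  have hq1 : X * (harmonic m : ℝ) - m ≤ ∑ a ∈ Finset.Icc 1 m, ((⌊X⌋₊ / a : ℕ) : ℝ) := by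
    have h : ∑ a ∈ Finset.Icc 1 m, (X / a - 1) ≤ ∑ a ∈ Finset.Icc 1 m, ((⌊X⌋₊ / a : ℕ) : ℝ) :=
      Finset.sum_le_sum fun a ha => (floor_div_bounds hX0.le (Finset.mem_Icc.mp ha).1).1
    rw [Finset.sum_sub_distrib] at h
    simp only [div_eq_mul_inv, ← Finset.mul_sum, hH, Finset.sum_const, Nat.card_Icc, nsmul_eq_mul,
      Nat.add_sub_cancel, mul_one] at h
    exact h
  have hq2 : ∑ a ∈ Finset.Icc 1 m, ((⌊X⌋₊ / a : ℕ) : ℝ) ≤ X * (harmonic m : ℝ) := by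
    have h : ∑ a ∈ Finset.Icc 1 m, ((⌊X⌋₊ / a : ℕ) : ℝ) ≤ ∑ a ∈ Finset.Icc 1 m, X / a :=
      Finset.sum_le_sum fun a ha => (floor_div_bounds hX0.le (Finset.mem_Icc.mp ha).1).2
    simp only [div_eq_mul_inv X, ← Finset.mul_sum, hH] at h
    exact h
  have hg1 : Real.log m + γ ≤ harmonic m := by
    have h := Real.eulerMascheroniConstant_lt_eulerMascheroniSeq' m
    rw [Real.eulerMascheroniSeq', if_neg (by omega)] at h
    linarith
  have hg2 : (harmonic m : ℝ) ≤ Real.log m + γ + 1 / m := by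
    have h := Real.eulerMascheroniSeq_lt_eulerMascheroniConstant m
    rw [Real.eulerMascheroniSeq] at h
    have h2 : Real.log ((m : ℝ) + 1) ≤ Real.log m + 1 / m := by
      have h3 : (m : ℝ) + 1 = m * (1 + 1 / m) := by field_simp
      rw [h3, Real.log_mul hm0.ne' (by positivity)]
      have := Real.log_le_sub_one_of_pos (x := 1 + 1 / (m : ℝ)) (by positivity)
      linarith
    linarith
  have hl1 : Real.log m ≤ Real.log Y := Real.log_le_log hm0 hmY
  have hl2 : Real.log Y ≤ Real.log m + 1 / m := by
    have h1 : Real.log Y ≤ Real.log (m * (1 + 1 / m)) := by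
      apply Real.log_le_log (by linarith)
      have : (m : ℝ) * (1 + 1 / m) = m + 1 := by field_simp
      linarith
    rw [Real.log_mul hm0.ne' (by positivity)] at h1
    have := Real.log_le_sub_one_of_pos (x := 1 + 1 / (m : ℝ)) (by positivity)
    linarith
  have hlY : Real.log X = 2 * Real.log Y := by
    rw [hY, Real.log_sqrt hX0.le]; ring
  have hXm : X * (1 / m) ≤ 1.34 * Y := by
    rw [mul_one_div, div_le_iff₀ hm0, ← hYX]
    nlinarith
  rw [hsum, hlY, abs_le]
  have e1 := mul_le_mul_of_nonneg_left hg1 hX0.le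
  have e2 := mul_le_mul_of_nonneg_left hg2 hX0.le
  have e3 := mul_le_mul_of_nonneg_left hl1 hX0.le
  have e4 := mul_le_mul_of_nonneg_left hl2 hX0.le
  have e5 : (m : ℝ) ^ 2 ≤ X := by rw [← hYX]; gcongr
  have e6 : X ≤ (m : ℝ) ^ 2 + 2 * Y := by rw [← hYX]; nlinarith
  constructor <;> linarith

/-! ### The divisor sum for positive exponents -/

/-- Replacing the integer `⌊X⌋ / a` by `X / a` in one term of the hyperbola sum. -/
lemma abs_hyperbola_term_sub_le {α X : ℝ} (hα : 0 ≤ α) (hX : 0 ≤ X) {a : ℕ} (ha : 1 ≤ a) :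
    |(a : ℝ) ^ α + (((⌊X⌋₊ / a : ℕ) : ℝ) - a) * (a : ℝ) ^ α
        + (∑ b ∈ Finset.Icc 1 (⌊X⌋₊ / a), (b : ℝ) ^ α - ∑ b ∈ Finset.Icc 1 a, (b : ℝ) ^ α)
        - (X * (a : ℝ) ^ (-(1 - α)) + X ^ (1 + α) / (1 + α) * (a : ℝ) ^ (-(1 + α))
          - (2 + α) / (1 + α) * (a : ℝ) ^ (1 + α))|
      ≤ (a : ℝ) ^ α + X ^ α * (a : ℝ) ^ (-α) := by
  have ha0 : (0 : ℝ) < a := by exact_mod_cast ha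
  have h1α : (1 + α) ≠ 0 := by linarith
  set v := (a : ℝ) ^ α with hv
  have hv0 : 0 < v := Real.rpow_pos_of_pos ha0 _
  have e1 : (a : ℝ) ^ (-(1 - α)) = v / a := by
    rw [show -(1 - α) = α - 1 by ring, Real.rpow_sub ha0, Real.rpow_one]
  have e2 : (a : ℝ) ^ (1 + α) = a * v := by rw [Real.rpow_add ha0, Real.rpow_one]
  have e3 : X ^ (1 + α) / (1 + α) * (a : ℝ) ^ (-(1 + α)) = (X / a) ^ (1 + α) / (1 + α) := by
    rw [Real.div_rpow hX ha0.le, Real.rpow_neg ha0.le]; ring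
  have e4 : X ^ α * (a : ℝ) ^ (-α) = (X / a) ^ α := by
    rw [Real.div_rpow hX ha0.le, Real.rpow_neg ha0.le]; ring
  have hB := abs_sum_floor_rpow_sub_le hα (show 0 ≤ X / a by positivity)
  rw [Nat.floor_div_natCast] at hB
  obtain ⟨q1, q2⟩ := floor_div_bounds hX ha
  have hA := sum_rpow_bounds hα a
  rw [e2, ← hv] at hA
  rw [e1, e3, e4, e2]
  set q : ℝ := ((⌊X⌋₊ / a : ℕ) : ℝ) with hq
  have hXa : X * (v / a) = X / a * v := by ring
  have hsplit : (2 + α) / (1 + α) * (a * v) = a * v + a * v / (1 + α) := by field_simp; ring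
  rw [hXa, hsplit]
  have f1 := mul_le_mul_of_nonneg_right q1 hv0.le
  have f2 := mul_le_mul_of_nonneg_right q2 hv0.le
  rw [abs_le] at hB ⊢
  constructor <;> linarith [hA.1, hA.2, hB.1, hB.2]

/-- The main terms of the hyperbola sum, cut at `m = ⌊√X⌋`, with `v = m^α`, `u = X^(α/2)` and
`w = u / v`. The three terms of order `X^(1 + α/2)` combine into a factor that vanishes when
`m² = X`. -/
lemma hyperbola_main_terms_cancel {α X m u v w z₁ z₂ Z₁ Z₂ P : ℝ} (hα : 0 < α) (hv : 0 < v)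
    (huw : u = w * v) :
    X * (Z₂ + v / α) + X * u ^ 2 / (1 + α) * (Z₁ - 1 / v / α) - (2 + α) / (1 + α) * P
        - (z₁ * (X * u ^ 2 / (1 + α)) + z₂ * X)
      = X * (Z₂ - z₂) + X * u ^ 2 / (1 + α) * (Z₁ - z₁)
        - (2 + α) / (1 + α) * (P - m ^ 2 * v / (2 + α))
        + v / (1 + α) * (X - m ^ 2 - X * ((w ^ 2 - 1) / α)) := by
  have h1 : 1 + α ≠ 0 := by linarith
  have h2 : 2 + α ≠ 0 := by linarith
  subst huw
  field_simp
  ring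

/-- A bound for the right-hand side of `hyperbola_main_terms_cancel`; `R` stands for
`(w ^ 2 - 1) / α`, which is `O(1 / m)` uniformly in `α`. -/
lemma abs_hyperbola_remainder_le {α X Y m u v w z₁ z₂ Z₁ Z₂ P R : ℝ} (hα : 0 < α)
    (hX0 : 0 < X) (hYX : Y ^ 2 = X) (hY0 : 0 < Y) (hmY : m ≤ Y) (hYm : Y < m + 1) (hm0 : 0 < m)
    (hv0 : 0 < v) (hu0 : 0 < u) (hvu : v ≤ u) (huw : u = w * v) (hw1 : 1 ≤ w) (hw3 : w ≤ 1.17)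
    (hXm : X * (1 / m) ≤ 1.34 * Y) (p1 : z₁ ≤ Z₁) (p2 : Z₁ ≤ z₁ + 1 / (m * v)) (p3 : z₂ ≤ Z₂)
    (p4 : Z₂ ≤ z₂ + v / m) (p5 : m ^ 2 * v / (2 + α) ≤ P)
    (p6 : P ≤ m ^ 2 * v / (2 + α) + m * v) (hR0 : 0 ≤ R) (hR1 : R ≤ 2.17 * (1 / m)) :
    |X * (Z₂ - z₂) + X * u ^ 2 / (1 + α) * (Z₁ - z₁)
        - (2 + α) / (1 + α) * (P - m ^ 2 * v / (2 + α))
        + v / (1 + α) * (X - m ^ 2 - X * R)| ≤ 4.91 * (Y * u) := by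
  have h1α : 0 < 1 + α := by linarith
  have hYu0 : 0 < Y * u := by positivity
  have b1 : 0 ≤ X * (Z₂ - z₂) := mul_nonneg hX0.le (by linarith)
  have b2 : X * (Z₂ - z₂) ≤ 1.34 * (Y * u) := by
    calc X * (Z₂ - z₂) ≤ X * (v / m) := by gcongr; linarith
      _ = X * (1 / m) * v := by ring
      _ ≤ 1.34 * Y * u := by gcongr
      _ = _ := by ring
  have b3 : 0 ≤ X * u ^ 2 / (1 + α) * (Z₁ - z₁) := mul_nonneg (by positivity) (by linarith)
  have b4 : X * u ^ 2 / (1 + α) * (Z₁ - z₁) ≤ 1.57 * (Y * u) := by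
    calc X * u ^ 2 / (1 + α) * (Z₁ - z₁) ≤ X * u ^ 2 / 1 * (1 / (m * v)) := by
          gcongr <;> linarith
      _ = X * (1 / m) * (w * u) := by rw [huw]; field_simp
      _ ≤ 1.34 * Y * (1.17 * u) := by gcongr
      _ ≤ _ := by linarith
  have b5 : 0 ≤ (2 + α) / (1 + α) * (P - m ^ 2 * v / (2 + α)) :=
    mul_nonneg (by positivity) (by linarith)
  have b6 : (2 + α) / (1 + α) * (P - m ^ 2 * v / (2 + α)) ≤ 2 * (Y * u) := by
    have h2 : (2 + α) / (1 + α) ≤ 2 := by rw [div_le_iff₀ h1α]; linarith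
    calc _ ≤ 2 * (m * v) := by
          gcongr
          linarith
      _ ≤ _ := by gcongr
  have c1 : 0 ≤ X - m ^ 2 := by nlinarith
  have c2 : X - m ^ 2 ≤ 2 * Y := by nlinarith
  have c3 : X * R ≤ 2.91 * Y := by
    calc X * R ≤ X * (2.17 * (1 / m)) := by gcongr
      _ = 2.17 * (X * (1 / m)) := by ring
      _ ≤ 2.17 * (1.34 * Y) := by gcongr
      _ ≤ _ := by linarith
  have c4 : 0 ≤ X * R := mul_nonneg hX0.le hR0
  have c5 : v / (1 + α) ≤ u := by rw [div_le_iff₀ h1α]; nlinarith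
  have c6 : 0 ≤ v / (1 + α) := by positivity
  have b7 : v / (1 + α) * (X - m ^ 2 - X * R) ≤ 2 * (Y * u) := by
    calc _ ≤ v / (1 + α) * (2 * Y) := by gcongr; linarith
      _ ≤ u * (2 * Y) := by gcongr
      _ = _ := by ring
  have b8 : -(2.91 * (Y * u)) ≤ v / (1 + α) * (X - m ^ 2 - X * R) := by
    have : v / (1 + α) * (-(X - m ^ 2 - X * R)) ≤ 2.91 * (Y * u) := by
      calc _ ≤ v / (1 + α) * (2.91 * Y) := by gcongr; linarith
        _ ≤ u * (2.91 * Y) := by gcongr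
        _ = _ := by ring
    linarith
  rw [abs_le]
  constructor <;> linarith

set_option maxHeartbeats 400000 in
/-- The Dirichlet divisor asymptotics for `d_α`, `0 < α ≤ 1/2`. The terms of order `X^(1 + α/2)`
coming from the two halves of the hyperbola cancel. -/
lemma abs_sum_divisorPowerSum_sub_le {α X : ℝ} (hα : 0 < α) (hα' : α ≤ 1 / 2) (hX : 15.9 ≤ X)
    {z₁ z₂ : ℝ}
    (hz₁ : ∀ N : ℕ, 1 ≤ N →
      z₁ ≤ zetaPartial (1 + α) N ∧ zetaPartial (1 + α) N ≤ z₁ + (N : ℝ) ^ (-(1 + α)))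
    (hz₂ : ∀ N : ℕ, 1 ≤ N →
      z₂ ≤ zetaPartial (1 - α) N ∧ zetaPartial (1 - α) N ≤ z₂ + (N : ℝ) ^ (-(1 - α))) :
    |∑ n ∈ Finset.Icc 1 ⌊X⌋₊, divisorPowerSum α n
        - (z₁ * (X ^ (1 + α) / (1 + α)) + z₂ * X)| ≤ 9 * (X ^ α * Real.sqrt X) := by
  have hX0 : 0 < X := by linarith
  set Y := Real.sqrt X with hY
  have hYX : Y ^ 2 = X := Real.sq_sqrt hX0.le
  have hY3 : 3.98 ≤ Y := Real.le_sqrt_of_sq_le (by linarith)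
  have hY0 : 0 < Y := by linarith
  set m := ⌊X⌋₊.sqrt with hm
  obtain ⟨hmY, hYm⟩ := sqrt_floor_bounds hX0.le
  rw [← hY, ← hm] at hmY hYm
  have hm2 : (2.98 : ℝ) ≤ m := by linarith
  have hm0 : (0 : ℝ) < m := by linarith
  have hm1 : 1 ≤ m := by exact_mod_cast hm0
  have h1α : 0 < 1 + α := by linarith
  set v := (m : ℝ) ^ α with hv
  set u := Y ^ α with hu
  have hv0 : 0 < v := Real.rpow_pos_of_pos hm0 _
  have hu1 : 1 ≤ u := Real.one_le_rpow (by linarith) hα.le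
  have hu0 : 0 < u := by linarith
  have hvu : v ≤ u := Real.rpow_le_rpow hm0.le hmY hα.le
  have hXα : X ^ α = u ^ 2 := by
    rw [← hYX, hu, ← Real.rpow_natCast, ← Real.rpow_natCast, ← Real.rpow_mul hY0.le,
      ← Real.rpow_mul hY0.le, mul_comm]
  have hX1α : X ^ (1 + α) = X * u ^ 2 := by rw [Real.rpow_add hX0, Real.rpow_one, hXα]
  have e1 : (m : ℝ) ^ (-(1 - α)) = v / m := by
    rw [show -(1 - α) = α - 1 by ring, Real.rpow_sub hm0, Real.rpow_one]
  have e2 : (m : ℝ) ^ (1 + α) = m * v := by rw [Real.rpow_add hm0, Real.rpow_one]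
  have e3 : (m : ℝ) ^ (-(1 + α)) = 1 / (m * v) := by rw [Real.rpow_neg hm0.le, e2, one_div]
  have e4 : (m : ℝ) ^ (1 + (1 + α)) = m ^ 2 * v := by
    rw [Real.rpow_add hm0, Real.rpow_one, e2]; ring
  have e5 : (m : ℝ) ^ (1 - (1 + α)) = 1 / v := by
    rw [show 1 - (1 + α) = -α by ring, Real.rpow_neg hm0.le, one_div]
  have e6 : (m : ℝ) ^ (1 - α) = m / v := by rw [Real.rpow_sub hm0, Real.rpow_one]
  -- by Bernoulli's inequality `w = (Y / m)^α` is close to `1`, to within `O(α / m)`; the factor `α`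
  -- compensates the denominators `α` in the main terms
  set w := u / v with hw
  have huw : u = w * v := by rw [hw]; field_simp
  have hw1 : 1 ≤ w := by rw [hw, le_div_iff₀ hv0]; linarith
  have hw2 : w ≤ 1 + α * (1 / m) := by
    have h1 : w = (Y / m) ^ α := by rw [hw, hu, hv, Real.div_rpow hY0.le hm0.le]
    have h2 : Y / m ≤ 1 + 1 / m := by
      rw [div_le_iff₀ hm0, add_mul, one_div_mul_cancel hm0.ne']; linarith
    rw [h1]
    refine (Real.rpow_le_rpow (by positivity) h2 hα.le).trans ?_
    exact rpow_one_add_le_one_add_mul_self (by linarith [show (0 : ℝ) ≤ 1 / m by positivity])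
      hα.le (by linarith)
  have hm3 : 1 / (m : ℝ) ≤ 0.34 := by rw [div_le_iff₀ hm0]; linarith
  have hw3 : w ≤ 1.17 := by
    have h1 : α * (1 / m) ≤ 1 / 2 * 0.34 := by gcongr
    linarith only [h1, hw2]
  have hXm : X * (1 / m) ≤ 1.34 * Y := by
    rw [mul_one_div, div_le_iff₀ hm0, ← hYX, sq, mul_right_comm]
    exact mul_le_mul_of_nonneg_right (by linarith only [hYm, hm2]) hY0.le
  -- the sum of the smooth approximations
  set A := ∑ a ∈ Finset.Icc 1 m, (X * (a : ℝ) ^ (-(1 - α))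
      + X ^ (1 + α) / (1 + α) * (a : ℝ) ^ (-(1 + α)) - (2 + α) / (1 + α) * (a : ℝ) ^ (1 + α)) with hA
  have hSA : |∑ n ∈ Finset.Icc 1 ⌊X⌋₊, divisorPowerSum α n - A| ≤ 3.34 * (Y * u) := by
    rw [sum_divisorPowerSum_eq, ← hm, hA, ← Finset.sum_sub_distrib]
    refine (Finset.abs_sum_le_sum_abs _ _).trans ?_
    refine (Finset.sum_le_sum fun a ha =>
      abs_hyperbola_term_sub_le hα.le hX0.le (Finset.mem_Icc.mp ha).1).trans ?_
    rw [Finset.sum_add_distrib, ← Finset.mul_sum]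
    have h1 : ∑ a ∈ Finset.Icc 1 m, (a : ℝ) ^ α ≤ m * v := by
      refine (Finset.sum_le_sum (g := fun _ => v) fun a ha => ?_).trans (by simp)
      exact Real.rpow_le_rpow (Nat.cast_nonneg a)
        (by exact_mod_cast (Finset.mem_Icc.mp ha).2) hα.le
    have h2 := sum_rpow_neg_le m α hα.le (by linarith)
    have h3 : (m : ℝ) ^ (1 - α) / (1 - α) ≤ 2 * (m / v) := by
      rw [e6, div_le_iff₀ (by linarith)]
      have h4 : 0 ≤ m / v * (1 - 2 * α) := mul_nonneg (by positivity) (by linarith only [hα'])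
      linarith only [h4]
    calc _ ≤ m * v + X ^ α * (2 * (m / v)) := by gcongr; exact h2.trans h3
      _ = m * v + 2 * (m * (w * u)) := by rw [hXα, hw]; field_simp
      _ ≤ Y * u + 2 * (Y * (1.17 * u)) := by gcongr
      _ = _ := by ring
  -- evaluation of that sum
  have hAeq : A = X * (zetaPartial (1 - α) m + v / α)
      + X * u ^ 2 / (1 + α) * (zetaPartial (1 + α) m - 1 / v / α)
      - (2 + α) / (1 + α) * ∑ a ∈ Finset.Icc 1 m, (a : ℝ) ^ (1 + α) := by
    rw [hA, Finset.sum_sub_distrib, Finset.sum_add_distrib, ← Finset.mul_sum, ← Finset.mul_sum,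
      ← Finset.mul_sum, zetaPartial, zetaPartial, e5, hX1α, show 1 - (1 - α) = α by ring, ← hv,
      show 1 - (1 + α) = -α by ring, div_neg]
    ring
  obtain ⟨p1, p2⟩ := hz₁ m hm1
  obtain ⟨p3, p4⟩ := hz₂ m hm1
  obtain ⟨p5, p6⟩ := sum_rpow_bounds h1α.le m
  rw [e3] at p2
  rw [e1] at p4
  rw [e4, show 1 + (1 + α) = 2 + α by ring] at p5 p6
  rw [e2] at p6
  set P := ∑ a ∈ Finset.Icc 1 m, (a : ℝ) ^ (1 + α)
  set Z₁ := zetaPartial (1 + α) m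
  set Z₂ := zetaPartial (1 - α) m
  set R := (w ^ 2 - 1) / α with hR
  have hR0 : 0 ≤ R := div_nonneg (by linarith [one_le_pow₀ hw1 (n := 2)]) hα.le
  have hR1 : R ≤ 2.17 * (1 / m) := by
    rw [hR, div_le_iff₀ hα]
    calc w ^ 2 - 1 = (w - 1) * (w + 1) := by ring
      _ ≤ α * (1 / m) * 2.17 :=
        mul_le_mul (by linarith) (by linarith) (by linarith) (by positivity)
      _ = _ := by ring
  have hkey : A - (z₁ * (X ^ (1 + α) / (1 + α)) + z₂ * X)
      = X * (Z₂ - z₂) + X * u ^ 2 / (1 + α) * (Z₁ - z₁)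
        - (2 + α) / (1 + α) * (P - m ^ 2 * v / (2 + α))
        + v / (1 + α) * (X - m ^ 2 - X * R) := by
    rw [hAeq, hX1α]
    exact hyperbola_main_terms_cancel hα hv0 huw
  have hrem := abs_hyperbola_remainder_le hα hX0 hYX hY0 hmY hYm hm0 hv0 hu0 hvu huw hw1 hw3 hXm
    p1 p2 p3 p4 p5 p6 hR0 hR1
  rw [← hkey] at hrem
  have hYu0 : 0 ≤ Y * u := by positivity
  have hfin : Y * u ≤ X ^ α * Y := by
    rw [hXα, show u ^ 2 * Y = Y * u * u by ring]
    exact le_mul_of_one_le_right hYu0 hu1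
  have htri := abs_sub_le (∑ n ∈ Finset.Icc 1 ⌊X⌋₊, divisorPowerSum α n) A
    (z₁ * (X ^ (1 + α) / (1 + α)) + z₂ * X)
  linarith only [htri, hSA, hrem, hfin, hYu0]

/-! ### The two asymptotic formulas -/

lemma norm_sub_le_of_norm_sub_ofReal_le {I : ℂ} {S M a b : ℝ} (h1 : ‖I - (S : ℂ)‖ ≤ a)
    (h2 : |S - M| ≤ b) : ‖I - (M : ℂ)‖ ≤ a + b := by
  have h3 : ‖(S : ℂ) - (M : ℂ)‖ ≤ b := by
    rw [← Complex.ofReal_sub, Complex.norm_real]; exact h2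
  exact (norm_sub_le_norm_sub_add_norm_sub I (S : ℂ) (M : ℂ)).trans (add_le_add h1 h3)

/-- Numerical bounds comparing `X = T / (2π)` with `T`. -/
lemma numerical_bounds {T : ℝ} (hT : 100 ≤ T) :
    15.9 ≤ T / (2 * Real.pi) ∧ Real.sqrt (T / (2 * Real.pi)) ≤ 0.399 * Real.sqrt T ∧
      Real.log (T / (2 * Real.pi)) ≤ Real.log T - 1.5 ∧ 4.5 ≤ Real.log T := by
  have hpi := Real.pi_pos
  have hpi2 := Real.pi_gt_d4
  have hpi4 := Real.pi_lt_d4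
  have hT0 : 0 < T := by linarith
  have he := Real.exp_one_lt_d9
  refine ⟨?_, ?_, ?_, ?_⟩
  · rw [le_div_iff₀ (by positivity)]; linarith
  · rw [Real.sqrt_le_left (by positivity), mul_pow, Real.sq_sqrt hT0.le, div_le_iff₀ (by positivity)]
    nlinarith
  · rw [Real.log_div hT0.ne' (by positivity)]
    have h : 1.5 ≤ Real.log (2 * Real.pi) := by
      rw [Real.le_log_iff_exp_le (by positivity)]
      have h2 : Real.exp 1.5 ^ 2 = Real.exp 1 ^ 3 := by
        rw [← Real.exp_nat_mul, ← Real.exp_nat_mul]; norm_num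
      have h3 : Real.exp 1 ^ 3 ≤ 2.7182818286 ^ 3 := by gcongr
      refine (pow_le_pow_iff_left₀ (by positivity) (by positivity) two_ne_zero).mp ?_
      rw [h2]
      nlinarith
    linarith
  · rw [Real.le_log_iff_exp_le hT0]
    refine le_trans ?_ hT
    have h2 : Real.exp 4.5 ^ 2 = Real.exp 1 ^ 9 := by
      rw [← Real.exp_nat_mul, ← Real.exp_nat_mul]; norm_num
    have h3 : Real.exp 1 ^ 9 ≤ 2.7182818286 ^ 9 := by gcongr
    refine (pow_le_pow_iff_left₀ (by positivity) (by positivity) two_ne_zero).mp ?_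
    rw [h2]
    exact h3.trans (by norm_num)

theorem proposition3p1 (T : ℝ) (hT : 100 ≤ T) (lam : ℝ) (hlam : 0 < lam) (hlam' : lam < 1 / 2) :
    ‖integralI (1 / 2) lam T (T / (2 * Real.pi))
        - ((T * Real.log T
            + (2 * Real.eulerMascheroniConstant - 1 - Real.log (2 * Real.pi)) * T : ℝ) : ℂ)‖
      ≤ 19.275 * Real.sqrt T * Real.log T
    ∧ ∀ τ : ℝ, 1 / 4 ≤ τ → τ < 1 / 2 →
      ‖integralI τ lam T (T / (2 * Real.pi))
          - (riemannZeta ((2 - 2 * τ : ℝ) : ℂ)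
                / (((2 - 2 * τ) * (2 * Real.pi) ^ (1 - 2 * τ) : ℝ) : ℂ)
                * ((T ^ (2 - 2 * τ) : ℝ) : ℂ)
              + riemannZeta ((2 * τ : ℝ) : ℂ) * (T : ℂ))‖
        ≤ (1.99 / (1 / 2 - τ) + 35.354) * T ^ (3 / 2 - 2 * τ) * Real.log T := by
  have hpi := Real.pi_pos
  have hpi4 := Real.pi_lt_d4
  have hT0 : 0 < T := by linarith
  obtain ⟨hX15, hsqrt, hlog, hlogT⟩ := numerical_bounds hT
  have hTX : 2 * Real.pi * (T / (2 * Real.pi)) = T := by field_simp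
  have hlogX : Real.log (T / (2 * Real.pi)) = Real.log T - Real.log (2 * Real.pi) :=
    Real.log_div hT0.ne' (by positivity)
  have hXT : T / (2 * Real.pi) ≤ T := by
    rw [div_le_iff₀ (by positivity)]; nlinarith [Real.pi_gt_three]
  set X := T / (2 * Real.pi) with hX
  have hX0 : 0 < X := by linarith
  have hL0 : 0 ≤ Real.log X := Real.log_nonneg (by linarith)
  have hsX0 : 0 ≤ Real.sqrt X := Real.sqrt_nonneg X
  have hsT0 : 0 ≤ Real.sqrt T := Real.sqrt_nonneg T
  have hscale : ∀ {S M b : ℝ}, |S - M| ≤ b →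
      |2 * Real.pi * S - 2 * Real.pi * M| ≤ 6.2832 * b := by
    intro S M b h
    rw [← mul_sub, abs_mul, abs_of_pos (by positivity : 0 < 2 * Real.pi)]
    exact mul_le_mul (by linarith) h (abs_nonneg _) (by norm_num)
  constructor
  · have h1 := norm_integralI_sub_sum_le (1 / 2) lam T (by norm_num) le_rfl hT hlam hlam' X hX
    rw [show (1 - 2 * (1 / 2) : ℝ) = 0 by norm_num, Real.rpow_zero, one_mul] at h1
    have h2 := norm_sub_le_of_norm_sub_ofReal_le h1
      (hscale (abs_sum_divisorPowerSum_zero_sub_le hX15))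
    have h3 : 2 * Real.pi * (X * Real.log X + (2 * Real.eulerMascheroniConstant - 1) * X)
        = T * Real.log T
          + (2 * Real.eulerMascheroniConstant - 1 - Real.log (2 * Real.pi)) * T := by
      rw [hlogX]
      linear_combination (Real.log T - Real.log (2 * Real.pi)
        + (2 * Real.eulerMascheroniConstant - 1)) * hTX
    rw [h3] at h2
    refine h2.trans ?_
    calc Real.sqrt X * (31.3 * Real.log X + 73.2) + 6.2832 * (5 * Real.sqrt X)
        = Real.sqrt X * (31.3 * Real.log X + 104.616) := by ring
      _ ≤ 0.399 * Real.sqrt T * (31.3 * (Real.log T - 1.5) + 104.616) := by gcongr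
      _ = Real.sqrt T * (0.399 * (31.3 * (Real.log T - 1.5) + 104.616)) := by ring
      _ ≤ Real.sqrt T * (19.275 * Real.log T) :=
        mul_le_mul_of_nonneg_left (by linarith) hsT0
      _ = _ := by ring
  · intro τ hτ hτ'
    have h1 := norm_integralI_sub_sum_le τ lam T hτ hτ'.le hT hlam hlam' X hX
    obtain ⟨z₁, hz₁, hz₁'⟩ := exists_riemannZeta_eq (s := 2 - 2 * τ) (by linarith) (by linarith)
    obtain ⟨z₂, hz₂, hz₂'⟩ := exists_riemannZeta_eq (s := 2 * τ) (by linarith) (by linarith)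
    have e1 : 1 + (1 - 2 * τ) = 2 - 2 * τ := by ring
    have e2 : 1 - (1 - 2 * τ) = 2 * τ := by ring
    have h2 := norm_sub_le_of_norm_sub_ofReal_le h1
      (hscale (abs_sum_divisorPowerSum_sub_le (α := 1 - 2 * τ) (by linarith) (by linarith) hX15
        (z₁ := z₁) (z₂ := z₂) (by rw [e1]; exact hz₁') (by rw [e2]; exact hz₂')))
    have h3 : 2 * Real.pi * (z₁ * (X ^ (1 + (1 - 2 * τ)) / (1 + (1 - 2 * τ))) + z₂ * X)
        = z₁ / ((2 - 2 * τ) * (2 * Real.pi) ^ (1 - 2 * τ)) * T ^ (2 - 2 * τ) + z₂ * T := by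
      have h4 : (2 * Real.pi) ^ (2 - 2 * τ) = 2 * Real.pi * (2 * Real.pi) ^ (1 - 2 * τ) := by
        rw [← e1, Real.rpow_add (by positivity), Real.rpow_one]
      have h5 : 0 < (2 * Real.pi) ^ (1 - 2 * τ) := Real.rpow_pos_of_pos (by positivity) _
      have h6 : 2 - 2 * τ ≠ 0 := by linarith
      rw [e1, hX, Real.div_rpow hT0.le (by positivity), h4]
      generalize (2 * Real.pi) ^ (1 - 2 * τ) = c at h5
      field_simp
    rw [h3] at h2
    rw [hz₁, hz₂]
    push_cast at h2 ⊢
    refine h2.trans ?_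
    have h7 : T ^ (3 / 2 - 2 * τ) = T ^ (1 - 2 * τ) * Real.sqrt T := by
      rw [Real.sqrt_eq_rpow, ← Real.rpow_add hT0]; congr 1; ring
    have h8 : X ^ (1 - 2 * τ) ≤ T ^ (1 - 2 * τ) := Real.rpow_le_rpow hX0.le hXT (by linarith)
    have h9 : 0 ≤ X ^ (1 - 2 * τ) := Real.rpow_nonneg hX0.le _
    have h10 : 0 ≤ T ^ (1 - 2 * τ) := Real.rpow_nonneg hT0.le _
    have h11 : 0 ≤ 1.99 / (1 / 2 - τ) := div_nonneg (by norm_num) (by linarith)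
    rw [h7]
    calc X ^ (1 - 2 * τ) * Real.sqrt X * (31.3 * Real.log X + 73.2)
          + 6.2832 * (9 * (X ^ (1 - 2 * τ) * Real.sqrt X))
        = X ^ (1 - 2 * τ) * Real.sqrt X * (31.3 * Real.log X + 129.7488) := by ring
      _ ≤ T ^ (1 - 2 * τ) * (0.399 * Real.sqrt T)
          * (31.3 * (Real.log T - 1.5) + 129.7488) := by gcongr
      _ = T ^ (1 - 2 * τ) * Real.sqrt T
          * (0.399 * (31.3 * (Real.log T - 1.5) + 129.7488)) := by ring
      _ ≤ T ^ (1 - 2 * τ) * Real.sqrt T * ((1.99 / (1 / 2 - τ) + 35.354) * Real.log T) := by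
        refine mul_le_mul_of_nonneg_left ?_ (by positivity)
        have h12 : 0 ≤ 1.99 / (1 / 2 - τ) * Real.log T := mul_nonneg h11 (by linarith)
        linarith
      _ = _ := by ring
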